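/- Notation. A sequence $S=s_1,\dots,s_n$ over a linearly ordered set contains a permutation $\pi$ of $[k]$ if there are indices $i_1<\dots<i_k$ with $s_{i_j}<s_{i_\ell}\iff\pi_j<\pi_\ell$ for all $j,\ell$; otherwise $S$ avoids $\pi$. A binary matrix contains $\pi$ if the permutation matrix of $\pi$ can be obtained from it by deleting rows and columns and changing some 1-entries to 0. Let $\mathrm{ex}_\pi(N)$ be the maximum number of 1-entries in an $N\times N$ binary matrix that does not contain $\pi$ (and $0$ if there is no such matrix), and let $c_\pi=\lim_{N\to\infty}\mathrm{ex}_\pi(N)/N$ be the Füredi–Hajnal limit. Logarithms are to base 2. Computational model. Comparison-based word RAM with words of $\log n+O(1)$ bits: word variables and arrays with random access; arithmetic on words, memory access, comparing two input elements and writing an input element to the output each take unit time; input elements can only be compared and output. Theorem. The limit $c_\pi$ exists for every permutation $\pi$. There are an algorithm (a single program on this machine) and an absolute constant $C$ such that the following holds. Let $\pi$ be any permutation, let $n\ge 2$, and let $S$ be a $\pi$-avoiding sequence of length $n$ (repeated values allowed) over a linearly ordered set that is the concatenation $S=S_1S_2\cdots S_m$ of $m\le n/\log n$ (possibly empty) sequences,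 each sorted in non-decreasing order. Given the elements of $S$ and the numbers $n$, $m$, $|S_1|,\dots,|S_m|$, but not $\pi$ or $c_\pi$, the algorithm halts after at most $C\,(\log c_\pi+1)\,n$ steps, and its output is the sequence $S$ sorted in non-decreasing order. -/

import Mathlib

open Filter Topology

namespace PatternMerge

/-! ### Patterns, matrices and the Füredi–Hajnal limit -/

/-- The sequence `S` contains the permutation `π`: some subsequence of `S` is order-isomorphic
to `π`. -/
def SeqContains {α : Type*} [LinearOrder α] {k : ℕ} (S : List α) (π : Equiv.Perm (Fin k)) :
    Prop :=
  ∃ f : Fin k ↪o Fin S.length, ∀ a b : Fin k, S.get (f a) < S.get (f b) ↔ π a < π b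

/-- The sequence `S` avoids `π`. -/
def SeqAvoids {α : Type*} [LinearOrder α] {k : ℕ} (S : List α) (π : Equiv.Perm (Fin k)) : Prop :=
  ¬ SeqContains S π

/-- The binary matrix `M` contains the binary matrix `P`: deleting rows and columns of `M` and
turning some 1-entries into 0-entries gives `P`. -/
def MatContains {m n k l : ℕ} (M : Matrix (Fin m) (Fin n) Bool) (P : Matrix (Fin k) (Fin l) Bool) :
    Prop :=
  ∃ (f : Fin k ↪o Fin m) (g : Fin l ↪o Fin n),
    ∀ i j, P i j = true → M (f i) (g j) = true

/-- The binary matrix of `π`: the entry `(i, j)` (column `i`, row `j`) is 1 iff `j = π i`. -/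
def permMat {k : ℕ} (π : Equiv.Perm (Fin k)) : Matrix (Fin k) (Fin k) Bool :=
  Matrix.of fun i j => decide (j = π i)

/-- The number of 1-entries of a binary matrix. -/
def ones {m n : ℕ} (M : Matrix (Fin m) (Fin n) Bool) : ℕ :=
  (Finset.univ.filter fun p : Fin m × Fin n => M p.1 p.2 = true).card

open Classical in
/-- The maximum number of 1-entries in an `n × n` binary matrix that avoids `π`. -/
noncomputable def ex {k : ℕ} (π : Equiv.Perm (Fin k)) (n : ℕ) : ℕ :=
  (Finset.univ.filter fun M : Matrix (Fin n) (Fin n) Bool => ¬ MatContains M (permMat π)).sup ones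

/-- The Füredi–Hajnal limit `c_π = lim ex_π(n) / n`. -/
noncomputable def furediHajnal {k : ℕ} (π : Equiv.Perm (Fin k)) : ℝ :=
  limUnder atTop fun n : ℕ => (ex π n : ℝ) / n

/-! ### A comparison-based word RAM

A program uses finitely many word variables and word arrays with random access.  The input
elements sit in a read-only list `S`; a program addresses them by their position, and the only
things it can do with them is to compare two of them and to write one of them to the output.
Every operation on words, every access to memory, every comparison and every output step costs
one unit of time.  All words that occur must be at most the capacity `W` of the machine;
a computation that leaves this range, or addresses an element outside `S`, is stuck. -/

/-- The content of the memory, and the list of the elements output so far. -/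
structure Store (α : Type*) where
  var : ℕ → ℕ
  arr : ℕ → ℕ → ℕ
  out : List α

/-- Word expressions; `get a e` is the entry of array `a` at address `e`, and `sub` is truncated
subtraction. -/
inductive Expr where
  | const (c : ℕ)
  | var (x : ℕ)
  | get (a : ℕ) (e : Expr)
  | add (e f : Expr)
  | sub (e f : Expr)
  | mul (e f : Expr)
  | div (e f : Expr)

namespace Expr

/-- The value of an expression. -/
def eval {α : Type*} (σ : Store α) : Expr → ℕ
  | const c => c
  | var x => σ.var x
  | get a e => σ.arr a (e.eval σ)
  | add e f => e.eval σ + f.eval σ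
  | sub e f => e.eval σ - f.eval σ
  | mul e f => e.eval σ * f.eval σ
  | div e f => e.eval σ / f.eval σ

/-- All values that occur in the evaluation of an expression are at most `W`. -/
def Fits {α : Type*} (W : ℕ) (σ : Store α) : Expr → Prop
  | const c => c ≤ W
  | var x => σ.var x ≤ W
  | get a e => e.Fits W σ ∧ σ.arr a (e.eval σ) ≤ W
  | add e f => e.Fits W σ ∧ f.Fits W σ ∧ e.eval σ + f.eval σ ≤ W
  | sub e f => e.Fits W σ ∧ f.Fits W σ
  | mul e f => e.Fits W σ ∧ f.Fits W σ ∧ e.eval σ * f.eval σ ≤ W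
  | div e f => e.Fits W σ ∧ f.Fits W σ

/-- The time to evaluate an expression. -/
def cost : Expr → ℕ
  | const _ => 1
  | var _ => 1
  | get _ e => e.cost + 1
  | add e f => e.cost + f.cost + 1
  | sub e f => e.cost + f.cost + 1
  | mul e f => e.cost + f.cost + 1
  | div e f => e.cost + f.cost + 1

end Expr

/-- Tests; `elemLe e f` compares the input elements at the positions `e` and `f`. -/
inductive Test where
  | lt (e f : Expr)
  | elemLe (e f : Expr)
  | not (b : Test)
  | and (b c : Test)

namespace Test

/-- The outcome of a test. -/
def Holds {α : Type*} [LinearOrder α] (S : List α) (σ : Store α) : Test → Prop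
  | lt e f => e.eval σ < f.eval σ
  | elemLe e f => ∃ x ∈ S[e.eval σ]?, ∃ y ∈ S[f.eval σ]?, x ≤ y
  | not b => ¬ b.Holds S σ
  | and b c => b.Holds S σ ∧ c.Holds S σ

/-- The evaluation of a test stays within the word capacity and compares existing elements only.
In a conjunction the second test is evaluated only if the first one holds. -/
def Fits {α : Type*} [LinearOrder α] (W : ℕ) (S : List α) (σ : Store α) : Test → Prop
  | lt e f => e.Fits W σ ∧ f.Fits W σ
  | elemLe e f => e.Fits W σ ∧ f.Fits W σ ∧ e.eval σ < S.length ∧ f.eval σ < S.length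
  | not b => b.Fits W S σ
  | and b c => b.Fits W S σ ∧ (b.Holds S σ → c.Fits W S σ)

/-- The time to evaluate a test (both parts of a conjunction are always charged). -/
def cost : Test → ℕ
  | lt e f => e.cost + f.cost + 1
  | elemLe e f => e.cost + f.cost + 1
  | not b => b.cost + 1
  | and b c => b.cost + c.cost + 1

end Test

/-- Programs.  They do not refer to the type of the elements. -/
inductive Prog where
  | skip
  | assign (x : ℕ) (e : Expr)
  | put (a : ℕ) (i e : Expr)
  | emit (i : Expr)
  | seq (P Q : Prog)
  | branch (b : Test) (P Q : Prog)
  | loop (b : Test) (P : Prog)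

/-- `Exec W S P σ t τ`: on a machine of word capacity `W` and with input elements `S`, the
program `P` started in `σ` terminates in `τ` after exactly `t` steps. -/
inductive Exec {α : Type*} [LinearOrder α] (W : ℕ) (S : List α) :
    Prog → Store α → ℕ → Store α → Prop
  | skip (σ : Store α) : Exec W S .skip σ 1 σ
  | assign (σ : Store α) (x : ℕ) (e : Expr) (he : e.Fits W σ) :
      Exec W S (.assign x e) σ (e.cost + 1)
        { σ with var := Function.update σ.var x (e.eval σ) }
  | put (σ : Store α) (a : ℕ) (i e : Expr) (hi : i.Fits W σ) (he : e.Fits W σ) :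
      Exec W S (.put a i e) σ (i.cost + e.cost + 1)
        { σ with
          arr := Function.update σ.arr a (Function.update (σ.arr a) (i.eval σ) (e.eval σ)) }
  | emit (σ : Store α) (i : Expr) (hi : i.Fits W σ) (hS : i.eval σ < S.length) :
      Exec W S (.emit i) σ (i.cost + 1) { σ with out := σ.out ++ [S[i.eval σ]] }
  | seq {P Q : Prog} {σ τ ρ : Store α} {s t : ℕ} (hP : Exec W S P σ s τ)
      (hQ : Exec W S Q τ t ρ) : Exec W S (.seq P Q) σ (s + t) ρ
  | branchTrue {b : Test} {P Q : Prog} {σ τ : Store α} {t : ℕ} (hf : b.Fits W S σ)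
      (hb : b.Holds S σ) (hP : Exec W S P σ t τ) :
      Exec W S (.branch b P Q) σ (b.cost + t) τ
  | branchFalse {b : Test} {P Q : Prog} {σ τ : Store α} {t : ℕ} (hf : b.Fits W S σ)
      (hb : ¬ b.Holds S σ) (hQ : Exec W S Q σ t τ) :
      Exec W S (.branch b P Q) σ (b.cost + t) τ
  | loopTrue {b : Test} {P : Prog} {σ τ ρ : Store α} {s t : ℕ} (hf : b.Fits W S σ)
      (hb : b.Holds S σ) (hP : Exec W S P σ s τ) (hL : Exec W S (.loop b P) τ t ρ) :
      Exec W S (.loop b P) σ (b.cost + s + t) ρ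
  | loopFalse {b : Test} {P : Prog} {σ : Store α} (hf : b.Fits W S σ) (hb : ¬ b.Holds S σ) :
      Exec W S (.loop b P) σ b.cost σ

/-- The initial memory for the sequences `L = [S₁, …, Sₘ]`: variable 0 holds the total length,
variable 1 holds `m`, array 0 holds the lengths of the sequences; the rest is 0, and nothing has
been output. -/
def mergeInput {α : Type*} (L : List (List α)) : Store α where
  var x := if x = 0 then L.flatten.length else if x = 1 then L.length else 0
  arr a i := if a = 0 then (L.map List.length).getD i 0 else 0
  out := []

/-- Given the sequences in `L`, laid out one after the other, `P` halts after exactly `t` steps on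
a machine of word capacity `W` and its output is `out`. -/
def MergesTo {α : Type*} [LinearOrder α] (W : ℕ) (P : Prog) (L : List (List α)) (t : ℕ)
    (out : List α) : Prop :=
  ∃ τ : Store α, Exec W L.flatten P (mergeInput L) t τ ∧ τ.out = out

end PatternMerge

namespace PatternMerge

/-! ### Extremal numbers of permutation matrices -/

/-! A single winner tree over all m sequences would cost log m per element; locality improves this
to log c_π. The sequences are cut into G = ⌈m/K⌉ groups of K neighbours, each with its own winner
tree. A tree with K slots holds the heads of recently used groups, and a third tree holds the heads
of all other groups. If the next element lies in a group that has a slot, its output touches only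
trees with K leaves and costs O(log K). Otherwise that group must first be loaded into a slot, for
O(log n). A window ends, and its slots are emptied, when K·⌊log n⌋ elements have been output in it,
or when another group is needed while all K slots are full. A phase therefore costs O(n log K),
provided that there are O(n / log n) loads.

That loads are rare is extremal combinatorics. Let X be the set of ranks at which the first load of
a window happens. Every other load is sent to a cell: its column is the group, its row is the place
of the element among the values at X and the gaps between them. A group is loaded at most once per
window, so two loads of one group are separated by an element of X, which makes the map injective
(`gapIndex_injOn`); equal values do no harm because they are output in the order of their positions.
Columns are monotone in the position and rows in the value, so a copy of π among the cells gives one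
in the sequence (`loadBound_of_avoids`). Hence at most D(G + 2|X| + 1) loads lie outside X, where D
= ⌈c_π⌉. Conversely, a completed window has used up K·⌊log n⌋ outputs or K loads, which bounds |X|
by n and the number of loads. For K ≥ 6D the two inequalities together give fewer than 40⌊n / ⌊log
n⌋⌋ loads (`Ghost.loads_lt`).

As c_π is unknown, a phase is broken off when it reaches this number of loads. Then K is squared,
and the next phase continues after the elements already output. From K = 8 on, the cost n log K
doubles from phase to phase, so the last phase dominates and the total is O(n (log c_π + 1))
(`runs_phases`, `exists_phases`). If the square would exceed m + 6, all sequences are put into one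
group instead; the load count then holds with D = 1 without any pattern (`loadBound_single`).

The load count needs ex_π(N) ≤ c_π N for every N, not only asymptotically. The Marcus–Tardos
recursion (`ex_le_ex_blocks`) makes ex_π linear, and gluing two avoiding matrices makes it
superadditive (`ex_add_le`). By Fekete's lemma the limit exists and is the supremum of ex_π(N)/N
(`tendsto_ex_div`). -/

/-- The finite point set `A` contains the permutation `π`. -/
def PtsContain {k : ℕ} (π : Equiv.Perm (Fin k)) (A : Finset (ℕ × ℕ)) : Prop :=
  ∃ f g : Fin k → ℕ, StrictMono f ∧ StrictMono g ∧ ∀ i, (f i, g (π i)) ∈ A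

/-- Point sets in ℕ × ℕ replace matrices from here on: shifts, transposition and division into
blocks become images of finite sets. -/
theorem card_le_ex {k : ℕ} {π : Equiv.Perm (Fin k)} {A : Finset (ℕ × ℕ)} {N : ℕ}
    (hA : ¬ PtsContain π A) (hN : ∀ p ∈ A, p.1 < N ∧ p.2 < N) : A.card ≤ ex π N := by
  classical
  let M : Matrix (Fin N) (Fin N) Bool := Matrix.of fun i j => decide (((i : ℕ), (j : ℕ)) ∈ A)
  have hM : ¬ MatContains M (permMat π) := by
    rintro ⟨f, g, h⟩
    refine hA ⟨fun i => f i, fun i => g i, fun a b hab => ?_, fun a b hab => ?_, fun i => ?_⟩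
    · exact f.strictMono hab
    · exact g.strictMono hab
    · have := h i (π i) (by simp [permMat])
      simpa [M] using this
  have hones : A.card ≤ ones M := by
    unfold ones
    refine Finset.card_le_card_of_surjOn (fun p : Fin N × Fin N => ((p.1 : ℕ), (p.2 : ℕ))) ?_
    intro p hp
    obtain ⟨h1, h2⟩ := hN p hp
    refine ⟨(⟨p.1, h1⟩, ⟨p.2, h2⟩), ?_, rfl⟩
    simpa [M] using hp
  refine hones.trans ?_
  unfold ex
  exact Finset.le_sup (f := ones) (by simpa using hM)

theorem exists_card_eq_ex {k : ℕ} (π : Equiv.Perm (Fin k)) (hk : 0 < k) (N : ℕ) :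
    ∃ A : Finset (ℕ × ℕ), ¬ PtsContain π A ∧ (∀ p ∈ A, p.1 < N ∧ p.2 < N) ∧ A.card = ex π N := by
  classical
  have hne : (Finset.univ.filter fun M : Matrix (Fin N) (Fin N) Bool =>
      ¬ MatContains M (permMat π)).Nonempty := by
    -- The zero matrix avoids π only because `0 < k`; for the empty pattern no matrix qualifies.
    refine ⟨Matrix.of fun _ _ => false, ?_⟩
    simp only [Finset.mem_filter, Finset.mem_univ, true_and]
    rintro ⟨f, g, h⟩
    have := h ⟨0, hk⟩ (π ⟨0, hk⟩) (by simp [permMat])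
    simp at this
  obtain ⟨M, hM, hs⟩ := Finset.exists_mem_eq_sup _ hne ones
  simp only [Finset.mem_filter, Finset.mem_univ, true_and] at hM
  refine ⟨(Finset.univ.filter fun p : Fin N × Fin N => M p.1 p.2 = true).image
    fun p => ((p.1 : ℕ), (p.2 : ℕ)), ?_, ?_, ?_⟩
  · rintro ⟨f, g, hf, hg, h⟩
    apply hM
    have hfN : ∀ i, ∃ p : Fin N × Fin N, M p.1 p.2 = true ∧ (p.1 : ℕ) = f i ∧
        (p.2 : ℕ) = g (π i) := by
      intro i
      obtain ⟨p, hp, he⟩ := Finset.mem_image.1 (h i)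
      refine ⟨p, by simpa using hp, ?_, ?_⟩
      · exact congrArg Prod.fst he
      · exact congrArg Prod.snd he
    choose p hp1 hp2 hp3 using hfN
    refine ⟨OrderEmbedding.ofStrictMono (fun i => (p i).1) ?_,
      OrderEmbedding.ofStrictMono (fun j => (p (π.symm j)).2) ?_, ?_⟩
    · intro a b hab
      show ((p a).1 : ℕ) < (p b).1
      rw [hp2, hp2]; exact hf hab
    · intro a b hab
      show ((p _).2 : ℕ) < (p _).2
      rw [hp3, hp3]; simpa using hg hab
    · intro i j hij
      have : j = π i := by simpa [permMat] using hij
      subst this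
      show M (p i).1 (p (π.symm (π i))).2 = true
      rw [Equiv.symm_apply_apply]; exact hp1 i
  · intro q hq
    obtain ⟨p, -, rfl⟩ := Finset.mem_image.1 hq
    exact ⟨p.1.2, p.2.2⟩
  · rw [Finset.card_image_of_injective]
    · unfold ex; rw [hs]; rfl
    · rintro ⟨a, b⟩ ⟨c, d⟩ h
      simp only [Prod.mk.injEq] at h
      ext <;> simp [h]

/-- Every matrix contains the empty pattern, so the supremum runs over the empty set and takes its
default value 0. -/
theorem ex_eq_zero_of_zero (π : Equiv.Perm (Fin 0)) (N : ℕ) : ex π N = 0 := by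
  classical
  unfold ex
  rw [Finset.filter_false_of_mem, Finset.sup_empty]; · rfl
  intro M _
  rw [not_not]
  exact ⟨OrderEmbedding.ofStrictMono Fin.elim0 (fun a => a.elim0),
    OrderEmbedding.ofStrictMono Fin.elim0 (fun a => a.elim0), fun i => i.elim0⟩

theorem ex_eq_zero_of_one (π : Equiv.Perm (Fin 1)) (N : ℕ) : ex π N = 0 := by
  obtain ⟨A, hA, -, hc⟩ := exists_card_eq_ex π one_pos N
  rw [← hc, Finset.card_eq_zero]
  by_contra hne
  obtain ⟨p, hp⟩ := Finset.nonempty_iff_ne_empty.2 hne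
  exact hA ⟨fun _ => p.1, fun _ => p.2, Subsingleton.strictMono _, Subsingleton.strictMono _,
    fun _ => hp⟩

/-- A full line avoids every permutation of length at least two. -/
theorem le_ex {k : ℕ} (π : Equiv.Perm (Fin k)) (hk : 2 ≤ k) (N : ℕ) : N ≤ ex π N := by
  rcases Nat.eq_zero_or_pos N with rfl | hN
  · exact Nat.zero_le _
  have : ((Finset.range N).image fun x => (x, 0)).card = N := by
    rw [Finset.card_image_of_injective _ (fun a b h => by simpa using h), Finset.card_range]
  refine this.symm.le.trans (card_le_ex ?_ ?_)
  · rintro ⟨f, g, -, hg, h⟩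
    have h1 : ∀ i, g (π i) = 0 := fun i => by
      obtain ⟨x, -, hx⟩ := Finset.mem_image.1 (h i)
      simpa using (congrArg Prod.snd hx).symm
    have h0 := h1 (π.symm ⟨0, by omega⟩)
    have h2 := h1 (π.symm ⟨1, by omega⟩)
    have : g ⟨0, by omega⟩ < g ⟨1, by omega⟩ := hg (by simp)
    simp only [Equiv.apply_symm_apply] at h0 h2
    omega
  · intro p hp
    obtain ⟨x, hx, rfl⟩ := Finset.mem_image.1 hp
    exact ⟨Finset.mem_range.1 hx, hN⟩

/-- Two avoiding sets are placed in opposite corners of a larger square. If π starts lower than it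
ends, the left set goes above the right one, otherwise below it. A copy of π that uses both sets
would begin in the left one and end in the right one, with its first and last heights in the wrong
order. -/
theorem ex_add_le {k : ℕ} (π : Equiv.Perm (Fin k)) (hk : 2 ≤ k) (a b : ℕ) :
    ex π a + ex π b ≤ ex π (a + b) := by
  classical
  obtain ⟨A, hA, hAa, hAc⟩ := exists_card_eq_ex π (by omega) a
  obtain ⟨B, hB, hBb, hBc⟩ := exists_card_eq_ex π (by omega) b
  let z : Fin k := ⟨0, by omega⟩
  let l : Fin k := ⟨k - 1, by omega⟩
  have hz : ∀ i : Fin k, z ≤ i := fun i => Fin.mk_le_of_le_val (Nat.zero_le _)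
  have hl : ∀ i : Fin k, i ≤ l := fun i => Fin.mk_le_mk.2 (by omega)
  -- shifts of the two point sets, glued along the diagonal or along the antidiagonal
  have key : ∀ (da db : ℕ), (da = 0 ∧ db = a ∧ π l < π z ∨ da = b ∧ db = 0 ∧ π z < π l) →
      ex π a + ex π b ≤ ex π (a + b) := by
    intro da db hd
    set A' := A.image fun p => (p.1, p.2 + da) with hA'
    set B' := B.image fun p => (p.1 + a, p.2 + db) with hB'
    have mA : ∀ x y, (x, y) ∈ A' → x < a ∧ da ≤ y ∧ y < a + da ∧ (x, y - da) ∈ A := by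
      intro x y h
      obtain ⟨p, hp, he⟩ := Finset.mem_image.1 h
      have h1 : p.1 = x := congrArg Prod.fst he
      have h2 : p.2 + da = y := congrArg Prod.snd he
      have h3 := hAa p hp
      refine ⟨by omega, by omega, by omega, ?_⟩
      have : (x, y - da) = p := by ext <;> simp <;> omega
      rw [this]; exact hp
    have mB : ∀ x y, (x, y) ∈ B' → a ≤ x ∧ x < a + b ∧ db ≤ y ∧ y < b + db ∧
        (x - a, y - db) ∈ B := by
      intro x y h
      obtain ⟨p, hp, he⟩ := Finset.mem_image.1 h
      have h1 : p.1 + a = x := congrArg Prod.fst he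
      have h2 : p.2 + db = y := congrArg Prod.snd he
      have h3 := hBb p hp
      refine ⟨by omega, by omega, by omega, by omega, ?_⟩
      have : (x - a, y - db) = p := by ext <;> simp <;> omega
      rw [this]; exact hp
    have cA : A'.card = A.card :=
      Finset.card_image_of_injective _ fun p q h => by
        simp only [Prod.mk.injEq] at h; ext <;> omega
    have cB : B'.card = B.card :=
      Finset.card_image_of_injective _ fun p q h => by
        simp only [Prod.mk.injEq] at h; ext <;> omega
    have hdis : Disjoint A' B' := by
      rw [Finset.disjoint_left]
      rintro ⟨x, y⟩ h1 h2
      have := mA _ _ h1; have := mB _ _ h2; omega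
    rw [← hAc, ← hBc, ← cA, ← cB, ← Finset.card_union_of_disjoint hdis]
    refine card_le_ex ?_ ?_
    · rintro ⟨f, g, hf, hg, h⟩
      -- The columns of an occurrence increase, so it lies entirely in the left set if its last
      -- point does, and entirely in the right set if its first point does. The remaining case is
      -- the mixed one, which contradicts the choice of the corners.
      by_cases c1 : f l < a
      · apply hA
        have hmem : ∀ i, (f i, g (π i)) ∈ A' := fun i => by
          rcases Finset.mem_union.1 (h i) with h' | h'
          · exact h'
          · have := mB _ _ h'; have := hf.monotone (hl i); omega
        refine ⟨f, fun j => g j - da, hf, fun i j hij => ?_, fun i => (mA _ _ (hmem i)).2.2.2⟩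
        have h1 := (mA _ _ (hmem (π.symm i))).2.1
        simp only [Equiv.apply_symm_apply] at h1
        have := hg hij
        show g i - da < g j - da
        omega
      by_cases c2 : a ≤ f z
      · apply hB
        have hmem : ∀ i, (f i, g (π i)) ∈ B' := fun i => by
          rcases Finset.mem_union.1 (h i) with h' | h'
          · have := mA _ _ h'; have := hf.monotone (hz i); omega
          · exact h'
        refine ⟨fun i => f i - a, fun j => g j - db, fun i j hij => ?_, fun i j hij => ?_,
          fun i => (mB _ _ (hmem i)).2.2.2.2⟩
        · have := (mB _ _ (hmem i)).1
          have := hf hij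
          show f i - a < f j - a
          omega
        · have h1 := (mB _ _ (hmem (π.symm i))).2.2.1
          simp only [Equiv.apply_symm_apply] at h1
          have := hg hij
          show g i - db < g j - db
          omega
      · have h1 : (f z, g (π z)) ∈ A' := by
          rcases Finset.mem_union.1 (h z) with h' | h'
          · exact h'
          · have := mB _ _ h'; omega
        have h2 : (f l, g (π l)) ∈ B' := by
          rcases Finset.mem_union.1 (h l) with h' | h'
          · have := mA _ _ h'; omega
          · exact h'
        have h1 := mA _ _ h1
        have h2 := mB _ _ h2
        rcases hd with ⟨rfl, rfl, hd⟩ | ⟨rfl, rfl, hd⟩ <;> have := hg hd <;> omega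
    · rintro ⟨x, y⟩ hp
      rcases Finset.mem_union.1 hp with h' | h'
      · have := mA _ _ h'; refine ⟨?_, ?_⟩ <;> simp only <;> omega
      · have := mB _ _ h'; refine ⟨?_, ?_⟩ <;> simp only <;> omega
  have hne : π z ≠ π l := fun h => by
    have := congrArg Fin.val (π.injective h)
    simp only [z, l] at this
    omega
  rcases lt_or_gt_of_ne hne with h | h
  · exact key b 0 (Or.inr ⟨rfl, rfl, h⟩)
  · exact key 0 a (Or.inl ⟨rfl, rfl, h⟩)

/-! ### The Marcus–Tardos theorem -/

/-- Transposition exchanges π with its inverse. This reduces blocks with many rows to blocks with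
many columns. -/
theorem PtsContain.of_swap {k : ℕ} {π : Equiv.Perm (Fin k)} {A : Finset (ℕ × ℕ)}
    (h : PtsContain π.symm (A.image Prod.swap)) : PtsContain π A := by
  obtain ⟨f, g, hf, hg, h⟩ := h
  refine ⟨g, f, hg, hf, fun i => ?_⟩
  have := h (π i)
  rw [Equiv.symm_apply_apply] at this
  obtain ⟨p, hp, he⟩ := Finset.mem_image.1 this
  have : p = (g i, f (π i)) := by rw [← Prod.swap_swap p, he]; rfl
  rwa [← this]

/-- Division of the plane into squares of side `s` keeps permutations avoided. -/
theorem not_ptsContain_blocks {k : ℕ} {π : Equiv.Perm (Fin k)} {A : Finset (ℕ × ℕ)}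
    (hA : ¬ PtsContain π A) (s : ℕ) :
    ¬ PtsContain π (A.image fun p => (p.1 / s, p.2 / s)) := by
  rintro ⟨f, g, hf, hg, h⟩
  have hp : ∀ i, ∃ p ∈ A, p.1 / s = f i ∧ p.2 / s = g (π i) := fun i => by
    obtain ⟨p, hp, he⟩ := Finset.mem_image.1 (h i)
    exact ⟨p, hp, congrArg Prod.fst he, congrArg Prod.snd he⟩
  choose p hpA hp1 hp2 using hp
  refine hA ⟨fun i => (p i).1, fun j => (p (π.symm j)).2, fun i j hij => ?_, fun i j hij => ?_,
    fun i => ?_⟩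
  · have := hf hij
    rw [← hp1, ← hp1] at this
    exact lt_of_not_ge fun h => absurd (Nat.div_le_div_right (c := s) h) (not_le.2 this)
  · have := hg hij
    rw [← π.apply_symm_apply i, ← π.apply_symm_apply j, ← hp2, ← hp2] at this
    exact lt_of_not_ge fun h => absurd (Nat.div_le_div_right (c := s) h) (not_le.2 this)
  · simpa using hpA i

/-- In a column of blocks there are few blocks with points in at least `k` columns. -/
theorem card_wide_le {k : ℕ} {π : Equiv.Perm (Fin k)} {A : Finset (ℕ × ℕ)}
    (hA : ¬ PtsContain π A) {s : ℕ} (hs : 0 < s) (X : ℕ) (E : Finset ℕ)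
    (hE : ∀ Y ∈ E, k ≤ ((A.filter fun p => p.1 / s = X ∧ p.2 / s = Y).image Prod.fst).card) :
    E.card ≤ s.choose k * k := by
  classical
  by_contra hlt
  push Not at hlt
  have hc : ∀ Y, ∃ c : Finset ℕ, Y ∈ E →
      c ⊆ ((A.filter fun p => p.1 / s = X ∧ p.2 / s = Y).image Prod.fst) ∧ c.card = k := by
    intro Y
    by_cases hY : Y ∈ E
    · obtain ⟨c, h1, h2⟩ := Finset.exists_subset_card_eq (hE Y hY)
      exact ⟨c, fun _ => ⟨h1, h2⟩⟩
    · exact ⟨∅, fun h => absurd h hY⟩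
  choose c hc using hc
  have hmaps : ∀ Y ∈ E, c Y ∈ Finset.powersetCard k (Finset.Ico (X * s) (X * s + s)) := by
    intro Y hY
    rw [Finset.mem_powersetCard]
    refine ⟨fun x hx => ?_, (hc Y hY).2⟩
    obtain ⟨p, hp, rfl⟩ := Finset.mem_image.1 ((hc Y hY).1 hx)
    have h1 := (Finset.mem_filter.1 hp).2.1
    rw [Finset.mem_Ico, ← h1]
    exact ⟨Nat.div_mul_le_self _ _, by
      have := Nat.lt_div_mul_add hs (a := p.1); omega⟩
  -- Pigeonhole over the `s.choose k` sets of k columns: more than k blocks have points in the same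
  -- k columns `C`. From k of these blocks, stacked vertically, the i-th column and the block of
  -- index `π i` supply the i-th point of a copy of π.
  obtain ⟨C, hC, hcard⟩ := Finset.exists_lt_card_fiber_of_mul_lt_card_of_maps_to hmaps
    (n := k) (by simpa using hlt)
  obtain ⟨T, hT, hTk⟩ := Finset.exists_subset_card_eq hcard.le
  have hCk : C.card = k := (Finset.mem_powersetCard.1 hC).2
  have hp : ∀ i, ∃ p ∈ A, p.1 = C.orderEmbOfFin hCk i ∧
      p.2 / s = T.orderEmbOfFin hTk (π i) := by
    intro i
    have hY := Finset.mem_filter.1 (hT (Finset.orderEmbOfFin_mem T hTk (π i)))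
    have hx : C.orderEmbOfFin hCk i ∈ c (T.orderEmbOfFin hTk (π i)) := by
      rw [hY.2]; exact Finset.orderEmbOfFin_mem _ _ _
    obtain ⟨p, hp, he⟩ := Finset.mem_image.1 ((hc _ hY.1).1 hx)
    rw [Finset.mem_filter] at hp
    exact ⟨p, hp.1, he, hp.2.2⟩
  choose p hpA hp1 hp2 using hp
  refine hA ⟨C.orderEmbOfFin hCk, fun j => (p (π.symm j)).2, OrderEmbedding.strictMono _,
    fun i j hij => ?_, fun i => ?_⟩
  · have := (T.orderEmbOfFin hTk).strictMono hij
    rw [← π.apply_symm_apply i, ← π.apply_symm_apply j, ← hp2, ← hp2] at this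
    exact lt_of_not_ge fun h => absurd (Nat.div_le_div_right (c := s) h) (not_le.2 this)
  · rw [← hp1]; simpa using hpA i

/-- The number of all blocks with points in at least `k` columns. -/
theorem card_wide_blocks_le {k : ℕ} {π : Equiv.Perm (Fin k)} {A : Finset (ℕ × ℕ)}
    (hA : ¬ PtsContain π A) {s N : ℕ} (hs : 0 < s) (B : Finset (ℕ × ℕ))
    (hB : ∀ b ∈ B, b.1 < N ∧
      k ≤ ((A.filter fun p => p.1 / s = b.1 ∧ p.2 / s = b.2).image Prod.fst).card) :
    B.card ≤ s.choose k * k * N := by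
  classical
  have := Finset.card_le_mul_card_image_of_maps_to (s := B) (t := Finset.range N) (f := Prod.fst)
    (fun b hb => Finset.mem_range.2 (hB b hb).1) (s.choose k * k) ?_
  · simpa using this
  intro X _
  have h : ((B.filter fun b => b.1 = X).image Prod.snd).card = (B.filter fun b => b.1 = X).card := by
    refine Finset.card_image_of_injOn ?_
    rintro ⟨a, b⟩ h1 ⟨a', b'⟩ h2 h
    simp only [Finset.coe_filter, Set.mem_ofPred_eq] at h1 h2
    simp only at h
    rw [h, h1.2, h2.2]
  rw [← h]
  refine card_wide_le hA hs X _ fun Y hY => ?_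
  obtain ⟨b, hb, rfl⟩ := Finset.mem_image.1 hY
  obtain ⟨hbB, rfl⟩ := Finset.mem_filter.1 hb
  exact (hB b hbB).2

/-- The Marcus–Tardos recursion with blocks of side k². The nonempty blocks form a π-avoiding set,
those with points in k columns or in k rows are linearly few and have at most k⁴ points each, and
every other block fits into k - 1 columns and k - 1 rows. -/
theorem ex_le_ex_blocks {k : ℕ} (π : Equiv.Perm (Fin k)) (hk : 0 < k) (N : ℕ) :
    ex π N ≤ (k - 1) ^ 2 * ex π (N / (k * k) + 1) +
      (k * k) ^ 2 * (2 * ((k * k).choose k * k)) * (N / (k * k) + 1) := by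
  classical
  obtain ⟨A, hA, hN, hc⟩ := exists_card_eq_ex π hk N
  rw [← hc]
  set s := k * k with hs
  have hs0 : 0 < s := Nat.mul_pos hk hk
  set N' := N / s + 1 with hN'
  let blk : ℕ × ℕ → ℕ × ℕ := fun p => (p.1 / s, p.2 / s)
  set B := A.image blk with hB
  have hBN : ∀ b ∈ B, b.1 < N' ∧ b.2 < N' := by
    intro b hb
    obtain ⟨p, hp, rfl⟩ := Finset.mem_image.1 hb
    exact ⟨Nat.lt_succ_of_le (Nat.div_le_div_right (hN p hp).1.le),
      Nat.lt_succ_of_le (Nat.div_le_div_right (hN p hp).2.le)⟩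
  have hBc : B.card ≤ ex π N' := card_le_ex (not_ptsContain_blocks hA s) hBN
  let cell : ℕ × ℕ → Finset (ℕ × ℕ) := fun b => A.filter fun p => p.1 / s = b.1 ∧ p.2 / s = b.2
  let wide : ℕ × ℕ → Prop := fun b => k ≤ ((cell b).image Prod.fst).card
  let tall : ℕ × ℕ → Prop := fun b => k ≤ ((cell b).image Prod.snd).card
  have hwide : (B.filter wide).card ≤ s.choose k * k * N' :=
    card_wide_blocks_le hA hs0 _ fun b hb =>
      ⟨(hBN b (Finset.mem_filter.1 hb).1).1, (Finset.mem_filter.1 hb).2⟩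
  have htall : (B.filter tall).card ≤ s.choose k * k * N' := by
    rw [← Finset.card_image_of_injective (B.filter tall) Prod.swap_injective]
    refine card_wide_blocks_le (π := π.symm) (A := A.image Prod.swap)
      (fun h => hA h.of_swap) hs0 _ fun b' hb' => ?_
    obtain ⟨b, hb, rfl⟩ := Finset.mem_image.1 hb'
    rw [Finset.mem_filter] at hb
    refine ⟨(hBN b hb.1).2, hb.2.trans (Finset.card_le_card ?_)⟩
    intro y hy
    obtain ⟨p, hp, rfl⟩ := Finset.mem_image.1 hy
    rw [Finset.mem_filter] at hp
    refine Finset.mem_image.2 ⟨p.swap, Finset.mem_filter.2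
      ⟨Finset.mem_image_of_mem _ hp.1, hp.2.2, hp.2.1⟩, rfl⟩
  have hsub : ∀ b, cell b ⊆ (cell b).image Prod.fst ×ˢ (cell b).image Prod.snd := fun b p hp =>
    Finset.mem_product.2 ⟨Finset.mem_image_of_mem _ hp, Finset.mem_image_of_mem _ hp⟩
  have hdiv : ∀ x y : ℕ, x / s = y → x ∈ Finset.Ico (y * s) (y * s + s) := by
    rintro x y rfl
    rw [Finset.mem_Ico]
    exact ⟨Nat.div_mul_le_self _ _, by have := Nat.lt_div_mul_add hs0 (a := x); omega⟩
  have hbig : ∀ b, (cell b).card ≤ s ^ 2 := fun b => by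
    have h : cell b ⊆ Finset.Ico (b.1 * s) (b.1 * s + s) ×ˢ Finset.Ico (b.2 * s) (b.2 * s + s) :=
      fun p hp => Finset.mem_product.2 ⟨hdiv _ _ (Finset.mem_filter.1 hp).2.1,
        hdiv _ _ (Finset.mem_filter.1 hp).2.2⟩
    refine (Finset.card_le_card h).trans ?_
    rw [Finset.card_product, Nat.card_Ico, Nat.card_Ico, sq]
    simp
  have hsmall : ∀ b, ¬ wide b → ¬ tall b → (cell b).card ≤ (k - 1) ^ 2 := fun b h1 h2 => by
    refine (Finset.card_le_card (hsub b)).trans ?_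
    rw [Finset.card_product, sq]
    simp only [wide, tall, not_le] at h1 h2
    exact Nat.mul_le_mul (by omega) (by omega)
  have hsum : A.card = ∑ b ∈ B, (cell b).card := by
    rw [Finset.card_eq_sum_card_fiberwise (f := blk) (t := B)
      (fun p hp => Finset.mem_image_of_mem _ hp)]
    refine Finset.sum_congr rfl fun b _ => ?_
    congr 1
    ext p
    simp [cell, blk, Prod.ext_iff]
  rw [hsum]
  have hterm : ∀ b ∈ B, (cell b).card ≤ (k - 1) ^ 2 + (if wide b then s ^ 2 else 0) +
      (if tall b then s ^ 2 else 0) := by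
    intro b _
    by_cases h1 : wide b
    · simp only [h1, if_true]; have := hbig b; omega
    · by_cases h2 : tall b
      · simp only [h2, if_true]; have := hbig b; omega
      · simpa [h1, h2] using hsmall b h1 h2
  refine (Finset.sum_le_sum hterm).trans ?_
  rw [Finset.sum_add_distrib, Finset.sum_add_distrib, ← Finset.sum_filter, ← Finset.sum_filter,
    Finset.sum_const, Finset.sum_const, Finset.sum_const, smul_eq_mul, smul_eq_mul, smul_eq_mul]
  nlinarith [Nat.mul_le_mul_right ((k - 1) ^ 2) hBc, Nat.mul_le_mul_right (s ^ 2) hwide,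
    Nat.mul_le_mul_right (s ^ 2) htall]

theorem ex_le_sq {k : ℕ} (π : Equiv.Perm (Fin k)) (hk : 0 < k) (N : ℕ) : ex π N ≤ N * N := by
  obtain ⟨A, -, hN, hc⟩ := exists_card_eq_ex π hk N
  rw [← hc]
  have : A ⊆ Finset.range N ×ˢ Finset.range N := fun p hp =>
    Finset.mem_product.2 ⟨Finset.mem_range.2 (hN p hp).1, Finset.mem_range.2 (hN p hp).2⟩
  simpa using Finset.card_le_card this

/-- The recursion multiplies the count by (k - 1)² while the side shrinks by k², so the linear bound
survives the induction. -/
theorem exists_ex_le_mul {k : ℕ} (π : Equiv.Perm (Fin k)) (hk : 0 < k) :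
    ∃ C : ℕ, ∀ N, ex π N ≤ C * N := by
  set E := (k * k) ^ 2 * (2 * ((k * k).choose k * k)) with hE
  -- The part 2E absorbs the additive term E(q + 1) into Cq. The part k⁴ + k² settles small N by the
  -- trivial bound N²; for larger N the quotient q is at least k².
  obtain ⟨C, hC1, hC2⟩ : ∃ C : ℕ, 2 * E ≤ C ∧ k ^ 4 + k * k ≤ C :=
    ⟨2 * E + (k ^ 4 + k * k), by omega, by omega⟩
  refine ⟨C, fun N => ?_⟩
  induction N using Nat.strong_induction_on with
  | _ N ih =>
    by_cases hN : N < k ^ 4 + k * k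
    · exact (ex_le_sq π hk N).trans (Nat.mul_le_mul_right _ (by omega))
    push Not at hN
    rcases Nat.lt_or_ge k 2 with h1 | h2
    · obtain rfl : k = 1 := by omega
      rw [ex_eq_zero_of_one]; exact Nat.zero_le _
    have hs : 4 ≤ k * k := Nat.mul_le_mul h2 h2
    set q := N / (k * k) with hq
    have hq1 : k * k * q ≤ N := Nat.mul_div_le _ _
    have hq2 : k * k ≤ q := by
      rw [hq, Nat.le_div_iff_mul_le (by omega)]
      nlinarith
    have hlt : q + 1 < N := by nlinarith
    have hrec := ex_le_ex_blocks π hk N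
    rw [← hq, ← hE] at hrec
    have hi := ih _ hlt
    have hEq : E * (q + 1) ≤ C * q := by nlinarith
    obtain ⟨j, rfl⟩ : ∃ j, k = j + 2 := ⟨k - 2, by omega⟩
    have hj : (j + 2 - 1) ^ 2 = (j + 1) ^ 2 := by congr 1
    rw [hj] at hrec
    have hlin : (j + 1) ^ 2 * (q + 1) + q ≤ (j + 2) * (j + 2) * q := by nlinarith
    calc ex π N ≤ (j + 1) ^ 2 * (C * (q + 1)) + C * q :=
          hrec.trans (Nat.add_le_add (Nat.mul_le_mul_left _ hi) hEq)
      _ = C * ((j + 1) ^ 2 * (q + 1) + q) := by ring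
      _ ≤ C * ((j + 2) * (j + 2) * q) := Nat.mul_le_mul_left _ hlin
      _ ≤ C * N := Nat.mul_le_mul_left _ hq1

/-! ### The Füredi–Hajnal limit -/

/-- Fekete's lemma for the subadditive function -ex_π, which is bounded below after division by n
thanks to Marcus–Tardos. The limit equals the supremum, so the second claim has no error term. -/
theorem tendsto_ex_div {k : ℕ} (π : Equiv.Perm (Fin k)) :
    Tendsto (fun n : ℕ => (ex π n : ℝ) / n) atTop (𝓝 (furediHajnal π)) ∧
      ∀ n : ℕ, (ex π n : ℝ) ≤ furediHajnal π * n := by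
  rcases Nat.lt_or_ge k 2 with h | hk
  · have hz : ∀ n, ex π n = 0 := by
      interval_cases k
      · exact ex_eq_zero_of_zero π
      · exact ex_eq_zero_of_one π
    have ht : Tendsto (fun n : ℕ => (ex π n : ℝ) / n) atTop (𝓝 0) := by simp [hz]
    have hc : furediHajnal π = 0 := ht.limUnder_eq
    rw [hc]
    exact ⟨ht, fun n => by simp [hz]⟩
  · have hsub : Subadditive fun n => -(ex π n : ℝ) := by
      intro a b
      have := ex_add_le π hk a b
      have : (ex π a : ℝ) + ex π b ≤ ex π (a + b) := by exact_mod_cast this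
      linarith
    obtain ⟨C, hC⟩ := exists_ex_le_mul π (by omega : 0 < k)
    have hbdd : BddBelow (Set.range fun n : ℕ => -(ex π n : ℝ) / n) := by
      refine ⟨-C, ?_⟩
      rintro _ ⟨n, rfl⟩
      have : (ex π n : ℝ) / n ≤ C := by
        refine div_le_of_le_mul₀ (Nat.cast_nonneg _) (Nat.cast_nonneg _) ?_
        exact_mod_cast hC n
      show (-(C : ℝ)) ≤ -(ex π n : ℝ) / n
      rw [neg_div]; linarith
    have ht : Tendsto (fun n : ℕ => (ex π n : ℝ) / n) atTop (𝓝 (-hsub.lim)) := by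
      have := (hsub.tendsto_lim hbdd).neg
      simpa [neg_div] using this
    have hc : furediHajnal π = -hsub.lim := ht.limUnder_eq
    refine ⟨by rw [hc]; exact ht, fun n => ?_⟩
    rcases Nat.eq_zero_or_pos n with rfl | hn
    · have := ex_le_sq π (by omega : 0 < k) 0
      have : ex π 0 = 0 := by omega
      simp [this]
    · have h1 := hsub.lim_le_div hbdd hn.ne'
      have hn' : (0 : ℝ) < n := by exact_mod_cast hn
      rw [le_div_iff₀ hn'] at h1
      rw [hc]; linarith

/-- Makes log c_π nonnegative, so that the time bound is at least linear. -/
theorem one_le_furediHajnal {k : ℕ} (π : Equiv.Perm (Fin k)) (hk : 2 ≤ k) :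
    1 ≤ furediHajnal π := by
  have h1 := (tendsto_ex_div π).2 1
  have h2 : (1 : ℝ) ≤ ex π 1 := by exact_mod_cast le_ex π hk 1
  simp only [Nat.cast_one, mul_one] at h1
  linarith

/-! ### Ranks of positions

Positions of a list are ordered by the element they hold, ties being broken by the position. -/

section Rank

variable {α : Type*} [LinearOrder α]

/-- The number of positions before `p` in the stable sorting order; `S.length` if `p` is no
position. -/
noncomputable def rk (S : List α) (p : ℕ) : ℕ :=
  if h : p < S.length then ((Tuple.sort S.get).symm ⟨p, h⟩ : Fin S.length) else S.length

/-- The position of rank `t`. -/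
noncomputable def posOf (S : List α) (t : ℕ) : ℕ :=
  if h : t < S.length then (Tuple.sort S.get ⟨t, h⟩ : Fin S.length) else S.length

variable {S : List α}

theorem rk_lt {p : ℕ} (h : p < S.length) : rk S p < S.length := by
  unfold rk; rw [dif_pos h]; exact Fin.is_lt _

theorem rk_of_le {p : ℕ} (h : S.length ≤ p) : rk S p = S.length := by
  unfold rk; rw [dif_neg (by omega)]

theorem rk_le (p : ℕ) : rk S p ≤ S.length := by
  rcases lt_or_ge p S.length with h | h
  · exact (rk_lt h).le
  · exact (rk_of_le h).le

theorem posOf_lt {t : ℕ} (h : t < S.length) : posOf S t < S.length := by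
  unfold posOf; rw [dif_pos h]; exact Fin.is_lt _

theorem rk_posOf {t : ℕ} (h : t < S.length) : rk S (posOf S t) = t := by
  unfold rk; rw [dif_pos (posOf_lt h)]; unfold posOf; simp [h]

theorem posOf_rk {p : ℕ} (h : p < S.length) : posOf S (rk S p) = p := by
  unfold posOf; rw [dif_pos (rk_lt h)]; unfold rk; simp [h]

theorem rk_inj {p q : ℕ} (hp : p < S.length) (hq : q < S.length) (h : rk S p = rk S q) : p = q := by
  rw [← posOf_rk hp, h, posOf_rk hq]

theorem getElem_posOf_le {s t : ℕ} (hst : s ≤ t) (ht : t < S.length) :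
    S[posOf S s]'(posOf_lt (hst.trans_lt ht)) ≤ S[posOf S t]'(posOf_lt ht) := by
  have h := Tuple.monotone_sort S.get (a := ⟨s, hst.trans_lt ht⟩) (b := ⟨t, ht⟩) hst
  simp only [Function.comp, List.get_eq_getElem] at h
  simpa only [posOf, ht, hst.trans_lt ht, dif_pos] using h

/-- The sorting permutation `Tuple.sort` is stable. The load count relies on this for repeated
values. -/
theorem posOf_lt_posOf {s t : ℕ} (hst : s < t) (ht : t < S.length)
    (he : S[posOf S s]'(posOf_lt (hst.trans ht)) = S[posOf S t]'(posOf_lt ht)) :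
    posOf S s < posOf S t := by
  have h := (Tuple.eq_sort_iff.1 (rfl : Tuple.sort S.get = Tuple.sort S.get)).2
    ⟨s, hst.trans ht⟩ ⟨t, ht⟩ hst
  simp only [List.get_eq_getElem] at h
  simp only [posOf, ht, hst.trans ht, dif_pos] at he ⊢
  exact h he

theorem getElem_le_of_rk_le {p q : ℕ} (hp : p < S.length) (hq : q < S.length)
    (h : rk S p ≤ rk S q) : S[p] ≤ S[q] := by
  have := getElem_posOf_le h (rk_lt hq)
  simpa only [posOf_rk hp, posOf_rk hq] using this

/-- Expresses the order of ranks by what the machine can observe: two comparisons of elements and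
one of positions. -/
theorem rk_le_rk_iff {p q : ℕ} (hp : p < S.length) (hq : q < S.length) :
    rk S p ≤ rk S q ↔ S[p] ≤ S[q] ∧ ¬ (S[q] ≤ S[p] ∧ q < p) := by
  constructor
  · intro h
    refine ⟨getElem_le_of_rk_le hp hq h, fun ⟨h1, h2⟩ => ?_⟩
    have he := le_antisymm (getElem_le_of_rk_le hp hq h) h1
    rcases h.lt_or_eq with h | h
    · have := posOf_lt_posOf h (rk_lt hq) (by simpa only [posOf_rk hp, posOf_rk hq] using he)
      rw [posOf_rk hp, posOf_rk hq] at this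
      omega
    · have := rk_inj hp hq h; omega
  · rintro ⟨h1, h2⟩
    by_contra hlt
    push Not at hlt
    have h3 := getElem_le_of_rk_le hq hp hlt.le
    have he := le_antisymm h3 h1
    have := posOf_lt_posOf hlt (rk_lt hp) (by simpa only [posOf_rk hp, posOf_rk hq] using he)
    rw [posOf_rk hp, posOf_rk hq] at this
    exact h2 ⟨h3, this⟩

theorem rk_lt_rk {p q : ℕ} (hpq : p < q) (hq : q < S.length)
    (h : S[p]'(hpq.trans hq) ≤ S[q]) : rk S p < rk S q := by
  refine lt_of_le_of_ne ((rk_le_rk_iff (hpq.trans hq) hq).2 ⟨h, fun h => ?_⟩) fun h => ?_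
  · omega
  · have := rk_inj (hpq.trans hq) hq h; omega

/-- The elements in the order of their ranks. -/
noncomputable def sortedPrefix (S : List α) (t : ℕ) : List α :=
  (List.range t).filterMap fun s => S[posOf S s]?

theorem sortedPrefix_zero : sortedPrefix S 0 = [] := rfl

theorem sortedPrefix_succ {t p : ℕ} (hp : p < S.length) (h : rk S p = t) :
    sortedPrefix S (t + 1) = sortedPrefix S t ++ [S[p]] := by
  subst h
  simp [sortedPrefix, List.range_succ, List.filterMap_append, posOf_rk hp, hp]

theorem sortedPrefix_length_eq :
    sortedPrefix S S.length = (List.finRange S.length).map (S.get ∘ Tuple.sort S.get) := by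
  unfold sortedPrefix
  have : List.range S.length = (List.finRange S.length).map Fin.val := by simp
  rw [this, List.filterMap_map, ← List.filterMap_eq_map]
  refine List.filterMap_congr fun t _ => ?_
  simp [posOf]

theorem sortedPrefix_perm : (sortedPrefix S S.length).Perm S := by
  rw [sortedPrefix_length_eq, ← List.map_map]
  conv_rhs => rw [← List.map_get_finRange S]
  exact (Equiv.Perm.map_finRange_perm _).map _

theorem sortedPrefix_pairwise : (sortedPrefix S S.length).Pairwise (· ≤ ·) := by
  rw [sortedPrefix_length_eq, List.pairwise_map]
  exact (List.pairwise_le_finRange _).imp fun h => Tuple.monotone_sort S.get h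

end Rank

/-! ### Counting loads -/

section Events

variable {α : Type*} [LinearOrder α]

/-- The bound on the number of load events: whenever between two events of the same class a
window starts, the number of events is bounded in terms of the number of windows. -/
def LoadBound (S : List α) (γ : ℕ → ℕ) (G D : ℕ) : Prop :=
  ∀ Ev X : Finset ℕ, (∀ t ∈ Ev, t < S.length) → X ⊆ Ev →
    (∀ s ∈ Ev, ∀ t ∈ Ev, s < t → γ (posOf S s) = γ (posOf S t) → ∃ a ∈ X, s < a ∧ a ≤ t) →
    Ev.card ≤ X.card + D * (G + (2 * X.card + 1))

/-- The number of a value among the values at the ranks in `X` and the gaps between them. -/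
def gapIndex {β : Type*} [LinearOrder β] (X : Finset ℕ) (v : ℕ → β) (y : β) : ℕ :=
  (X.filter fun a => v a ≤ y).card + (X.filter fun a => v a < y).card

theorem gapIndex_mono {β : Type*} [LinearOrder β] (X : Finset ℕ) (v : ℕ → β) {y z : β}
    (h : y ≤ z) : gapIndex X v y ≤ gapIndex X v z :=
  Nat.add_le_add
    (Finset.card_le_card fun a ha => by
      rw [Finset.mem_filter] at ha ⊢; exact ⟨ha.1, ha.2.trans h⟩)
    (Finset.card_le_card fun a ha => by
      rw [Finset.mem_filter] at ha ⊢; exact ⟨ha.1, ha.2.trans_le h⟩)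

/-- Both counts in `gapIndex` are monotone, so equal sums force equal index sets at y and z. If y <
z, then `a` is counted by the weak inequality at z, hence at y, so `v a = y`; it is then counted
strictly at z but not at y. -/
theorem eq_of_gapIndex_eq {β : Type*} [LinearOrder β] {X : Finset ℕ} {v : ℕ → β} {y z : β} {a : ℕ}
    (ha : a ∈ X) (hy : y ≤ v a) (hz : v a ≤ z) (h : gapIndex X v y = gapIndex X v z) : y = z := by
  by_contra hne
  have hlt : y < z := lt_of_le_of_ne (hy.trans hz) hne
  have h1 : (X.filter fun a => v a ≤ y) ⊆ X.filter fun a => v a ≤ z := fun b hb => by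
    rw [Finset.mem_filter] at hb ⊢; exact ⟨hb.1, hb.2.trans hlt.le⟩
  have h2 : (X.filter fun a => v a < y) ⊆ X.filter fun a => v a < z := fun b hb => by
    rw [Finset.mem_filter] at hb ⊢; exact ⟨hb.1, hb.2.trans hlt⟩
  have c1 := Finset.card_le_card h1
  have c2 := Finset.card_le_card h2
  unfold gapIndex at h
  have e1 := Finset.eq_of_subset_of_card_le h1 (by omega)
  have e2 := Finset.eq_of_subset_of_card_le h2 (by omega)
  have m1 : a ∈ X.filter fun a => v a ≤ y := by
    rw [e1, Finset.mem_filter]; exact ⟨ha, hz⟩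
  have hva : v a = y := le_antisymm (Finset.mem_filter.1 m1).2 hy
  have m2 : a ∈ X.filter fun a => v a < y := by
    rw [e2, Finset.mem_filter]; exact ⟨ha, hva ▸ hlt⟩
  exact absurd hva (Finset.mem_filter.1 m2).2.ne

theorem gapIndex_lt {β : Type*} [LinearOrder β] (X : Finset ℕ) (v : ℕ → β) (y : β) :
    gapIndex X v y < 2 * X.card + 1 := by
  have h1 := Finset.card_filter_le X fun a => v a ≤ y
  have h2 := Finset.card_filter_le X fun a => v a < y
  unfold gapIndex
  omega

/-- Suppose that s < t outside X share class and row. A window starts between them, and the equality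
of rows makes all values in between equal. On equal values the class is monotone, so it is constant
from s to t, and the last window start before t has the same class as t. Separation then yields a
still later window start, which is absurd. -/
theorem gapIndex_injOn {β : Type*} [LinearOrder β] {Ev X : Finset ℕ} {v : ℕ → β} {c : ℕ → ℕ}
    (hX : X ⊆ Ev) (hv : ∀ s ∈ Ev, ∀ t ∈ Ev, s ≤ t → v s ≤ v t)
    (hc : ∀ s ∈ Ev, ∀ t ∈ Ev, s ≤ t → v s = v t → c s ≤ c t)
    (hsep : ∀ s ∈ Ev, ∀ t ∈ Ev, s < t → c s = c t → ∃ a ∈ X, s < a ∧ a ≤ t) :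
    Set.InjOn (fun t => (c t, gapIndex X v (v t))) (Ev \ X : Finset ℕ) := by
  have key : ∀ s ∈ Ev \ X, ∀ t ∈ Ev \ X, s < t → c s = c t →
      gapIndex X v (v s) = gapIndex X v (v t) → False := by
    intro s hs t ht hst hcc hrow
    rw [Finset.mem_sdiff] at hs ht
    obtain ⟨a, ha, hsa, hat⟩ := hsep s hs.1 t ht.1 hst hcc
    have hne : ((X.filter fun a => s < a ∧ a ≤ t)).Nonempty :=
      ⟨a, Finset.mem_filter.2 ⟨ha, hsa, hat⟩⟩
    obtain ⟨b, hb, hmax⟩ := Finset.exists_max_image _ id hne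
    obtain ⟨hbX, hsb, hbt⟩ := Finset.mem_filter.1 hb
    -- Strictness is the reason for leaving the ranks in `X` out of the map.
    have hbt' : b < t := lt_of_le_of_ne hbt fun h => ht.2 (h ▸ hbX)
    have v1 := hv s hs.1 b (hX hbX) hsb.le
    have v2 := hv b (hX hbX) t ht.1 hbt
    have he := eq_of_gapIndex_eq hbX v1 v2 hrow
    have e1 : v s = v b := le_antisymm v1 (he ▸ v2)
    have c1 := hc s hs.1 b (hX hbX) hsb.le e1
    have c2 := hc b (hX hbX) t ht.1 hbt (e1.symm.trans he)
    obtain ⟨a', ha', h1, h2⟩ := hsep b (hX hbX) t ht.1 hbt' (by omega)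
    have := hmax a' (Finset.mem_filter.2 ⟨ha', by omega, h2⟩)
    simp only [id] at this
    omega
  intro s hs t ht h
  simp only [Prod.mk.injEq] at h
  rcases lt_trichotomy s t with hst | hst | hst
  · exact (key s hs t ht hst h.1 h.2).elim
  · exact hst
  · exact (key t ht s hs hst h.1.symm h.2.symm).elim

/-- Values are taken in `WithBot α`, so that the lookup at a rank is total without a default
element. Ranks increase with the values and, on equal values, with the positions; this supplies the
two monotonicity conditions of the injectivity lemma. -/
theorem loadBound_aux {S : List α} {γ : ℕ → ℕ} (hγ : Monotone γ) {Ev X : Finset ℕ}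
    (hEv : ∀ t ∈ Ev, t < S.length) (hX : X ⊆ Ev)
    (hsep : ∀ s ∈ Ev, ∀ t ∈ Ev, s < t → γ (posOf S s) = γ (posOf S t) →
      ∃ a ∈ X, s < a ∧ a ≤ t) :
    ∃ v : ℕ → WithBot α, (∀ t ∈ Ev, v t = S[posOf S t]?) ∧
      Set.InjOn (fun t => (γ (posOf S t), gapIndex X v (v t))) (Ev \ X : Finset ℕ) := by
  let v : ℕ → WithBot α := fun t => S[posOf S t]?
  refine ⟨v, fun _ _ => rfl, gapIndex_injOn hX ?_ ?_ hsep⟩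
  · intro s hs t ht hst
    have h1 := posOf_lt (hEv s hs)
    have h2 := posOf_lt (hEv t ht)
    simp only [v, List.getElem?_eq_getElem h1, List.getElem?_eq_getElem h2]
    exact WithBot.coe_le_coe.2 (getElem_posOf_le hst (hEv t ht))
  · intro s hs t ht hst he
    have h1 := posOf_lt (hEv s hs)
    have h2 := posOf_lt (hEv t ht)
    simp only [v, List.getElem?_eq_getElem h1, List.getElem?_eq_getElem h2] at he
    rcases hst.lt_or_eq with h | rfl
    · exact hγ (posOf_lt_posOf h (hEv t ht) (WithBot.coe_inj.1 he)).le
    · exact le_rfl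

theorem card_le_of_cells {Ev X : Finset ℕ} {C : Finset (ℕ × ℕ)} {f : ℕ → ℕ × ℕ}
    (hinj : Set.InjOn f (Ev \ X : Finset ℕ)) (hC : C = (Ev \ X).image f) :
    Ev.card ≤ X.card + C.card := by
  rw [hC, Finset.card_image_of_injOn hinj]
  have := Finset.le_card_sdiff X Ev
  omega

/-- In a copy of π among the cells, distinct columns mean classes in strict order, hence positions
in the same order. Distinct rows mean strictly ordered values. So the elements behind the cells form
a copy of π in `S`, and the cells number at most ex_π(G + 2|X| + 1). -/
theorem loadBound_of_avoids {S : List α} {γ : ℕ → ℕ} (hγ : Monotone γ) {G D k : ℕ}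
    (hG : ∀ p < S.length, γ p < G) {π : Equiv.Perm (Fin k)} (hS : SeqAvoids S π)
    (hD : ∀ N, ex π N ≤ D * N) : LoadBound S γ G D := by
  intro Ev X hEv hX hsep
  obtain ⟨v, hv, hinj⟩ := loadBound_aux hγ hEv hX hsep
  refine (card_le_of_cells hinj rfl).trans (Nat.add_le_add_left ?_ _)
  refine (card_le_ex (N := G + (2 * X.card + 1)) ?_ ?_).trans (hD _)
  · rintro ⟨f, g, hf, hg, h⟩
    have ht : ∀ i, ∃ t ∈ Ev, γ (posOf S t) = f i ∧ gapIndex X v (v t) = g (π i) := by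
      intro i
      obtain ⟨t, ht, he⟩ := Finset.mem_image.1 (h i)
      exact ⟨t, (Finset.mem_sdiff.1 ht).1, congrArg Prod.fst he, congrArg Prod.snd he⟩
    choose t htE ht1 ht2 using ht
    have hpos : ∀ i, posOf S (t i) < S.length := fun i => posOf_lt (hEv _ (htE i))
    have hval : ∀ i, v (t i) = (S[posOf S (t i)]'(hpos i) : WithBot α) := fun i => by
      rw [hv _ (htE i), List.getElem?_eq_getElem (hpos i)]; rfl
    have hlt : ∀ a b, π a < π b → S[posOf S (t a)]'(hpos a) < S[posOf S (t b)]'(hpos b) := by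
      intro a b hab
      have h1 := hg hab
      rw [← ht2, ← ht2] at h1
      by_contra hle
      push Not at hle
      have := gapIndex_mono X v (WithBot.coe_le_coe.2 hle)
      rw [← hval, ← hval] at this
      omega
    apply hS
    refine ⟨OrderEmbedding.ofStrictMono (fun i => ⟨posOf S (t i), hpos i⟩) ?_, ?_⟩
    · intro a b hab
      have h1 := hf hab
      rw [← ht1, ← ht1] at h1
      exact lt_of_not_ge fun h => absurd (hγ h) (not_le.2 h1)
    · intro a b
      refine ⟨fun h => ?_, hlt a b⟩
      by_contra hle
      rcases (not_lt.1 hle).lt_or_eq with h' | h'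
      · exact absurd (hlt b a h') (not_lt.2 h.le)
      · rw [π.injective h'] at h
        exact lt_irrefl _ h
  · intro p hp
    obtain ⟨t, ht, rfl⟩ := Finset.mem_image.1 hp
    have h1 := hG _ (posOf_lt (hEv t (Finset.mem_sdiff.1 ht).1))
    have h2 := gapIndex_lt X v (v t)
    exact ⟨by simp only; omega, by simp only; omega⟩

/-- With one class every row holds at most one cell, so the number of rows is itself the bound and
no avoidance is needed. -/
theorem loadBound_one {S : List α} {γ : ℕ → ℕ} (hγ : Monotone γ)
    (hG : ∀ p < S.length, γ p < 1) : LoadBound S γ 1 1 := by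
  intro Ev X hEv hX hsep
  obtain ⟨v, hv, hinj⟩ := loadBound_aux hγ hEv hX hsep
  refine (card_le_of_cells hinj rfl).trans (Nat.add_le_add_left ?_ _)
  have hsub : ((Ev \ X).image fun t => (γ (posOf S t), gapIndex X v (v t))) ⊆
      Finset.range 1 ×ˢ Finset.range (2 * X.card + 1) := by
    intro p hp
    obtain ⟨t, ht, rfl⟩ := Finset.mem_image.1 hp
    exact Finset.mem_product.2 ⟨Finset.mem_range.2
      (hG _ (posOf_lt (hEv t (Finset.mem_sdiff.1 ht).1))), Finset.mem_range.2 (gapIndex_lt X v _)⟩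
  have := Finset.card_le_card hsub
  rw [Finset.card_product, Finset.card_range, Finset.card_range] at this
  omega

end Events

/-! ### Reasoning about runs of programs -/

namespace Store

variable {α : Type*}

/-- The store with variable `x` set to `v`. -/
def setVar (σ : Store α) (x v : ℕ) : Store α := { σ with var := Function.update σ.var x v }

/-- The store with array `a` replaced by `A`. -/
def setArr (σ : Store α) (a : ℕ) (A : ℕ → ℕ) : Store α :=
  { σ with arr := Function.update σ.arr a A }

/-- The store after the output of `y`. -/
def push (σ : Store α) (y : α) : Store α := { σ with out := σ.out ++ [y] }

@[simp] theorem setVar_var (σ : Store α) (x v y : ℕ) :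
    (σ.setVar x v).var y = if y = x then v else σ.var y := by
  simp [setVar, Function.update_apply]

@[simp] theorem setVar_arr (σ : Store α) (x v : ℕ) : (σ.setVar x v).arr = σ.arr := rfl

@[simp] theorem setVar_out (σ : Store α) (x v : ℕ) : (σ.setVar x v).out = σ.out := rfl

@[simp] theorem setArr_arr (σ : Store α) (a b : ℕ) (A : ℕ → ℕ) :
    (σ.setArr a A).arr b = if b = a then A else σ.arr b := by
  simp [setArr, Function.update_apply]

@[simp] theorem setArr_var (σ : Store α) (a : ℕ) (A : ℕ → ℕ) : (σ.setArr a A).var = σ.var := rfl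

@[simp] theorem setArr_out (σ : Store α) (a : ℕ) (A : ℕ → ℕ) : (σ.setArr a A).out = σ.out := rfl

@[simp] theorem push_var (σ : Store α) (y : α) : (σ.push y).var = σ.var := rfl

@[simp] theorem push_arr (σ : Store α) (y : α) : (σ.push y).arr = σ.arr := rfl

@[simp] theorem push_out (σ : Store α) (y : α) : (σ.push y).out = σ.out ++ [y] := rfl

end Store

section Runs

variable {α : Type*} [LinearOrder α] {W : ℕ} {S : List α}

/-- Started in `σ`, the program `P` halts within `T` steps in a store that satisfies `Q`. -/
def Runs (W : ℕ) (S : List α) (P : Prog) (σ : Store α) (T : ℕ) (Q : Store α → Prop) : Prop :=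
  ∃ t τ, Exec W S P σ t τ ∧ t ≤ T ∧ Q τ

variable {P P' : Prog} {σ : Store α} {T T₁ T₂ : ℕ} {Q R : Store α → Prop} {b : Test} {e i : Expr}

theorem Runs.mono (h : Runs W S P σ T₁ Q) (hT : T₁ ≤ T₂) (hQ : ∀ τ, Q τ → R τ) :
    Runs W S P σ T₂ R := by
  obtain ⟨t, τ, h1, h2, h3⟩ := h
  exact ⟨t, τ, h1, h2.trans hT, hQ τ h3⟩

theorem Runs.seq (h : Runs W S P σ T₁ fun τ => Runs W S P' τ T₂ Q) (hT : T₁ + T₂ ≤ T) :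
    Runs W S (.seq P P') σ T Q := by
  obtain ⟨t, τ, h1, h2, u, ρ, h3, h4, h5⟩ := h
  exact ⟨t + u, ρ, .seq h1 h3, by omega, h5⟩

theorem runs_assign {x : ℕ} (he : e.Fits W σ) (hT : e.cost + 1 ≤ T)
    (hQ : Q (σ.setVar x (e.eval σ))) : Runs W S (.assign x e) σ T Q :=
  ⟨_, _, .assign σ x e he, hT, hQ⟩

theorem runs_put {a : ℕ} (hi : i.Fits W σ) (he : e.Fits W σ) (hT : i.cost + e.cost + 1 ≤ T)
    (hQ : Q (σ.setArr a (Function.update (σ.arr a) (i.eval σ) (e.eval σ)))) :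
    Runs W S (.put a i e) σ T Q :=
  ⟨_, _, .put σ a i e hi he, hT, hQ⟩

theorem runs_emit (hi : i.Fits W σ) (hS : i.eval σ < S.length) (hT : i.cost + 1 ≤ T)
    (hQ : Q (σ.push S[i.eval σ])) : Runs W S (.emit i) σ T Q :=
  ⟨_, _, .emit σ i hi hS, hT, hQ⟩

theorem runs_assign_seq {x : ℕ} (he : e.Fits W σ) (hT : e.cost + 1 ≤ T)
    (h : Runs W S P (σ.setVar x (e.eval σ)) (T - (e.cost + 1)) Q) :
    Runs W S (.seq (.assign x e) P) σ T Q :=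
  Runs.seq (runs_assign (Q := fun τ => Runs W S P τ (T - (e.cost + 1)) Q) he le_rfl h)
    (by omega)

theorem runs_put_seq {a : ℕ} (hi : i.Fits W σ) (he : e.Fits W σ) (hT : i.cost + e.cost + 1 ≤ T)
    (h : Runs W S P (σ.setArr a (Function.update (σ.arr a) (i.eval σ) (e.eval σ)))
      (T - (i.cost + e.cost + 1)) Q) :
    Runs W S (.seq (.put a i e) P) σ T Q :=
  Runs.seq (runs_put (Q := fun τ => Runs W S P τ (T - (i.cost + e.cost + 1)) Q) hi he le_rfl h)
    (by omega)

theorem runs_emit_seq (hi : i.Fits W σ) (hS : i.eval σ < S.length) (hT : i.cost + 1 ≤ T)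
    (h : Runs W S P (σ.push S[i.eval σ]) (T - (i.cost + 1)) Q) :
    Runs W S (.seq (.emit i) P) σ T Q :=
  Runs.seq (runs_emit (Q := fun τ => Runs W S P τ (T - (i.cost + 1)) Q) hi hS le_rfl h)
    (by omega)

theorem runs_branch (hf : b.Fits W S σ) (hT : b.cost ≤ T)
    (h1 : b.Holds S σ → Runs W S P σ (T - b.cost) Q)
    (h2 : ¬ b.Holds S σ → Runs W S P' σ (T - b.cost) Q) :
    Runs W S (.branch b P P') σ T Q := by
  by_cases hb : b.Holds S σ
  · obtain ⟨t, τ, h, ht, hq⟩ := h1 hb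
    exact ⟨_, τ, .branchTrue hf hb h, by omega, hq⟩
  · obtain ⟨t, τ, h, ht, hq⟩ := h2 hb
    exact ⟨_, τ, .branchFalse hf hb h, by omega, hq⟩

theorem runs_loop_of_not (hf : b.Fits W S σ) (hb : ¬ b.Holds S σ) (hT : b.cost ≤ T) (hQ : Q σ) :
    Runs W S (.loop b P) σ T Q :=
  ⟨_, σ, .loopFalse hf hb, hT, hQ⟩

theorem runs_loop_of_holds (hf : b.Fits W S σ) (hb : b.Holds S σ)
    (h : Runs W S P σ T₁ fun τ => Runs W S (.loop b P) τ T₂ Q) (hT : b.cost + T₁ + T₂ ≤ T) :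
    Runs W S (.loop b P) σ T Q := by
  obtain ⟨t, τ, h1, h2, u, ρ, h3, h4, h5⟩ := h
  exact ⟨_, ρ, .loopTrue hf hb h1 h3, by omega, h5⟩

theorem Test.cost_pos (b : Test) : 0 < b.cost := by cases b <;> simp [Test.cost]

/-- The loop rule; `I k σ` is an invariant for a store `σ` with `k` steps left. -/
theorem runs_loop (I : ℕ → Store α → Prop)
    (hI : ∀ k σ, I k σ → b.Fits W S σ ∧ b.cost ≤ k ∧ (¬ b.Holds S σ → Q σ) ∧
      (b.Holds S σ → ∃ c, b.cost + c ≤ k ∧ Runs W S P σ c fun τ => I (k - (b.cost + c)) τ))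
    (h : I T σ) : Runs W S (.loop b P) σ T Q := by
  induction T using Nat.strong_induction_on generalizing σ with
  | _ T ih =>
    obtain ⟨hf, hc, h1, h2⟩ := hI T σ h
    by_cases hb : b.Holds S σ
    · obtain ⟨c, hck, hr⟩ := h2 hb
      have := b.cost_pos
      exact runs_loop_of_holds hf hb (T₂ := T - (b.cost + c))
        (hr.mono le_rfl fun τ hτ => ih _ (by omega) hτ) (by omega)
    · exact runs_loop_of_not hf hb hc (h1 hb)

end Runs

/-! ### The comparison of positions

Variable 0 holds the length `n` of the input, and `n` also serves as a position after all
others. -/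

/-- The test whether the position `e` is at most the position `f` in the order of the ranks. -/
def leTest (e f : Expr) : Test :=
  .not (.and (.lt f (.var 0)) (.not (.and (.lt e (.var 0))
    (.and (.elemLe e f) (.not (.and (.elemLe f e) (.lt f e)))))))

section Compare

variable {α : Type*} [LinearOrder α] {W : ℕ} {S : List α} {σ : Store α} {e f : Expr}

/-- The guards treat every position outside the list as a last one: such an `f` passes at once, and
such an `e` fails against a genuine `f`. -/
theorem leTest_holds (h0 : σ.var 0 = S.length) :
    (leTest e f).Holds S σ ↔ rk S (e.eval σ) ≤ rk S (f.eval σ) := by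
  simp only [leTest, Test.Holds, Expr.eval, h0]
  by_cases hf : f.eval σ < S.length
  · by_cases he : e.eval σ < S.length
    · rw [rk_le_rk_iff he hf]
      simp [he, hf]
    · rw [rk_of_le (not_lt.1 he)]
      have := rk_lt hf
      simp [he, hf, this]
  · rw [rk_of_le (not_lt.1 hf)]
    simp [hf, rk_le]

theorem leTest_fits (h0 : σ.var 0 = S.length) (hW : S.length ≤ W) (he : e.Fits W σ)
    (hf : f.Fits W σ) : (leTest e f).Fits W S σ := by
  simp only [leTest, Test.Fits, Test.Holds, Expr.Fits, Expr.eval, h0]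
  simp +contextual [he, hf, hW]

end Compare

/-! ### Winner trees

The nodes of a tree with `N` leaves are numbered from `1` to `2 N - 1`, the children of `v` being
`2 v` and `2 v + 1`; node `v` of a tree with base `b` is stored at the address `b + v`.  Every inner
node holds the better one of the positions held by its children. -/

section Tree

variable {α : Type*} [LinearOrder α]

/-- The position of smaller rank. -/
noncomputable def best (S : List α) (p q : ℕ) : ℕ := if rk S p ≤ rk S q then p else q

/-- The array `A` holds a winner tree with base `b` and `N` leaves. -/
structure IsTree (S : List α) (A : ℕ → ℕ) (b N : ℕ) : Prop where
  le : ∀ v, 1 ≤ v → v < 2 * N → A (b + v) ≤ S.length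
  node : ∀ v, 1 ≤ v → v < N → A (b + v) = best S (A (b + 2 * v)) (A (b + 2 * v + 1))

theorem IsTree.congr {S : List α} {A A' : ℕ → ℕ} {b N : ℕ} (h : IsTree S A b N)
    (hA : ∀ v, 1 ≤ v → v < 2 * N → A' (b + v) = A (b + v)) : IsTree S A' b N where
  le v h1 h2 := by rw [hA v h1 h2]; exact h.le v h1 h2
  node v h1 h2 := by
    rw [hA v h1 (by omega), hA (2 * v) (by omega) (by omega), Nat.add_assoc b,
      hA (2 * v + 1) (by omega) (by omega)]
    exact h.node v h1 h2

/-- Induction from a node to its parent `v / 2`. The number of leaves need not be a power of two. -/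
theorem IsTree.rk_root_le {S : List α} {A : ℕ → ℕ} {b N : ℕ} (h : IsTree S A b N) {v : ℕ}
    (h1 : 1 ≤ v) (h2 : v < 2 * N) : rk S (A (b + 1)) ≤ rk S (A (b + v)) := by
  induction v using Nat.strong_induction_on with
  | _ v ih =>
    rcases h1.eq_or_lt with rfl | h1
    · exact le_rfl
    refine (ih (v / 2) (by omega) (by omega) (by omega)).trans ?_
    rw [h.node (v / 2) (by omega) (by omega), best]
    rcases Nat.even_or_odd' v with ⟨u, rfl | rfl⟩
    · have : 2 * u / 2 = u := by omega
      rw [this]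
      split_ifs with hc
      · exact le_rfl
      · exact (not_le.1 hc).le
    · have : (2 * u + 1) / 2 = u := by omega
      rw [this, Nat.add_assoc]
      split_ifs with hc
      · exact hc
      · exact le_rfl

theorem IsTree.exists_leaf {S : List α} {A : ℕ → ℕ} {b N : ℕ} (h : IsTree S A b N)
    (hN : 1 ≤ N) : ∃ j < N, A (b + 1) = A (b + (N + j)) := by
  have key : ∀ d v, 1 ≤ v → v < 2 * N → 2 * N - v ≤ d → ∃ j < N, A (b + v) = A (b + (N + j)) := by
    intro d
    induction d with
    | zero => intro v _ h2 h3; omega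
    | succ d ih =>
      intro v h1 h2 h3
      by_cases hv : v < N
      · rw [h.node v h1 hv, best]
        split_ifs
        · exact ih (2 * v) (by omega) (by omega) (by omega)
        · exact ih (2 * v + 1) (by omega) (by omega) (by omega)
      · exact ⟨v - N, by omega, by congr 2; omega⟩
  exact key _ 1 le_rfl (by omega) le_rfl

/-- Restore the inner nodes of a tree from the node in variable 11 up to the root. -/
def repair (a : ℕ) : Prog :=
  .loop (.lt (.const 0) (.var 11))
    (.seq
      (.branch (leTest (.get a (.add (.var 15) (.mul (.const 2) (.var 11))))
          (.get a (.add (.add (.var 15) (.mul (.const 2) (.var 11))) (.const 1))))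
        (.put a (.add (.var 15) (.var 11))
          (.get a (.add (.var 15) (.mul (.const 2) (.var 11)))))
        (.put a (.add (.var 15) (.var 11))
          (.get a (.add (.add (.var 15) (.mul (.const 2) (.var 11))) (.const 1)))))
      (.assign 11 (.div (.var 11) (.const 2))))

/-- Set the leaf in variable 11 of the tree with base in variable 15 to the value of
variable 16. -/
def setLeaf (a : ℕ) : Prog :=
  .seq (.put a (.add (.var 15) (.var 11)) (.var 16))
    (.seq (.assign 11 (.div (.var 11) (.const 2))) (repair a))

variable {W : ℕ} {S : List α}

/-- The invariant is that only the node in variable 11 may be wrong. Recomputing it from its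
children leaves at most its parent wrong; `j` bounds the depth of the node, at 100 steps per level.
The content of the current node is left unconstrained because it is overwritten. -/
theorem runs_repair {a b N : ℕ} (hW : S.length ≤ W) (hWb : b + 2 * N + 2 ≤ W) :
    ∀ (j : ℕ) (σ : Store α), σ.var 0 = S.length → σ.var 15 = b → σ.var 11 < N →
      σ.var 11 < 2 ^ j →
      (∀ v, 1 ≤ v → v < 2 * N → v ≠ σ.var 11 → σ.arr a (b + v) ≤ S.length) →
      (∀ v, 1 ≤ v → v < N → v ≠ σ.var 11 →
        σ.arr a (b + v) = best S (σ.arr a (b + 2 * v)) (σ.arr a (b + 2 * v + 1))) →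
      Runs W S (repair a) σ (100 * j + 3) fun τ => ∃ A,
        τ = (σ.setVar 11 0).setArr a A ∧ IsTree S A b N ∧
        ∀ x, (∀ v, 1 ≤ v → v < N → x ≠ b + v) → A x = σ.arr a x := by
  intro j
  induction j with
  | zero =>
    intro σ h0 h15 hN h11 hle hok
    have h11 : σ.var 11 = 0 := by simpa using h11
    refine runs_loop_of_not (by simp [Test.Fits, Expr.Fits, h11]) (by simp [Test.Holds, Expr.eval, h11])
      (by simp [Test.cost, Expr.cost]) ⟨σ.arr a, ?_, ⟨?_, ?_⟩, fun _ _ => rfl⟩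
    · rcases σ with ⟨v, r, o⟩
      simp only at h11
      simp [Store.setVar, Store.setArr, ← h11]
    · exact fun v h1 h2 => hle v h1 h2 (by omega)
    · exact fun v h1 h2 => hok v h1 h2 (by omega)
  | succ j ih =>
    intro σ h0 h15 hN h11 hle hok
    rcases Nat.eq_zero_or_pos (σ.var 11) with hz | hpos
    -- The walk has already passed the root, and fewer steps suffice.
    · refine (ih σ h0 h15 hN (by rw [hz]; exact Nat.two_pow_pos j) hle hok).mono (by omega)
        fun _ h => h
    set c := σ.var 11 with hc
    have l1 : σ.arr a (b + 2 * c) ≤ S.length := by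
      have := hle (2 * c) (by omega) (by omega) (by omega)
      exact this
    have l2 : σ.arr a (b + 2 * c + 1) ≤ S.length := by
      have := hle (2 * c + 1) (by omega) (by omega) (by omega)
      exact this
    set A := Function.update (σ.arr a) (b + c)
      (best S (σ.arr a (b + 2 * c)) (σ.arr a (b + 2 * c + 1))) with hA
    have hA' : ∀ v, v ≠ c → A (b + v) = σ.arr a (b + v) := fun v hv => by
      rw [hA, Function.update_of_ne (by omega)]
    have hAc : A (b + c) = best S (σ.arr a (b + 2 * c)) (σ.arr a (b + 2 * c + 1)) := by
      rw [hA, Function.update_self]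
    refine runs_loop_of_holds (T₁ := 94) (T₂ := 100 * j + 3) ?_ ?_ ?_ ?_
    · simp only [Test.Fits, Expr.Fits]; omega
    · simpa [Test.Holds, Expr.eval] using hpos
    · refine Runs.seq (T₁ := 90) (T₂ := 4) ?_ (by omega)
      have hstep : ∀ τ, τ = σ.setArr a A → Runs W S (.assign 11 (.div (.var 11) (.const 2))) τ 4
          fun τ => Runs W S (repair a) τ (100 * j + 3) fun τ => ∃ A,
            τ = (σ.setVar 11 0).setArr a A ∧ IsTree S A b N ∧
            ∀ x, (∀ v, 1 ≤ v → v < N → x ≠ b + v) → A x = σ.arr a x := by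
        rintro _ rfl
        refine runs_assign ?_ (by simp [Expr.cost]) ?_
        · simp only [Expr.Fits, Store.setArr_var]; omega
        simp only [Expr.eval, Store.setArr_var, ← hc]
        refine (ih _ ?_ ?_ ?_ ?_ ?_ ?_).mono le_rfl ?_
        · simpa using h0
        · simpa using h15
        · simp; omega
        · simp only [Store.setVar_var, if_true]
          rw [pow_succ] at h11
          omega
        · intro v h1 h2 h3
          simp only [Store.setVar_arr, Store.setArr_arr, if_true]
          by_cases hv : v = c
          · rw [hv, hAc, best]; split_ifs <;> assumption
          · rw [hA' v hv]; exact hle v h1 h2 hv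
        · intro v h1 h2 h3
          simp only [Store.setVar_arr, Store.setArr_arr, if_true]
          simp only [Store.setVar_var, if_true] at h3
          by_cases hv : v = c
          · subst hv
            rw [hAc, hA' (2 * c) (by omega), Nat.add_assoc b, hA' (2 * c + 1) (by omega)]
          · rw [hA' v hv, hA' (2 * v) (by omega), Nat.add_assoc b, hA' (2 * v + 1) (by omega)]
            exact hok v h1 h2 hv
        · rintro _ ⟨A₂, rfl, hT, hx⟩
          refine ⟨A₂, ?_, hT, fun x h => ?_⟩
          · simp [Store.setVar, Store.setArr]
          · rw [hx x h]
            simp only [Store.setVar_arr, Store.setArr_arr, if_true, hA]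
            rw [Function.update_of_ne (h c hpos hN)]
      refine runs_branch ?_ (by simp [leTest, Test.cost, Expr.cost]) ?_ ?_
      · refine leTest_fits h0 hW ?_ ?_
        · simp only [Expr.Fits, Expr.eval, h15, ← hc]; omega
        · simp only [Expr.Fits, Expr.eval, h15, ← hc]; omega
      · intro hh
        rw [leTest_holds h0] at hh
        simp only [Expr.eval, h15, ← hc] at hh
        refine runs_put ?_ ?_ (by simp [leTest, Test.cost, Expr.cost]) (hstep _ ?_)
        · simp only [Expr.Fits, Expr.eval, h15, ← hc]; omega
        · simp only [Expr.Fits, Expr.eval, h15, ← hc]; omega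
        · simp only [Expr.eval, h15, ← hc]
          rw [hA, best, if_pos hh]
      · intro hh
        rw [leTest_holds h0] at hh
        simp only [Expr.eval, h15, ← hc] at hh
        refine runs_put ?_ ?_ (by simp [leTest, Test.cost, Expr.cost]) (hstep _ ?_)
        · simp only [Expr.Fits, Expr.eval, h15, ← hc]; omega
        · simp only [Expr.Fits, Expr.eval, h15, ← hc]; omega
        · simp only [Expr.eval, h15, ← hc]
          rw [hA, best, if_neg hh]
    · simp only [Test.cost, Expr.cost]; omega

theorem runs_setLeaf {a b N c x j T : ℕ} {σ : Store α} {Q : Store α → Prop} (hW : S.length ≤ W)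
    (hWb : b + 2 * N + 2 ≤ W) (h0 : σ.var 0 = S.length) (h15 : σ.var 15 = b)
    (h11 : σ.var 11 = N + c) (hc : c < N) (h16 : σ.var 16 = x) (hx : x ≤ S.length)
    (hj : N ≤ 2 ^ j) (hT : 100 * j + 20 ≤ T) (hA : IsTree S (σ.arr a) b N)
    (hQ : ∀ A, IsTree S A b N → A (b + (N + c)) = x →
      (∀ d < N, d ≠ c → A (b + (N + d)) = σ.arr a (b + (N + d))) →
      (∀ y, (∀ v, 1 ≤ v → v < 2 * N → y ≠ b + v) → A y = σ.arr a y) →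
      Q ((σ.setVar 11 0).setArr a A)) :
    Runs W S (setLeaf a) σ T Q := by
  refine runs_put_seq ?_ ?_ (by simp only [Expr.cost]; omega) ?_
  · simp only [Expr.Fits, Expr.eval, h15, h11]; omega
  · simp only [Expr.Fits, h16]; omega
  refine runs_assign_seq ?_ (by simp only [Expr.cost]; omega) ?_
  · simp only [Expr.Fits, Store.setArr_var, h11]; omega
  simp only [Expr.eval, Expr.cost, h15, h11, h16, Store.setArr_var]
  refine (runs_repair hW hWb j _ ?_ ?_ ?_ ?_ ?_ ?_).mono (by omega) ?_
  · simpa using h0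
  · simpa using h15
  · simp; omega
  · simp; omega
  · intro v h1 h2 h3
    simp only [Store.setVar_arr, Store.setArr_arr, if_true]
    by_cases hv : v = N + c
    · rw [hv, Function.update_self]; exact hx
    · rw [Function.update_of_ne (by omega)]; exact hA.le v h1 h2
  · intro v h1 h2 h3
    simp only [Store.setVar_var, if_true] at h3
    simp only [Store.setVar_arr, Store.setArr_arr, if_true]
    rw [Function.update_of_ne (by omega), Function.update_of_ne (by omega),
      Function.update_of_ne (by omega)]
    exact hA.node v h1 h2
  · rintro _ ⟨A, rfl, hT, hy⟩
    have hleaf : ∀ d < N, A (b + (N + d)) = Function.update (σ.arr a) (b + (N + c)) x (b + (N + d)) :=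
      fun d _ => by
        rw [hy _ fun v h1 h2 => by omega]
        simp
    have : (((σ.setArr a (Function.update (σ.arr a) (b + (N + c)) x)).setVar 11
        ((N + c) / 2)).setVar 11 0).setArr a A = (σ.setVar 11 0).setArr a A := by
      simp [Store.setVar, Store.setArr]
    rw [this]
    refine hQ A hT ?_ ?_ ?_
    · rw [hleaf c hc, Function.update_self]
    · intro d hd hdc
      rw [hleaf d hd, Function.update_of_ne (by omega)]
    · intro y h
      rw [hy y fun v h1 h2 => h v h1 (by omega)]
      simp only [Store.setVar_arr, Store.setArr_arr, if_true]
      rw [Function.update_of_ne (h _ (by omega) (by omega))]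

end Tree

/-! ### The data structure of the merging algorithm -/

section Data

variable {α : Type*} [LinearOrder α]

/-- `p` is the first position of rank at least `t` that satisfies `I`; it is `S.length` if there is
no such position. -/
structure IsHead (S : List α) (I : ℕ → Prop) (t p : ℕ) : Prop where
  le : p ≤ S.length
  mem : p < S.length → I p ∧ t ≤ rk S p
  min : ∀ q < S.length, I q → t ≤ rk S q → rk S p ≤ rk S q

variable {S : List α} {I J : ℕ → Prop} {t p q : ℕ}

theorem IsHead.congr (h : IsHead S I t p) (hIJ : ∀ q < S.length, I q ↔ J q) : IsHead S J t p where
  le := h.le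
  mem hp := ⟨(hIJ p hp).1 (h.mem hp).1, (h.mem hp).2⟩
  min q hq hJ := h.min q hq ((hIJ q hq).2 hJ)

theorem isHead_length (h : ∀ q < S.length, ¬ I q) : IsHead S I t S.length where
  le := le_rfl
  mem h := absurd h (lt_irrefl _)
  min q hq hI := absurd hI (h q hq)

theorem IsHead.le_rk (h : IsHead S I t p) (ht : t ≤ S.length) : t ≤ rk S p := by
  rcases h.le.lt_or_eq with hp | rfl
  · exact (h.mem hp).2
  · rw [rk_of_le le_rfl]; exact ht

theorem IsHead.succ (h : IsHead S I t p) (hne : rk S p ≠ t) : IsHead S I (t + 1) p where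
  le := h.le
  mem hp := ⟨(h.mem hp).1, by have := (h.mem hp).2; omega⟩
  min q hq hI ht := h.min q hq hI (by omega)

/-- The root holds the content of some leaf and has the least rank among the leaves, so heads of the
parts combine to the head of their union. -/
theorem IsTree.isHead {A : ℕ → ℕ} {b N : ℕ} (hA : IsTree S A b N) (hN : 1 ≤ N)
    {I : ℕ → ℕ → Prop} (h : ∀ j < N, IsHead S (I j) t (A (b + (N + j)))) :
    IsHead S (fun p => ∃ j < N, I j p) t (A (b + 1)) where
  le := hA.le 1 le_rfl (by omega)
  mem hp := by
    obtain ⟨j, hj, he⟩ := hA.exists_leaf hN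
    rw [he] at hp ⊢
    exact ⟨⟨j, hj, ((h j hj).mem hp).1⟩, ((h j hj).mem hp).2⟩
  min q hq hI ht := by
    obtain ⟨j, hj, hI⟩ := hI
    exact (hA.rk_root_le (v := N + j) (by omega) (by omega)).trans ((h j hj).min q hq hI ht)

/-- The class `g` is held by one of the first `cnt` slots. -/
def Loaded (slot grp : ℕ → ℕ) (cnt g : ℕ) : Prop := slot g < cnt ∧ grp (slot g) = g

instance (slot grp : ℕ → ℕ) (cnt g : ℕ) : Decidable (Loaded slot grp cnt g) :=
  inferInstanceAs (Decidable (_ ∧ _))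

/-- Sparse-set representation: membership is confirmed by the two arrays pointing at each other, so
stale entries of `slot` and `grp` are harmless and never have to be cleared. -/
theorem loaded_update {slot grp : ℕ → ℕ} {cnt g : ℕ} (d : ℕ) :
    Loaded (Function.update slot g cnt) (Function.update grp cnt g) (cnt + 1) d ↔
      Loaded slot grp cnt d ∨ d = g := by
  unfold Loaded
  by_cases hd : d = g
  · subst hd; simp
  · rw [Function.update_of_ne hd]
    by_cases hs : slot d = cnt
    · simp [hs, hd, Ne.symm hd]
    · rw [Function.update_of_ne hs]
      simp only [hd, or_false]
      constructor
      · rintro ⟨h1, h2⟩; exact ⟨by omega, h2⟩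
      · rintro ⟨h1, h2⟩; exact ⟨by omega, h2⟩

/-- The state of the data structure when the positions of rank less than `t` have been output.
The `m` sequences are grouped into `G` groups of `K`; position `p` belongs to the sequence `sq p`.
* `cur` holds the heads of the sequences;
* `F` holds one winner tree for every group;
* `V` holds a winner tree of the heads of the groups in the first `cnt` slots;
* `U` holds a winner tree of the heads of all other groups. -/
structure Conf (S : List α) (sq : ℕ → ℕ) (m K G t cnt : ℕ) (cur F U V slot grp : ℕ → ℕ) :
    Prop where
  head : ∀ i < m, IsHead S (fun p => sq p = i) t (cur i)
  tree : ∀ g < G, IsTree S F (2 * K * g) K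
  leaf : ∀ g < G, ∀ j < K,
    F (2 * K * g + (K + j)) = if K * g + j < m then cur (K * g + j) else S.length
  cnt_le : cnt ≤ K
  grp_lt : ∀ s < cnt, grp s < G
  slot_grp : ∀ s < cnt, slot (grp s) = s
  top : IsTree S U 0 G
  top_leaf : ∀ g < G,
    U (0 + (G + g)) = if Loaded slot grp cnt g then S.length else F (2 * K * g + 1)
  small : IsTree S V 0 K
  small_leaf : ∀ s < K, V (0 + (K + s)) = if s < cnt then F (2 * K * grp s + 1) else S.length

variable {sq : ℕ → ℕ} {m K G cnt : ℕ} {cur F U V slot grp : ℕ → ℕ}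

theorem Conf.group_head (h : Conf S sq m K G t cnt cur F U V slot grp) (hK : 1 ≤ K)
    (hsq : ∀ p < S.length, sq p < m) {g : ℕ} (hg : g < G) :
    IsHead S (fun p => sq p / K = g) t (F (2 * K * g + 1)) := by
  have key := (h.tree g hg).isHead (t := t) hK (I := fun j p => K * g + j < m ∧ sq p = K * g + j) ?_
  · refine key.congr fun p hp => ⟨?_, ?_⟩
    · rintro ⟨j, hj, -, hs⟩
      rw [hs, Nat.mul_add_div hK, Nat.div_eq_of_lt hj, Nat.add_zero]
    · rintro rfl
      refine ⟨sq p % K, Nat.mod_lt _ hK, ?_, (Nat.div_add_mod _ _).symm⟩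
      rw [Nat.div_add_mod]
      exact hsq p hp
  · intro j hj
    rw [h.leaf g hg j hj]
    split_ifs with hm
    · exact (h.head _ hm).congr fun p _ => ⟨fun h => ⟨hm, h⟩, fun h => h.2⟩
    · exact isHead_length fun p _ h => hm h.1

theorem Conf.small_head (h : Conf S sq m K G t cnt cur F U V slot grp) (hK : 1 ≤ K)
    (hsq : ∀ p < S.length, sq p < m) :
    IsHead S (fun p => Loaded slot grp cnt (sq p / K)) t (V 1) := by
  have key := h.small.isHead (t := t) hK (I := fun s p => s < cnt ∧ sq p / K = grp s) ?_
  · refine key.congr fun p hp => ⟨?_, ?_⟩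
    · rintro ⟨s, -, hs, he⟩
      refine ⟨?_, ?_⟩
      · rw [he, h.slot_grp s hs]; exact hs
      · rw [he, h.slot_grp s hs]
    · rintro ⟨h1, h2⟩
      exact ⟨_, h1.trans_le h.cnt_le, h1, h2.symm⟩
  · intro s hs
    rw [h.small_leaf s hs]
    split_ifs with hc
    · exact (h.group_head hK hsq (h.grp_lt s hc)).congr
        fun p _ => ⟨fun h => ⟨hc, h⟩, fun h => h.2⟩
    · exact isHead_length fun p _ h => hc h.1

theorem Conf.top_head (h : Conf S sq m K G t cnt cur F U V slot grp) (hK : 1 ≤ K) (hG : 1 ≤ G)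
    (hsq : ∀ p < S.length, sq p < m) (hsG : ∀ p < S.length, sq p / K < G) :
    IsHead S (fun p => ¬ Loaded slot grp cnt (sq p / K)) t (U 1) := by
  have key := h.top.isHead (t := t) hG
    (I := fun g p => ¬ Loaded slot grp cnt g ∧ sq p / K = g) ?_
  · refine key.congr fun p hp => ⟨?_, fun h => ⟨_, hsG p hp, h, rfl⟩⟩
    rintro ⟨g, -, hl, rfl⟩
    exact hl
  · intro g hg
    rw [h.top_leaf g hg]
    split_ifs with hc
    · exact isHead_length fun p _ h => h.1 hc
    · exact (h.group_head hK hsq hg).congr fun p _ => ⟨fun h => ⟨hc, h⟩, fun h => h.2⟩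

/-- The better one of the two roots is the position of rank `t`. -/
theorem Conf.rk_root (h : Conf S sq m K G t cnt cur F U V slot grp) (hK : 1 ≤ K) (hG : 1 ≤ G)
    (hsq : ∀ p < S.length, sq p < m) (hsG : ∀ p < S.length, sq p / K < G) (ht : t < S.length) :
    (rk S (V 1) ≤ rk S (U 1) → V 1 < S.length ∧ rk S (V 1) = t ∧
      Loaded slot grp cnt (sq (V 1) / K)) ∧
    (¬ rk S (V 1) ≤ rk S (U 1) → U 1 < S.length ∧ rk S (U 1) = t ∧
      ¬ Loaded slot grp cnt (sq (U 1) / K)) := by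
  have hV := h.small_head hK hsq
  have hU := h.top_head hK hG hsq hsG
  have lV := hV.le_rk ht.le
  have lU := hU.le_rk ht.le
  have hr := rk_posOf ht
  -- The position of rank `t` belongs to a group that either has a slot or has none, and the
  -- corresponding root cannot come after it.
  have hmin : rk S (V 1) ≤ t ∨ rk S (U 1) ≤ t := by
    by_cases hl : Loaded slot grp cnt (sq (posOf S t) / K)
    · exact Or.inl (hr ▸ hV.min _ (posOf_lt ht) hl (by omega))
    · exact Or.inr (hr ▸ hU.min _ (posOf_lt ht) hl (by omega))
  have hlt : ∀ p, rk S p ≤ t → p < S.length := fun p hp => by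
    by_contra hn
    rw [rk_of_le (not_lt.1 hn)] at hp
    omega
  refine ⟨fun hle => ?_, fun hle => ?_⟩
  · have h1 := hlt (V 1) (by omega)
    exact ⟨h1, by omega, (hV.mem h1).1⟩
  · have h1 := hlt (U 1) (by omega)
    exact ⟨h1, by omega, (hU.mem h1).1⟩

/-- The heads after the output of the position `p`. -/
theorem heads_succ (h : ∀ i < m, IsHead S (fun p => sq p = i) t (cur i)) (hp : p < S.length)
    (hrk : rk S p = t) {x : ℕ} (hx : IsHead S (fun q => sq q = sq p) (t + 1) x) :
    ∀ i < m, IsHead S (fun q => sq q = i) (t + 1) (Function.update cur (sq p) x i) := by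
  intro i hi
  by_cases hip : i = sq p
  · subst hip
    rw [Function.update_self]
    exact hx
  · rw [Function.update_of_ne hip]
    refine (h i hi).succ fun he => hip ?_
    have hc : cur i < S.length := by
      by_contra hn
      rw [rk_of_le (not_lt.1 hn)] at he
      have := rk_lt hp
      omega
    have := rk_inj hc hp (he.trans hrk.symm)
    rw [← this, ((h i hi).mem hc).1]

theorem addr_ne {K g g' v v' : ℕ} (hv : v < 2 * K) (hv' : v' < 2 * K) (hg : g ≠ g') :
    2 * K * g + v ≠ 2 * K * g' + v' := by
  rcases Nat.lt_or_gt_of_ne hg with h | h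
  · have : 2 * K * (g + 1) ≤ 2 * K * g' := Nat.mul_le_mul_left _ h
    rw [Nat.mul_add] at this
    omega
  · have : 2 * K * (g' + 1) ≤ 2 * K * g := Nat.mul_le_mul_left _ h
    rw [Nat.mul_add] at this
    omega

/-- A new value of one leaf of the forest. -/
theorem forest_update {cur' F' : ℕ → ℕ} {i x : ℕ} (hK : 1 ≤ K)
    (htree : ∀ g < G, IsTree S F (2 * K * g) K)
    (hleaf : ∀ g < G, ∀ j < K,
      F (2 * K * g + (K + j)) = if K * g + j < m then cur (K * g + j) else S.length)
    (him : i < m)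
    (h1 : IsTree S F' (2 * K * (i / K)) K) (h2 : F' (2 * K * (i / K) + (K + i % K)) = x)
    (h3 : ∀ d < K, d ≠ i % K →
      F' (2 * K * (i / K) + (K + d)) = F (2 * K * (i / K) + (K + d)))
    (h4 : ∀ y, (∀ v, 1 ≤ v → v < 2 * K → y ≠ 2 * K * (i / K) + v) → F' y = F y)
    (hc : cur' = Function.update cur i x) :
    (∀ g < G, IsTree S F' (2 * K * g) K) ∧
    (∀ g < G, ∀ j < K,
      F' (2 * K * g + (K + j)) = if K * g + j < m then cur' (K * g + j) else S.length) ∧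
    ∀ g, g ≠ i / K → F' (2 * K * g + 1) = F (2 * K * g + 1) := by
  have hne : ∀ g v, g ≠ i / K → v < 2 * K → F' (2 * K * g + v) = F (2 * K * g + v) :=
    fun g v hg hv => h4 _ fun v' _ hv' => addr_ne hv hv' hg
  refine ⟨fun g hg => ?_, fun g hg j hj => ?_, fun g hg => hne g 1 hg (by omega)⟩
  · by_cases hgi : g = i / K
    · subst hgi; exact h1
    · exact (htree g hg).congr fun v _ hv => hne g v hgi hv
  · have hdm := Nat.div_add_mod i K
    by_cases hgi : g = i / K
    · by_cases hji : j = i % K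
      · subst hgi hji
        rw [h2, hdm, if_pos him, hc, Function.update_self]
      · rw [hgi, h3 j hj hji, ← hgi, hleaf g hg j hj, hc, Function.update_of_ne (by
          rw [hgi]; omega)]
    · rw [hne g _ hgi (by omega), hleaf g hg j hj, hc, Function.update_of_ne]
      intro he
      apply hgi
      rw [← he, Nat.mul_add_div hK, Nat.div_eq_of_lt hj, Nat.add_zero]

/-- The group that changes is loaded, so its leaf in `U` is the sentinel and `U` stays correct
untouched. This is why an output does not pay for the tree with G leaves. -/
theorem Conf.pop {x : ℕ} {F' V' : ℕ → ℕ} (h : Conf S sq m K G t cnt cur F U V slot grp)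
    (hK : 1 ≤ K) (hsq : ∀ p < S.length, sq p < m) (hp : p < S.length)
    (hrk : rk S p = t) (hl : Loaded slot grp cnt (sq p / K))
    (hx : IsHead S (fun q => sq q = sq p) (t + 1) x)
    (f1 : IsTree S F' (2 * K * (sq p / K)) K)
    (f2 : F' (2 * K * (sq p / K) + (K + sq p % K)) = x)
    (f3 : ∀ d < K, d ≠ sq p % K →
      F' (2 * K * (sq p / K) + (K + d)) = F (2 * K * (sq p / K) + (K + d)))
    (f4 : ∀ y, (∀ v, 1 ≤ v → v < 2 * K → y ≠ 2 * K * (sq p / K) + v) → F' y = F y)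
    (v1 : IsTree S V' 0 K)
    (v2 : V' (0 + (K + slot (sq p / K))) = F' (2 * K * (sq p / K) + 1))
    (v3 : ∀ d < K, d ≠ slot (sq p / K) → V' (0 + (K + d)) = V (0 + (K + d))) :
    Conf S sq m K G (t + 1) cnt (Function.update cur (sq p) x) F' U V' slot grp := by
  obtain ⟨t1, t2, t3⟩ := forest_update hK h.tree h.leaf (hsq p hp) f1 f2 f3 f4 rfl
  refine ⟨heads_succ h.head hp hrk hx, t1, t2, h.cnt_le, h.grp_lt, h.slot_grp, h.top, ?_, v1, ?_⟩
  · intro g hg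
    rw [h.top_leaf g hg]
    split_ifs with hc
    · rfl
    · exact (t3 g fun he => hc (he ▸ hl)).symm
  · intro s hs
    by_cases hss : s = slot (sq p / K)
    · rw [hss, v2, if_pos hl.1, hl.2]
    · rw [v3 s hs hss, h.small_leaf s hs]
      split_ifs with hc
      · refine (t3 _ fun he => hss ?_).symm
        rw [← he, h.slot_grp s hc]
      · rfl

theorem Conf.load {g : ℕ} {U' V' : ℕ → ℕ} (h : Conf S sq m K G t cnt cur F U V slot grp)
    (hg : g < G) (hl : ¬ Loaded slot grp cnt g) (hcnt : cnt < K)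
    (u1 : IsTree S U' 0 G) (u2 : U' (0 + (G + g)) = S.length)
    (u3 : ∀ d < G, d ≠ g → U' (0 + (G + d)) = U (0 + (G + d)))
    (v1 : IsTree S V' 0 K) (v2 : V' (0 + (K + cnt)) = F (2 * K * g + 1))
    (v3 : ∀ d < K, d ≠ cnt → V' (0 + (K + d)) = V (0 + (K + d))) :
    Conf S sq m K G t (cnt + 1) cur F U' V' (Function.update slot g cnt)
      (Function.update grp cnt g) := by
  have hgrp : ∀ s < cnt, Function.update grp cnt g s = grp s := fun s hs =>
    Function.update_of_ne (by omega) _ _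
  have hne : ∀ s < cnt, grp s ≠ g := fun s hs he => hl ⟨by rw [← he, h.slot_grp s hs]; exact hs,
    by rw [← he, h.slot_grp s hs]⟩
  have hL := loaded_update (slot := slot) (grp := grp) (cnt := cnt) (g := g)
  refine ⟨h.head, h.tree, h.leaf, hcnt, ?_, ?_, u1, ?_, v1, ?_⟩
  · intro s hs
    by_cases hsc : s = cnt
    · rw [hsc, Function.update_self]; exact hg
    · rw [hgrp s (by omega)]; exact h.grp_lt s (by omega)
  · intro s hs
    by_cases hsc : s = cnt
    · rw [hsc, Function.update_self, Function.update_self]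
    · rw [hgrp s (by omega), Function.update_of_ne (hne s (by omega))]
      exact h.slot_grp s (by omega)
  · intro d hd
    by_cases hdg : d = g
    · rw [hdg, u2, if_pos ((hL g).2 (Or.inr rfl))]
    · rw [u3 d hd hdg, h.top_leaf d hd]
      simp only [hL, hdg, or_false]
  · intro s hs
    by_cases hsc : s = cnt
    · subst hsc; rw [v2, if_pos (by omega), Function.update_self]
    · rw [v3 s hs hsc, h.small_leaf s hs]
      by_cases hlt : s < cnt
      · rw [if_pos hlt, if_pos (by omega), hgrp s hlt]
      · rw [if_neg hlt, if_neg (by omega)]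

/-- Lowering the counter removes exactly the group of the last slot, and its head, which may have
moved on in the meantime, returns to `U`. -/
theorem Conf.unload {U' V' : ℕ → ℕ} (h : Conf S sq m K G t (cnt + 1) cur F U V slot grp)
    (u1 : IsTree S U' 0 G) (u2 : U' (0 + (G + grp cnt)) = F (2 * K * grp cnt + 1))
    (u3 : ∀ d < G, d ≠ grp cnt → U' (0 + (G + d)) = U (0 + (G + d)))
    (v1 : IsTree S V' 0 K) (v2 : V' (0 + (K + cnt)) = S.length)
    (v3 : ∀ d < K, d ≠ cnt → V' (0 + (K + d)) = V (0 + (K + d))) :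
    Conf S sq m K G t cnt cur F U' V' slot grp := by
  have hL : ∀ d, Loaded slot grp cnt d ↔ Loaded slot grp (cnt + 1) d ∧ d ≠ grp cnt := by
    intro d
    unfold Loaded
    constructor
    · rintro ⟨h1, h2⟩
      refine ⟨⟨by omega, h2⟩, fun he => ?_⟩
      rw [he, h.slot_grp cnt (by omega)] at h1
      omega
    · rintro ⟨⟨h1, h2⟩, h3⟩
      refine ⟨lt_of_le_of_ne (by omega) fun he => h3 ?_, h2⟩
      rw [← he, h2]
  refine ⟨h.head, h.tree, h.leaf, by have := h.cnt_le; omega, fun s hs => h.grp_lt s (by omega),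
    fun s hs => h.slot_grp s (by omega), u1, ?_, v1, ?_⟩
  · intro d hd
    by_cases hdg : d = grp cnt
    · rw [hdg, u2, if_neg fun hl => ((hL _).1 hl).2 rfl]
    · rw [u3 d hd hdg, h.top_leaf d hd]
      simp only [hL, hdg, ne_eq, not_false_eq_true, and_true]
  · intro s hs
    by_cases hsc : s = cnt
    · subst hsc; rw [v2, if_neg (by omega)]
    · rw [v3 s hs hsc, h.small_leaf s hs]
      by_cases hlt : s < cnt
      · rw [if_pos hlt, if_pos (by omega)]
      · rw [if_neg hlt, if_neg (by omega)]

end Data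

/-! ### The steps of the merging algorithm

Variables: 0 length `n`, 1 number of sequences `m`, 2 `lg`, 3 group size `K`, 4 number of groups `G`,
5 window size `w`, 6 bound on the loads, 7 number of elements output, 8 number of used slots,
9 number of elements output in the current window, 10 number of loads; 11 to 17 are auxiliary.
Arrays: 0 lengths, 1 sequence of a position, 2 heads, 3 ends of the sequences, 4 the forest of the
groups, 5 tree of the other groups, 6 tree of the slots, 7 slot of a group, 8 group of a slot. -/

/-- Enter the value of variable 16 as the head of the sequence in variable 13 into the forest. -/
def putHead : Prog :=
  .seq (.assign 14 (.div (.var 13) (.var 3))) <|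
  .seq (.assign 15 (.mul (.mul (.const 2) (.var 3)) (.var 14))) <|
  .seq (.assign 11 (.add (.var 3) (.sub (.var 13) (.mul (.var 3) (.var 14))))) <|
  setLeaf 4

/-- Make the value of variable 16 the head of the sequence in variable 13, which belongs to a group
in a slot. -/
def replaceHead : Prog :=
  .seq (.put 2 (.var 13) (.var 16)) <|
  .seq putHead <|
  .seq (.assign 16 (.get 4 (.add (.var 15) (.const 1)))) <|
  .seq (.assign 15 (.const 0)) <|
  .seq (.assign 11 (.add (.var 3) (.get 7 (.var 14)))) <|
  setLeaf 6

/-- Output the best position of the slots. -/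
def popStep : Prog :=
  .seq (.assign 12 (.get 6 (.const 1))) <|
  .seq (.emit (.var 12)) <|
  .seq (.assign 7 (.add (.var 7) (.const 1))) <|
  .seq (.assign 9 (.add (.var 9) (.const 1))) <|
  .seq (.assign 13 (.get 1 (.var 12))) <|
  .seq (.branch (.lt (.add (.var 12) (.const 1)) (.get 3 (.var 13)))
    (.assign 16 (.add (.var 12) (.const 1))) (.assign 16 (.var 0))) <|
  replaceHead

/-- Move the best group outside the slots into a new slot. -/
def loadStep : Prog :=
  .seq (.assign 12 (.get 5 (.const 1))) <|
  .seq (.assign 14 (.div (.get 1 (.var 12)) (.var 3))) <|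
  .seq (.assign 16 (.var 0)) <|
  .seq (.assign 15 (.const 0)) <|
  .seq (.assign 11 (.add (.var 4) (.var 14))) <|
  .seq (setLeaf 5) <|
  .seq (.assign 16 (.get 4 (.add (.mul (.mul (.const 2) (.var 3)) (.var 14)) (.const 1)))) <|
  .seq (.assign 11 (.add (.var 3) (.var 8))) <|
  .seq (setLeaf 6) <|
  .seq (.put 7 (.var 14) (.var 8)) <|
  .seq (.put 8 (.var 8) (.var 14)) <|
  .seq (.assign 8 (.add (.var 8) (.const 1))) <|
  .assign 10 (.add (.var 10) (.const 1))

/-- Give up the last slot. -/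
def unloadStep : Prog :=
  .seq (.assign 8 (.sub (.var 8) (.const 1))) <|
  .seq (.assign 14 (.get 8 (.var 8))) <|
  .seq (.assign 16 (.get 4 (.add (.mul (.mul (.const 2) (.var 3)) (.var 14)) (.const 1)))) <|
  .seq (.assign 15 (.const 0)) <|
  .seq (.assign 11 (.add (.var 4) (.var 14))) <|
  .seq (setLeaf 5) <|
  .seq (.assign 16 (.var 0)) <|
  .seq (.assign 11 (.add (.var 3) (.var 8))) <|
  setLeaf 6

/-! ### The layout of sorted sequences and the size constraints of a phase -/

section Steps

variable {α : Type*} [LinearOrder α]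

/-- The list `S` consists of `m` sorted sequences, the `i`-th of which occupies the positions from
`st i` to `st (i + 1)`; `sq p` is the sequence of the position `p`. -/
structure Layout (S : List α) (m : ℕ) (st sq : ℕ → ℕ) : Prop where
  lt : ∀ p < S.length, sq p < m
  lt_end : ∀ p < S.length, p < st (sq p + 1)
  eq : ∀ i < m, ∀ p, st i ≤ p → p < st (i + 1) → sq p = i
  start_le : ∀ p < S.length, st (sq p) ≤ p
  end_le : ∀ i < m, st (i + 1) ≤ S.length
  mono : Monotone sq
  sorted : ∀ p q, p < q → q < S.length → sq p = sq q → rk S p < rk S q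

/-- The position after `p` in its sequence. -/
def nextPos (S : List α) (st sq : ℕ → ℕ) (p : ℕ) : ℕ :=
  if p + 1 < st (sq p + 1) then p + 1 else S.length

/-- Ranks increase along a sequence, so the elements left in it after `p` are those at later
positions, the first of which is `p + 1` unless the sequence ends there. -/
theorem Layout.isHead_nextPos {S : List α} {m : ℕ} {st sq : ℕ → ℕ} (h : Layout S m st sq) {p t : ℕ}
    (hp : p < S.length) (hrk : rk S p = t) :
    IsHead S (fun q => sq q = sq p) (t + 1) (nextPos S st sq p) := by
  have hlt : ∀ q < S.length, sq q = sq p → t + 1 ≤ rk S q → p < q := by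
    intro q hq hs hr
    by_contra hle
    rcases (not_lt.1 hle).lt_or_eq with h1 | h1
    · have := h.sorted q p h1 hp hs; omega
    · subst h1; omega
  have hend := h.end_le _ (h.lt p hp)
  unfold nextPos
  split_ifs with hc
  · have hs : sq (p + 1) = sq p :=
      h.eq _ (h.lt p hp) _ (by have := h.start_le p hp; omega) hc
    refine ⟨by omega, fun _ => ⟨hs, ?_⟩, fun q hq hs' hr => ?_⟩
    · have := h.sorted p (p + 1) (by omega) (by omega) hs.symm; omega
    · rcases Nat.lt_or_eq_of_le (hlt q hq hs' hr : p + 1 ≤ q) with h1 | h1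
      · exact (h.sorted (p + 1) q h1 hq (hs.trans hs'.symm)).le
      · subst h1; exact le_rfl
  · refine ⟨le_rfl, fun h => absurd h (lt_irrefl _), fun q hq hs hr => ?_⟩
    have h1 := hlt q hq hs hr
    have h2 := h.lt_end q hq
    rw [hs] at h2
    omega

theorem nextPos_le {S : List α} {m : ℕ} {st sq : ℕ → ℕ} (h : Layout S m st sq) {p : ℕ}
    (hp : p < S.length) : nextPos S st sq p ≤ S.length := by
  have := h.end_le _ (h.lt p hp)
  unfold nextPos
  split_ifs <;> omega

/-- The numbers that govern a phase of the algorithm. -/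
structure Sizes (W n m lg K G : ℕ) : Prop where
  hn : 2 ≤ n
  hm : 1 ≤ m
  hlg : 1 ≤ lg
  hK : 1 ≤ K
  hKm : K ≤ m + 7
  hmlg : m * lg ≤ n
  hlgn : lg ≤ n
  hG : G = (m + K - 1) / K
  hW : 40 * n ≤ W

section

variable {W n m lg K G : ℕ}

theorem Sizes.m_le (h : Sizes W n m lg K G) : m ≤ n := (Nat.le_mul_of_pos_right m h.hlg).trans h.hmlg

theorem Sizes.mul_le (h : Sizes W n m lg K G) : K * G + 1 ≤ m + K := by
  have h1 := Nat.mul_div_le (m + K - 1) K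
  rw [← h.hG] at h1
  have := h.hm
  omega

theorem Sizes.div_lt (h : Sizes W n m lg K G) {i : ℕ} (hi : i < m) : i / K < G := by
  rw [h.hG, Nat.lt_iff_add_one_le, Nat.le_div_iff_mul_le h.hK, Nat.add_mul, Nat.one_mul]
  have := Nat.div_mul_le_self i K
  omega

theorem Sizes.one_le (h : Sizes W n m lg K G) : 1 ≤ G := (Nat.zero_le _).trans_lt (h.div_lt (i := 0) h.hm)

theorem Sizes.G_le (h : Sizes W n m lg K G) : G ≤ m := by
  have h1 := h.mul_le
  have h2 := h.one_le
  have h3 := h.hK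
  obtain ⟨G, rfl⟩ : ∃ G', G = G' + 1 := ⟨G - 1, by omega⟩
  rw [Nat.mul_add] at h1
  have := Nat.le_mul_of_pos_left G h3
  omega

/-- The forest occupies 2KG ≤ 2(m + K) addresses, which is linear in n because K ≤ m + 7. -/
theorem Sizes.addr_le (h : Sizes W n m lg K G) {g : ℕ} (hg : g < G) : 2 * K * g + 2 * K + 2 ≤ W := by
  have h1 := h.mul_le
  have h2 : 2 * K * (g + 1) ≤ 2 * K * G := Nat.mul_le_mul_left _ hg
  rw [Nat.mul_add, Nat.mul_assoc 2 K G] at h2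
  have := h.m_le; have := h.hKm; have := h.hW; have := h.hn
  omega

theorem Sizes.w_le (h : Sizes W n m lg K G) : K * lg ≤ 8 * n := by
  have h1 : K * lg ≤ (m + 7) * lg := Nat.mul_le_mul_right _ h.hKm
  rw [Nat.add_mul] at h1
  have := h.hmlg; have := h.hlgn
  omega

end

/-- The state of the memory in a phase, after the output of `t` elements. -/
structure PhaseInv (S : List α) (m lg K G Tmax : ℕ) (st sq : ℕ → ℕ) (σ : Store α) (t cnt : ℕ) :
    Prop where
  v0 : σ.var 0 = S.length
  v1 : σ.var 1 = m
  v2 : σ.var 2 = lg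
  v3 : σ.var 3 = K
  v4 : σ.var 4 = G
  v5 : σ.var 5 = K * lg
  v6 : σ.var 6 = Tmax
  v7 : σ.var 7 = t
  v8 : σ.var 8 = cnt
  a1 : ∀ p < S.length, σ.arr 1 p = sq p
  a3 : ∀ i < m, σ.arr 3 i = st (i + 1)
  out : σ.out = sortedPrefix S t
  conf : Conf S sq m K G t cnt (σ.arr 2) (σ.arr 4) (σ.arr 5) (σ.arr 6) (σ.arr 7) (σ.arr 8)

variable {W m lg K G Tmax t cnt : ℕ} {S : List α} {st sq : ℕ → ℕ} {σ : Store α}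

theorem runs_putHead {i x j T : ℕ} {Q : Store α → Prop} (hz : Sizes W S.length m lg K G)
    (v0 : σ.var 0 = S.length) (v3 : σ.var 3 = K) (hi : i < m) (v13 : σ.var 13 = i)
    (v16 : σ.var 16 = x) (hx : x ≤ S.length) (hj : K ≤ 2 ^ j) (hT : 100 * j + 50 ≤ T)
    (hF : IsTree S (σ.arr 4) (2 * K * (i / K)) K)
    (hQ : ∀ A, IsTree S A (2 * K * (i / K)) K →
      A (2 * K * (i / K) + (K + i % K)) = x →
      (∀ d < K, d ≠ i % K →
        A (2 * K * (i / K) + (K + d)) = σ.arr 4 (2 * K * (i / K) + (K + d))) →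
      (∀ y, (∀ v, 1 ≤ v → v < 2 * K → y ≠ 2 * K * (i / K) + v) → A y = σ.arr 4 y) →
      Q ((((σ.setVar 14 (i / K)).setVar 15 (2 * K * (i / K))).setVar 11 0).setArr 4 A)) :
    Runs W S putHead σ T Q := by
  have hW := hz.hW
  have hn := hz.hn
  have hK := hz.hK
  have hg := hz.div_lt hi
  have hGm := hz.G_le
  have haddr := hz.addr_le hg
  have hKm := hz.hKm
  have hmn := hz.m_le
  have hdm := Nat.div_add_mod i K
  have hmod := Nat.mod_lt i hK
  refine runs_assign_seq ?_ (by simp only [Expr.cost]; omega) ?_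
  · simp only [Expr.Fits, v13, v3]; omega
  simp only [Expr.eval, v13, v3]
  refine runs_assign_seq ?_ (by simp only [Expr.cost]; omega) ?_
  · simp [Expr.Fits, Expr.eval, v3]; omega
  refine runs_assign_seq ?_ (by simp only [Expr.cost]; omega) ?_
  · simp [Expr.Fits, Expr.eval, v3, v13]; omega
  simp only [Expr.eval, Expr.cost, Store.setVar_var, v13, v3, 
    Nat.reduceEqDiff, if_false, if_true]
  -- The machine has no remainder operation; the index within the group is obtained from the
  -- quotient.
  have hsub : i - K * (i / K) = i % K := by omega
  refine runs_setLeaf (c := i % K) (x := x) (N := K) (b := 2 * K * (i / K)) (j := j)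
    (by omega) haddr ?_ ?_ ?_ hmod ?_ hx hj (by omega) ?_ ?_
  · simpa using v0
  · simp
  · simp [hsub]
  · simpa using v16
  · simpa using hF
  · intro A h1 h2 h3 h4
    have := hQ A h1 h2 h3 h4
    convert this using 2
    simp [Store.setVar]

end Steps

/-! ### Correctness and cost of one output, one load and one unload -/

section Steps

variable {α : Type*} [LinearOrder α]
variable {W m lg K G Tmax t cnt : ℕ} {S : List α} {st sq : ℕ → ℕ} {σ : Store α}

theorem runs_replaceHead {i x j T : ℕ} (hz : Sizes W S.length m lg K G)
    (v0 : σ.var 0 = S.length) (v3 : σ.var 3 = K) (hi : i < m) (v13 : σ.var 13 = i)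
    (v16 : σ.var 16 = x) (hx : x ≤ S.length) (hj : K ≤ 2 ^ j) (hT : 200 * j + 100 ≤ T)
    (hF : IsTree S (σ.arr 4) (2 * K * (i / K)) K) (hV : IsTree S (σ.arr 6) 0 K)
    (h7 : σ.arr 7 (i / K) < K) :
    Runs W S replaceHead σ T fun τ => ∃ F' V', IsTree S F' (2 * K * (i / K)) K ∧
      F' (2 * K * (i / K) + (K + i % K)) = x ∧
      (∀ d < K, d ≠ i % K →
        F' (2 * K * (i / K) + (K + d)) = σ.arr 4 (2 * K * (i / K) + (K + d))) ∧
      (∀ y, (∀ v, 1 ≤ v → v < 2 * K → y ≠ 2 * K * (i / K) + v) → F' y = σ.arr 4 y) ∧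
      IsTree S V' 0 K ∧ V' (0 + (K + σ.arr 7 (i / K))) = F' (2 * K * (i / K) + 1) ∧
      (∀ d < K, d ≠ σ.arr 7 (i / K) → V' (0 + (K + d)) = σ.arr 6 (0 + (K + d))) ∧
      (∀ y < 11, τ.var y = σ.var y) ∧ τ.out = σ.out ∧ τ.arr 1 = σ.arr 1 ∧
      τ.arr 2 = Function.update (σ.arr 2) i x ∧ τ.arr 3 = σ.arr 3 ∧ τ.arr 4 = F' ∧
      τ.arr 5 = σ.arr 5 ∧ τ.arr 6 = V' ∧ τ.arr 7 = σ.arr 7 ∧ τ.arr 8 = σ.arr 8 := by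
  have hW := hz.hW
  have hn := hz.hn
  have hK := hz.hK
  have hg := hz.div_lt hi
  have hGm := hz.G_le
  have haddr := hz.addr_le hg
  have hKm := hz.hKm
  have hmn := hz.m_le
  refine runs_put_seq ?_ ?_ (by simp only [Expr.cost]; omega) ?_
  · simp only [Expr.Fits, v13]; omega
  · simp only [Expr.Fits, v16]; omega
  simp only [Expr.eval, Expr.cost, v13, v16]
  refine Runs.seq (T₁ := 100 * j + 50) (T₂ := 100 * j + 40) ?_ (by omega)
  refine runs_putHead (i := i) (x := x) (j := j) hz (by simpa using v0) (by simpa using v3) hi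
    (by simpa using v13) (by simpa using v16) hx hj le_rfl (by simpa using hF) ?_
  intro F' f1 f2 f3 f4
  have hroot := f1.le 1 le_rfl (by omega)
  simp only [Store.setArr_arr, Nat.reduceEqDiff, if_false] at f3 f4
  refine runs_assign_seq ?_ (by simp only [Expr.cost]; omega) ?_
  · simp [Expr.Fits, Expr.eval]; omega
  refine runs_assign_seq ?_ (by simp only [Expr.cost]; omega) ?_
  · simp [Expr.Fits]
  refine runs_assign_seq ?_ (by simp only [Expr.cost]; omega) ?_
  · simp [Expr.Fits, Expr.eval, v3]; omega
  simp only [Expr.cost]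
  refine runs_setLeaf (b := 0) (N := K) (c := σ.arr 7 (i / K)) (x := F' (2 * K * (i / K) + 1))
    (j := j) (by omega) (by omega) ?_ ?_ ?_ h7 ?_ hroot hj (by omega) ?_ ?_
  · simpa using v0
  · simp [Expr.eval]
  · simp [Expr.eval, v3]
  · simp [Expr.eval]
  · simpa using hV
  · intro V' w1 w2 w3 _
    refine ⟨F', V', f1, f2, f3, f4, w1, w2, ?_, ?_, ?_⟩
    · simpa using w3
    · intro y hy
      have h1 : y ≠ 11 := by omega
      have h2 : y ≠ 14 := by omega
      have h3 : y ≠ 15 := by omega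
      have h4 : y ≠ 16 := by omega
      simp [h1, h2, h3, h4]
    · simp

/-- Two leaf updates, one in the tree of the group and one in the tree of the slots, both with K
leaves; hence the cost involves only `K ≤ 2 ^ j`. -/
theorem runs_popStep {j T : ℕ} (hz : Sizes W S.length m lg K G) (hL : Layout S m st sq)
    (h : PhaseInv S m lg K G Tmax st sq σ t cnt) (ht : t < S.length)
    (hb : rk S (σ.arr 6 1) ≤ rk S (σ.arr 5 1)) (h9 : σ.var 9 ≤ 8 * S.length) (hj : K ≤ 2 ^ j)
    (hT : 200 * j + 150 ≤ T) :
    Runs W S popStep σ T fun τ => PhaseInv S m lg K G Tmax st sq τ (t + 1) cnt ∧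
      τ.var 9 = σ.var 9 + 1 ∧ τ.var 10 = σ.var 10 ∧ τ.arr 7 = σ.arr 7 ∧ τ.arr 8 = σ.arr 8 := by
  have hW := hz.hW
  have hn := hz.hn
  have hK := hz.hK
  have hmn := hz.m_le
  have hsG : ∀ p < S.length, sq p / K < G := fun p hp => hz.div_lt (hL.lt p hp)
  obtain ⟨hp, hrk, hl⟩ := (h.conf.rk_root hK hz.one_le hL.lt hsG ht).1 hb
  set p := σ.arr 6 1 with hpd
  set i := sq p with hid
  have hi : i < m := hL.lt p hp
  have hend := hL.end_le i hi
  have a1 := h.a1 p hp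
  have a3 := h.a3 i hi
  have v7 := h.v7
  have v0 := h.v0
  refine runs_assign_seq ?_ (by simp only [Expr.cost]; omega) ?_
  · simp only [Expr.Fits, Expr.eval]; omega
  simp only [Expr.eval, ← hpd]
  refine runs_emit_seq ?_ ?_ (by simp only [Expr.cost]; omega) ?_
  · simp [Expr.Fits]; omega
  · simpa [Expr.eval] using hp
  refine runs_assign_seq ?_ (by simp only [Expr.cost]; omega) ?_
  · simp [Expr.Fits, Expr.eval]; omega
  refine runs_assign_seq ?_ (by simp only [Expr.cost]; omega) ?_
  · simp [Expr.Fits, Expr.eval]; omega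
  refine runs_assign_seq ?_ (by simp only [Expr.cost]; omega) ?_
  · simp [Expr.Fits, Expr.eval]; omega
  simp only [Expr.eval, Expr.cost, Store.setVar_var, Store.push_var, Store.setVar_arr,
    Store.push_arr, Nat.reduceEqDiff, if_false, if_true, a1, v7, ← hid]
  set τ₀ : Store α := ((((σ.setVar 12 p).push S[p]).setVar 7 (t + 1)).setVar 9
    (σ.var 9 + 1)).setVar 13 i with hτ₀
  have hcont : ∀ τ, τ = τ₀.setVar 16 (nextPos S st sq p) →
      Runs W S replaceHead τ (200 * j + 100) fun τ =>
        PhaseInv S m lg K G Tmax st sq τ (t + 1) cnt ∧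
        τ.var 9 = σ.var 9 + 1 ∧ τ.var 10 = σ.var 10 ∧ τ.arr 7 = σ.arr 7 ∧ τ.arr 8 = σ.arr 8 := by
    rintro _ rfl
    refine (runs_replaceHead (i := i) (x := nextPos S st sq p) (j := j) hz ?_ ?_ hi ?_ ?_
      (nextPos_le hL hp) hj le_rfl ?_ ?_ ?_).mono le_rfl ?_
    · simpa [τ₀] using v0
    · simpa [τ₀] using h.v3
    · simp [τ₀]
    · simp
    · simpa [τ₀] using h.conf.tree _ (hz.div_lt hi)
    · simpa [τ₀] using h.conf.small
    · simpa [τ₀] using hl.1.trans_le h.conf.cnt_le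
    · rintro τ ⟨F', V', f1, f2, f3, f4, w1, w2, w3, hv, ho, b1, b2, b3, b4, b5, b6, b7, b8⟩
      have e : ∀ b, (τ₀.setVar 16 (nextPos S st sq p)).arr b = σ.arr b := fun b => by simp [τ₀]
      rw [e] at b1 b2 b3 b5 b7 b8 w2
      simp only [e] at w3 f3 f4
      refine ⟨⟨?_, ?_, ?_, ?_, ?_, ?_, ?_, ?_, ?_, ?_, ?_, ?_, ?_⟩, ?_, ?_, b7, b8⟩
      · rw [hv 0 (by omega)]; simpa [τ₀] using h.v0
      · rw [hv 1 (by omega)]; simpa [τ₀] using h.v1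
      · rw [hv 2 (by omega)]; simpa [τ₀] using h.v2
      · rw [hv 3 (by omega)]; simpa [τ₀] using h.v3
      · rw [hv 4 (by omega)]; simpa [τ₀] using h.v4
      · rw [hv 5 (by omega)]; simpa [τ₀] using h.v5
      · rw [hv 6 (by omega)]; simpa [τ₀] using h.v6
      · rw [hv 7 (by omega)]; simp [τ₀]
      · rw [hv 8 (by omega)]; simpa [τ₀] using h.v8
      · rw [b1]; exact h.a1
      · rw [b3]; exact h.a3
      · rw [ho, sortedPrefix_succ hp hrk, ← h.out]; simp [τ₀]
      · rw [b2, b4, b5, b6, b7, b8]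
        exact h.conf.pop hK hL.lt hp hrk hl (hL.isHead_nextPos hp hrk) f1 f2 f3 f4 w1 w2 w3
      · rw [hv 9 (by omega)]; simp [τ₀]
      · rw [hv 10 (by omega)]; simp [τ₀]
  refine Runs.seq (T₁ := 14) (T₂ := 200 * j + 100) ?_ (by omega)
  have h12 : τ₀.var 12 = p := by simp [τ₀]
  have h13 : τ₀.var 13 = i := by simp [τ₀]
  have h00 : τ₀.var 0 = S.length := by simpa [τ₀] using v0
  have h3 : τ₀.arr 3 i = st (i + 1) := by simpa [τ₀] using a3
  refine runs_branch ?_ (by simp [Test.cost, Expr.cost]) ?_ ?_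
  · simp only [Test.Fits, Expr.Fits, Expr.eval, h12, h13, h3]; omega
  · intro hh
    simp only [Test.Holds, Expr.eval, h12, h13, h3] at hh
    refine runs_assign ?_ (by simp [Test.cost, Expr.cost]) (hcont _ ?_)
    · simp only [Expr.Fits, Expr.eval, h12]; omega
    · simp only [Expr.eval, h12]; rw [nextPos, if_pos hh]
  · intro hh
    simp only [Test.Holds, Expr.eval, h12, h13, h3] at hh
    refine runs_assign ?_ (by simp [Test.cost, Expr.cost]) (hcont _ ?_)
    · simp only [Expr.Fits, h00]; omega
    · simp only [Expr.eval, h00]; rw [nextPos, if_neg hh]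

/-- Nothing is output, so `t` stays. The rank `t` becomes the load event, because the root of the
tree of the other groups is the position of rank `t`. -/
theorem runs_loadStep {j T : ℕ} (hz : Sizes W S.length m lg K G) (hL : Layout S m st sq)
    (h : PhaseInv S m lg K G Tmax st sq σ t cnt) (ht : t < S.length)
    (hb : ¬ rk S (σ.arr 6 1) ≤ rk S (σ.arr 5 1)) (hcnt : cnt < K)
    (h10 : σ.var 10 < 40 * S.length)
    (hj : K ≤ 2 ^ j) (hjG : G ≤ 2 ^ j) (hT : 200 * j + 150 ≤ T) :
    Runs W S loadStep σ T fun τ => PhaseInv S m lg K G Tmax st sq τ t (cnt + 1) ∧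
      τ.var 9 = σ.var 9 ∧ τ.var 10 = σ.var 10 + 1 ∧
      τ.arr 7 = Function.update (σ.arr 7) (sq (posOf S t) / K) cnt ∧
      τ.arr 8 = Function.update (σ.arr 8) cnt (sq (posOf S t) / K) := by
  have hW := hz.hW
  have hn := hz.hn
  have hK := hz.hK
  have hmn := hz.m_le
  have hGm := hz.G_le
  have hKm := hz.hKm
  have hsG : ∀ p < S.length, sq p / K < G := fun p hp => hz.div_lt (hL.lt p hp)
  obtain ⟨hp, hrk, hl⟩ := (h.conf.rk_root hK hz.one_le hL.lt hsG ht).2 hb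
  have hpos : posOf S t = σ.arr 5 1 := by rw [← hrk, posOf_rk hp]
  rw [hpos]
  set p := σ.arr 5 1 with hpd
  have hg := hsG p hp
  have hi := hL.lt p hp
  set g := sq p / K with hgd
  have haddr := hz.addr_le hg
  have a1 := h.a1 p hp
  have v0 := h.v0
  have v3 := h.v3
  have v4 := h.v4
  have v8 := h.v8
  have hroot := (h.conf.tree g hg).le 1 le_rfl (by omega)
  refine runs_assign_seq ?_ (by simp only [Expr.cost]; omega) ?_
  · simp only [Expr.Fits, Expr.eval]; omega
  refine runs_assign_seq ?_ (by simp only [Expr.cost]; omega) ?_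
  · simp [Expr.Fits, Expr.eval, ← hpd, a1, v3]; omega
  refine runs_assign_seq ?_ (by simp only [Expr.cost]; omega) ?_
  · simp [Expr.Fits, v0]; omega
  refine runs_assign_seq ?_ (by simp only [Expr.cost]; omega) ?_
  · simp [Expr.Fits]
  simp only [Expr.eval, Expr.cost, Store.setVar_var, Store.setVar_arr,
    Nat.reduceEqDiff, if_false, if_true, ← hpd, a1, v0, v3, ← hgd]
  refine runs_assign_seq ?_ (by simp only [Expr.cost]; omega) ?_
  · simp [Expr.Fits, Expr.eval, v4]; omega
  refine Runs.seq (T₁ := 100 * j + 20) (T₂ := 100 * j + 80) ?_ (by simp only [Expr.cost]; omega)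
  refine runs_setLeaf (b := 0) (N := G) (c := g) (x := S.length) (j := j)
    (by omega) (by omega) ?_ ?_ ?_ hg ?_ le_rfl hjG le_rfl ?_ ?_
  · simpa using v0
  · simp
  · simp [Expr.eval, v4]
  · simp
  · simpa using h.conf.top
  intro U' u1 u2 u3 _
  refine runs_assign_seq ?_ (by simp only [Expr.cost]; omega) ?_
  · simp [Expr.Fits, Expr.eval, v3]; omega
  refine runs_assign_seq ?_ (by simp only [Expr.cost]; omega) ?_
  · simp [Expr.Fits, Expr.eval, v3, v8]; omega
  refine Runs.seq (T₁ := 100 * j + 20) (T₂ := 30) ?_ (by simp only [Expr.cost]; omega)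
  refine runs_setLeaf (b := 0) (N := K) (c := cnt) (x := σ.arr 4 (2 * K * g + 1)) (j := j)
    (by omega) (by omega) ?_ ?_ ?_ hcnt ?_ hroot hj le_rfl ?_ ?_
  · simpa using v0
  · simp
  · simp [Expr.eval, v3, v8]
  · simp [Expr.eval, v3]
  · simpa using h.conf.small
  intro V' w1 w2 w3 _
  refine runs_put_seq ?_ ?_ (by simp [Expr.cost]) ?_
  · simp [Expr.Fits]; omega
  · simp [Expr.Fits, v8]; omega
  refine runs_put_seq ?_ ?_ (by simp [Expr.cost]) ?_
  · simp [Expr.Fits, v8]; omega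
  · simp [Expr.Fits]; omega
  refine runs_assign_seq ?_ (by simp [Expr.cost]) ?_
  · simp [Expr.Fits, Expr.eval, v8]; omega
  refine runs_assign ?_ (by simp [Expr.cost]) ?_
  · simp [Expr.Fits, Expr.eval]; omega
  refine ⟨⟨?_, ?_, ?_, ?_, ?_, ?_, ?_, ?_, ?_, ?_, ?_, ?_, ?_⟩, ?_, ?_, ?_, ?_⟩
  · simpa using h.v0
  · simpa using h.v1
  · simpa using h.v2
  · simpa using h.v3
  · simpa using h.v4
  · simpa using h.v5
  · simpa using h.v6
  · simpa using h.v7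
  · simp [Expr.eval, v8]
  · simpa using h.a1
  · simpa using h.a3
  · simpa using h.out
  · have := h.conf.load hg hl hcnt u1 u2 (by simpa using u3) w1 w2 (by simpa using w3)
    simpa [Expr.eval, v8] using this
  · simp
  · simp [Expr.eval]
  · simp [Expr.eval, v8]
  · simp [Expr.eval, v8]

theorem runs_unloadStep {j T : ℕ} (hz : Sizes W S.length m lg K G)
    (h : PhaseInv S m lg K G Tmax st sq σ t (cnt + 1))
    (hj : K ≤ 2 ^ j) (hjG : G ≤ 2 ^ j) (hT : 200 * j + 150 ≤ T) :
    Runs W S unloadStep σ T fun τ => PhaseInv S m lg K G Tmax st sq τ t cnt ∧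
      τ.var 9 = σ.var 9 ∧ τ.var 10 = σ.var 10 := by
  have hW := hz.hW
  have hn := hz.hn
  have hK := hz.hK
  have hmn := hz.m_le
  have hGm := hz.G_le
  have hKm := hz.hKm
  have hcnt := h.conf.cnt_le
  have hg := h.conf.grp_lt cnt (by omega)
  set g := σ.arr 8 cnt with hgd
  have haddr := hz.addr_le hg
  have v0 := h.v0
  have v3 := h.v3
  have v4 := h.v4
  have v8 := h.v8
  have hroot := (h.conf.tree g hg).le 1 le_rfl (by omega)
  refine runs_assign_seq ?_ (by simp only [Expr.cost]; omega) ?_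
  · simp only [Expr.Fits, v8]; omega
  simp only [Expr.eval, v8, Nat.add_sub_cancel]
  refine runs_assign_seq ?_ (by simp only [Expr.cost]; omega) ?_
  · simp [Expr.Fits, Expr.eval, ← hgd]; omega
  simp only [Expr.eval, Store.setVar_var, Store.setVar_arr, if_true, ← hgd]
  refine runs_assign_seq ?_ (by simp only [Expr.cost]; omega) ?_
  · simp [Expr.Fits, Expr.eval, v3]; omega
  refine runs_assign_seq ?_ (by simp only [Expr.cost]; omega) ?_
  · simp [Expr.Fits]
  refine runs_assign_seq ?_ (by simp only [Expr.cost]; omega) ?_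
  · simp [Expr.Fits, Expr.eval, v4]; omega
  refine Runs.seq (T₁ := 100 * j + 20) (T₂ := 100 * j + 80) ?_ (by simp only [Expr.cost]; omega)
  refine runs_setLeaf (b := 0) (N := G) (c := g) (x := σ.arr 4 (2 * K * g + 1)) (j := j)
    (by omega) (by omega) ?_ ?_ ?_ hg ?_ hroot hjG le_rfl ?_ ?_
  · simpa using v0
  · simp [Expr.eval]
  · simp [Expr.eval, v4]
  · simp [Expr.eval, v3]
  · simpa using h.conf.top
  intro U' u1 u2 u3 _
  refine runs_assign_seq ?_ (by simp only [Expr.cost]; omega) ?_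
  · simp [Expr.Fits, v0]; omega
  refine runs_assign_seq ?_ (by simp only [Expr.cost]; omega) ?_
  · simp [Expr.Fits, Expr.eval, v3]; omega
  refine runs_setLeaf (b := 0) (N := K) (c := cnt) (x := S.length) (j := j)
    (by omega) (by omega) ?_ ?_ ?_ (by omega) ?_ le_rfl hj (by simp only [Expr.cost]; omega) ?_ ?_
  · simpa using v0
  · simp [Expr.eval]
  · simp [Expr.eval, v3]
  · simp [Expr.eval, v0]
  · simpa using h.conf.small
  intro V' w1 w2 w3 _
  refine ⟨⟨?_, ?_, ?_, ?_, ?_, ?_, ?_, ?_, ?_, ?_, ?_, ?_, ?_⟩, ?_, ?_⟩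
  · simpa using h.v0
  · simpa using h.v1
  · simpa using h.v2
  · simpa using h.v3
  · simpa using h.v4
  · simpa using h.v5
  · simpa using h.v6
  · simpa using h.v7
  · simp
  · simpa using h.a1
  · simpa using h.a3
  · simpa using h.out
  · have := h.conf.unload u1 u2 (by simpa using u3) w1 w2 (by simpa using w3)
    simpa using this
  · simp
  · simp

end Steps

/-! ### One phase of the merging algorithm -/

section Ghost

variable {α : Type*} [LinearOrder α]

/-- The bookkeeping of the loads of a phase: `Ev` is the set of the ranks of the loads, `X` the set
of the ranks at which a window begins, `cnt` the number of used slots, `wc` the counter of the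
current window, `L` the number of loads and `ld` the set of the groups in the slots. -/
structure Ghost (S : List α) (γ : ℕ → ℕ) (K w t cnt wc L : ℕ) (ld : ℕ → Prop)
    (Ev X : Finset ℕ) : Prop where
  sub : X ⊆ Ev
  lt_length : ∀ s ∈ Ev, s < S.length
  lt : ∀ s ∈ Ev, s < t ∨ (s = t ∧ wc < w ∧ ld (γ (posOf S t)))
  card : Ev.card = L
  sep : ∀ s ∈ Ev, ∀ u ∈ Ev, s < u → γ (posOf S s) = γ (posOf S u) → ∃ a ∈ X, s < a ∧ a ≤ u
  opened : wc < w → ∃ P₀ L₀, P₀ + wc = t ∧ L₀ + cnt = L ∧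
    K * w * X.card ≤ K * P₀ + w * L₀ + (if cnt = 0 then 0 else K * w)
  recent : wc < w → cnt ≠ 0 → ∀ s ∈ Ev, (∀ a ∈ X, a ≤ s) → ld (γ (posOf S s))
  closed : ¬ wc < w → K * w * X.card ≤ K * t + w * L
  wc_le : wc ≤ w

variable {S : List α} {γ : ℕ → ℕ} {K w t cnt wc L : ℕ} {ld ld' : ℕ → Prop} {Ev X : Finset ℕ}

theorem ghost_start : Ghost S γ K w t 0 0 0 ld ∅ ∅ where
  sub := Finset.Subset.refl _
  lt_length := by simp
  lt := by simp
  card := by simp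
  sep := by simp
  opened _ := ⟨t, 0, rfl, rfl, by simp⟩
  recent := by simp
  closed := by simp
  wc_le := Nat.zero_le _

/-- If this is the w-th output of the window, then its w outputs, at K each, pay the share K·w that
the window contributes to K·w·|X|. -/
theorem Ghost.pop (h : Ghost S γ K w t cnt wc L ld Ev X) (hw : wc < w) :
    Ghost S γ K w (t + 1) cnt (wc + 1) L ld Ev X where
  sub := h.sub
  lt_length := h.lt_length
  lt s hs := by rcases h.lt s hs with h | h <;> omega
  card := h.card
  sep := h.sep
  opened _ := by
    obtain ⟨P₀, L₀, h1, h2, h3⟩ := h.opened hw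
    exact ⟨P₀, L₀, by omega, h2, h3⟩
  recent _ := h.recent hw
  closed hc := by
    obtain ⟨P₀, L₀, h1, h2, h3⟩ := h.opened hw
    have h4 : (if cnt = 0 then 0 else K * w) ≤ K * w := by split_ifs <;> omega
    have h5 : t + 1 = P₀ + w := by omega
    have h6 : w * L₀ ≤ w * L := Nat.mul_le_mul_left _ (by omega)
    rw [h5, Nat.mul_add]
    omega
  wc_le := hw

/-- The first load of a window puts `t` into X and thereby separates all earlier events from `t`. A
later load leaves X alone: the groups of all events since the last window start are still loaded,
whereas the new one is not, so no earlier event of the same class is left unseparated. -/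
theorem Ghost.load (h : Ghost S γ K w t cnt wc L ld Ev X) (hw : wc < w) (ht : t < S.length)
    (hn : ¬ ld (γ (posOf S t))) (hld : ∀ g, ld' g ↔ ld g ∨ g = γ (posOf S t)) :
    ∃ Ev' X', Ghost S γ K w t (cnt + 1) wc (L + 1) ld' Ev' X' := by
  have hlt : ∀ s ∈ Ev, s < t := fun s hs => (h.lt s hs).resolve_right fun h => hn h.2.2
  have htE : t ∉ Ev := fun ht => lt_irrefl _ (hlt t ht)
  have hmem : ∀ a ∈ insert t Ev, a = t ∨ a ∈ Ev := fun a ha => Finset.mem_insert.1 ha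
  obtain ⟨P₀, L₀, h1, h2, h3⟩ := h.opened hw
  have hself : ld' (γ (posOf S t)) := (hld _).2 (Or.inr rfl)
  by_cases hc : cnt = 0
  · refine ⟨insert t Ev, insert t X, Finset.insert_subset_insert t h.sub, ?_, ?_, ?_, ?_, ?_, ?_,
      fun h => absurd hw h, h.wc_le⟩
    · intro s hs
      rcases hmem s hs with rfl | hs
      · exact ht
      · exact h.lt_length s hs
    · intro s hs
      rcases hmem s hs with rfl | hs
      · exact Or.inr ⟨rfl, hw, hself⟩
      · exact Or.inl (hlt s hs)
    · rw [Finset.card_insert_of_notMem htE, h.card]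
    · intro s hs u hu hsu hγ
      rcases hmem u hu with rfl | hu1
      · exact ⟨u, Finset.mem_insert_self _ _, hsu, le_rfl⟩
      · rcases hmem s hs with rfl | hs
        · exact absurd (hlt u hu1) (by omega)
        · obtain ⟨a, ha, h'⟩ := h.sep s hs u hu1 hsu hγ
          exact ⟨a, Finset.mem_insert_of_mem ha, h'⟩
    · intro _
      refine ⟨P₀, L₀, h1, by omega, ?_⟩
      rw [Finset.card_insert_of_notMem fun ht => htE (h.sub ht), Nat.mul_add, if_neg (by omega)]
      rw [if_pos hc] at h3
      omega
    · intro _ _ s hs hmax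
      rcases hmem s hs with rfl | hs
      · exact hself
      · exact absurd (hmax t (Finset.mem_insert_self _ _)) (not_le.2 (hlt s hs))
  · refine ⟨insert t Ev, X, h.sub.trans (Finset.subset_insert _ _), ?_, ?_, ?_, ?_, ?_, ?_,
      fun h => absurd hw h, h.wc_le⟩
    · intro s hs
      rcases hmem s hs with rfl | hs
      · exact ht
      · exact h.lt_length s hs
    · intro s hs
      rcases hmem s hs with rfl | hs
      · exact Or.inr ⟨rfl, hw, hself⟩
      · exact Or.inl (hlt s hs)
    · rw [Finset.card_insert_of_notMem htE, h.card]
    · intro s hs u hu hsu hγ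
      rcases hmem u hu with rfl | hu1
      · rcases hmem s hs with rfl | hs
        · exact absurd hsu (lt_irrefl _)
        · by_contra hno
          -- Without a window start after `s`, the event `s` belongs to the current window, so its
          -- group would still have a slot.
          refine hn (hγ ▸ h.recent hw hc s hs fun a ha => ?_)
          by_contra hlt'
          exact hno ⟨a, ha, not_le.1 hlt', (hlt a (h.sub ha)).le⟩
      · rcases hmem s hs with rfl | hs
        · exact absurd (hlt u hu1) (by omega)
        · exact h.sep s hs u hu1 hsu hγ
    · intro _
      refine ⟨P₀, L₀, h1, by omega, ?_⟩
      rw [if_neg (by omega)]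
      rwa [if_neg hc] at h3
    · intro _ _ s hs hmax
      rcases hmem s hs with rfl | hs
      · exact hself
      · exact (hld _).2 (Or.inl (h.recent hw hc s hs hmax))

/-- The window ends with full slots: its loads, at least K in number and at w each, pay the share
K·w. -/
theorem Ghost.close (h : Ghost S γ K w t cnt wc L ld Ev X) (hw : wc < w) (hc : K ≤ cnt)
    (hn : ¬ ld (γ (posOf S t))) : Ghost S γ K w t cnt w L ld Ev X where
  sub := h.sub
  lt_length := h.lt_length
  lt s hs := Or.inl ((h.lt s hs).resolve_right fun h => hn h.2.2)
  card := h.card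
  sep := h.sep
  opened h := absurd h (lt_irrefl _)
  recent h := absurd h (lt_irrefl _)
  closed _ := by
    obtain ⟨P₀, L₀, h1, h2, h3⟩ := h.opened hw
    have h4 : (if cnt = 0 then 0 else K * w) ≤ w * cnt := by
      split_ifs
      · exact Nat.zero_le _
      · rw [Nat.mul_comm]; exact Nat.mul_le_mul_left _ hc
    have h5 : K * P₀ ≤ K * t := Nat.mul_le_mul_left _ (by omega)
    rw [← h2, Nat.mul_add]
    omega
  wc_le := le_rfl

theorem Ghost.unload (h : Ghost S γ K w t cnt wc L ld Ev X) (hw : ¬ wc < w) (cnt' : ℕ) :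
    Ghost S γ K w t cnt' wc L ld' Ev X where
  sub := h.sub
  lt_length := h.lt_length
  lt s hs := Or.inl ((h.lt s hs).resolve_right fun h => hw h.2.1)
  card := h.card
  sep := h.sep
  opened h := absurd h hw
  recent h := absurd h hw
  closed := h.closed
  wc_le := h.wc_le

theorem Ghost.reopen (h : Ghost S γ K w t 0 wc L ld Ev X) (hw : ¬ wc < w) :
    Ghost S γ K w t 0 0 L ld Ev X where
  sub := h.sub
  lt_length := h.lt_length
  lt s hs := Or.inl ((h.lt s hs).resolve_right fun h => hw h.2.1)
  card := h.card
  sep := h.sep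
  opened _ := ⟨t, L, rfl, rfl, h.closed hw⟩
  recent _ h := absurd rfl h
  closed _ := h.closed hw
  wc_le := Nat.zero_le _

/-- If the group size is large enough, then the number of loads is small. -/
theorem Ghost.loads_lt {W m lg G D : ℕ} (h : Ghost S γ K (K * lg) t cnt wc L ld Ev X)
    (hz : Sizes W S.length m lg K G) (ht : t ≤ S.length) (hD : 1 ≤ D) (hDK : 6 * D ≤ K)
    (hB : LoadBound S γ G D) : L < 40 * (S.length / lg) := by
  have hb := hB Ev X h.lt_length h.sub h.sep
  rw [h.card] at hb
  -- The last summand covers a window that is still open and has not yet earned its share.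
  have hX : K * (K * lg) * X.card ≤ K * t + K * lg * L + K * (K * lg) := by
    by_cases hw : wc < K * lg
    · obtain ⟨P₀, L₀, h1, h2, h3⟩ := h.opened hw
      have h4 : (if cnt = 0 then 0 else K * (K * lg)) ≤ K * (K * lg) := by split_ifs <;> omega
      have h5 : K * P₀ ≤ K * t := Nat.mul_le_mul_left _ (by omega)
      have h6 : K * lg * L₀ ≤ K * lg * L := Nat.mul_le_mul_left _ (by omega)
      omega
    · have := h.closed hw
      omega
  have hX' : K * lg * X.card ≤ t + lg * L + K * lg := by
    refine Nat.le_of_mul_le_mul_left ?_ hz.hK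
    calc K * (K * lg * X.card) = K * (K * lg) * X.card := by ring
      _ ≤ _ := hX
      _ = K * (t + lg * L + K * lg) := by ring
  -- From L ≤ |X| + D(G + 2|X| + 1): since 6 ≤ 6D ≤ K, six times the right side is at most K|X| +
  -- K(G + 2|X| + 1), and KG < m + K.
  have h1 : 6 * L ≤ 3 * (K * X.card) + m + 2 * K := by
    have h2 : 6 * D * (G + (2 * X.card + 1)) ≤ K * (G + (2 * X.card + 1)) :=
      Nat.mul_le_mul_right _ hDK
    have h3 : 6 * X.card ≤ K * X.card := Nat.mul_le_mul_right _ (by omega)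
    have h4 := hz.mul_le
    have h5 : K * (G + (2 * X.card + 1)) = K * G + 2 * (K * X.card) + K := by ring
    have h6 : 6 * D * (G + (2 * X.card + 1)) = 6 * (D * (G + (2 * X.card + 1))) := by ring
    omega
  have h2 : 6 * (lg * L) ≤ 3 * (K * lg * X.card) + m * lg + 2 * (K * lg) := by
    calc 6 * (lg * L) = lg * (6 * L) := by ring
      _ ≤ lg * (3 * (K * X.card) + m + 2 * K) := Nat.mul_le_mul_left _ h1
      _ = _ := by ring
  have hw := hz.w_le
  have hmlg := hz.hmlg
  have hn := hz.hn
  -- Inserting the bound on K·lg·|X| leaves 3·lg·L ≤ 4n + 5K·lg ≤ 44n. As n is less than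
  -- 2·lg·⌊n/lg⌋, the constant 40 is ample.
  have hdiv : S.length < lg * (S.length / lg) + lg := by
    have := Nat.lt_div_mul_add hz.hlg (a := S.length)
    rw [Nat.mul_comm]
    omega
  have h1q : lg ≤ lg * (S.length / lg) :=
    Nat.le_mul_of_pos_right _ (Nat.div_pos hz.hlgn hz.hlg)
  refine Nat.lt_of_mul_lt_mul_left (a := lg) ?_
  have h3 : lg * (40 * (S.length / lg)) = 40 * (lg * (S.length / lg)) := by ring
  omega

end Ghost

/-- One step of a phase. -/
def mergeStep : Prog :=
  .branch (.lt (.var 9) (.var 5))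
    (.branch (leTest (.get 6 (.const 1)) (.get 5 (.const 1))) popStep
      (.branch (.lt (.var 8) (.var 3)) loadStep (.assign 9 (.var 5))))
    (.branch (.lt (.const 0) (.var 8)) unloadStep (.assign 9 (.const 0)))

/-- The steps of a phase. -/
def mergeLoop : Prog :=
  .loop (.and (.lt (.var 7) (.var 0)) (.lt (.var 10) (.var 6))) mergeStep

/-! ### Amortised analysis of the loop of a phase -/

section Loop

variable {α : Type*} [LinearOrder α]
variable {W m lg K G Tmax t cnt : ℕ} {S : List α} {st sq : ℕ → ℕ} {σ : Store α}

theorem runs_branch_true {b : Test} {P P' : Prog} {T : ℕ} {Q : Store α → Prop} (hf : b.Fits W S σ)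
    (hb : b.Holds S σ) (hT : b.cost ≤ T) (h : Runs W S P σ (T - b.cost) Q) :
    Runs W S (.branch b P P') σ T Q :=
  runs_branch hf hT (fun _ => h) fun hn => absurd hb hn

theorem runs_branch_false {b : Test} {P P' : Prog} {T : ℕ} {Q : Store α → Prop}
    (hf : b.Fits W S σ) (hb : ¬ b.Holds S σ) (hT : b.cost ≤ T)
    (h : Runs W S P' σ (T - b.cost) Q) : Runs W S (.branch b P P') σ T Q :=
  runs_branch hf hT (fun hn => absurd hn hb) fun _ => h

theorem PhaseInv.congr_var9 (h : PhaseInv S m lg K G Tmax st sq σ t cnt) (v : ℕ) :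
    PhaseInv S m lg K G Tmax st sq (σ.setVar 9 v) t cnt where
  v0 := by simpa using h.v0
  v1 := by simpa using h.v1
  v2 := by simpa using h.v2
  v3 := by simpa using h.v3
  v4 := by simpa using h.v4
  v5 := by simpa using h.v5
  v6 := by simpa using h.v6
  v7 := by simpa using h.v7
  v8 := by simpa using h.v8
  a1 := by simpa using h.a1
  a3 := by simpa using h.a3
  out := by simpa using h.out
  conf := by simpa using h.conf

/-- The steps that the state of a phase still has to pay for apart from outputs and loads. -/
def credit (B w cnt wc : ℕ) : ℕ :=
  B * cnt + if wc < w then (if cnt = 0 then 0 else 100) else 50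

/-- An output is charged A = O(log K). A load is charged 2B + 100: B for itself, B for its later
unload, and 100 towards closing its window and opening the next. The limit on the loads bounds the
time even when K is too small; the final clause says that for large K the limit is not what stops
the loop. -/
theorem runs_mergeLoop {j j' A B T t₀ : ℕ} (hz : Sizes W S.length m lg K G)
    (hL : Layout S m st sq) (h : PhaseInv S m lg K G Tmax st sq σ t₀ 0) (h9 : σ.var 9 = 0)
    (h10 : σ.var 10 = 0) (ht₀ : t₀ ≤ S.length) (hTmax : Tmax = 40 * (S.length / lg))
    (hj : K ≤ 2 ^ j) (hj' : K ≤ 2 ^ j') (hG' : G ≤ 2 ^ j') (hA : A = 200 * j + 200)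
    (hB : B = 200 * j' + 200)
    (hT : A * S.length + (2 * B + 100) * Tmax + 7 ≤ T) :
    Runs W S mergeLoop σ T fun τ => ∃ t cnt, PhaseInv S m lg K G Tmax st sq τ t cnt ∧
      t ≤ S.length ∧
      ∀ D, 1 ≤ D → 6 * D ≤ K → LoadBound S (fun p => sq p / K) G D → t = S.length := by
  have hW := hz.hW
  have hn := hz.hn
  have hK := hz.hK
  have hGone := hz.one_le
  have hwn := hz.w_le
  have hmn := hz.m_le
  have hKm := hz.hKm
  have hsG : ∀ p < S.length, sq p / K < G := fun p hp => hz.div_lt (hL.lt p hp)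
  have hTle : Tmax ≤ 40 * S.length := by
    rw [hTmax]; exact Nat.mul_le_mul_left _ (Nat.div_le_self _ _)
  have hwpos : 0 < K * lg := Nat.mul_pos hK hz.hlg
  -- The steps left pay for the outstanding outputs, the loads still allowed, the credit of the
  -- present state, and the final test of the guard, which costs 7.
  let I : ℕ → Store α → Prop := fun k σ => ∃ t cnt Ev X,
    PhaseInv S m lg K G Tmax st sq σ t cnt ∧
    Ghost S (fun p => sq p / K) K (K * lg) t cnt (σ.var 9) (σ.var 10)
      (Loaded (σ.arr 7) (σ.arr 8) cnt) Ev X ∧ t ≤ S.length ∧ σ.var 10 ≤ Tmax ∧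
    A * (S.length - t) + (2 * B + 100) * (Tmax - σ.var 10) +
      credit B (K * lg) cnt (σ.var 9) + 7 ≤ k
  have hI₀ : I T σ := by
    refine ⟨t₀, 0, ∅, ∅, h, ?_, ht₀, by omega, ?_⟩
    · rw [h9, h10]; exact ghost_start
    · have : A * (S.length - t₀) ≤ A * S.length := Nat.mul_le_mul_left _ (by omega)
      rw [h9, h10, credit, if_pos hwpos, if_pos rfl]
      simp only [Nat.sub_zero, Nat.mul_zero]
      omega
  refine runs_loop I ?_ hI₀
  rintro k σ ⟨t, cnt, Ev, X, h, hg, ht, hLT, hk⟩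
  have v0 := h.v0
  have v3 := h.v3
  have v5 := h.v5
  have v6 := h.v6
  have v7 := h.v7
  have v8 := h.v8
  have hcK := h.conf.cnt_le
  have hwc := hg.wc_le
  refine ⟨?_, ?_, ?_, ?_⟩
  · simp only [Test.Fits, Expr.Fits, v0, v6, v7]; omega
  · simp only [Test.cost, Expr.cost]; omega
  · intro hnot
    simp only [Test.Holds, Expr.eval, v0, v6, v7] at hnot
    refine ⟨t, cnt, h, ht, fun D hD hDK hLB => ?_⟩
    -- The load counter is below the limit, so the loop can only have stopped because everything has
    -- been output.
    have := hg.loads_lt hz ht hD hDK hLB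
    omega
  intro hh
  simp only [Test.Holds, Expr.eval, v0, v6, v7] at hh
  obtain ⟨htn, hLt⟩ := hh
  have hbc : (Test.and (.lt (.var 7) (.var 0)) (.lt (.var 10) (.var 6))).cost = 7 := rfl
  rw [hbc]
  obtain ⟨hrV, hrU⟩ := h.conf.rk_root hK hGone hL.lt hsG htn
  have lV := h.conf.small.le 1 le_rfl (by omega)
  have lU := h.conf.top.le 1 le_rfl (by omega)
  rw [Nat.zero_add] at lV lU
  have fitw : (Test.lt (.var 9) (.var 5)).Fits W S σ := by
    simp only [Test.Fits, Expr.Fits, v5]; omega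
  by_cases hw : σ.var 9 < K * lg
  · have fitl : (leTest (.get 6 (.const 1)) (.get 5 (.const 1))).Fits W S σ :=
      leTest_fits v0 (by omega) (by simp only [Expr.Fits, Expr.eval]; omega)
        (by simp only [Expr.Fits, Expr.eval]; omega)
    have hlc : (leTest (.get 6 (.const 1)) (.get 5 (.const 1))).cost = 30 := rfl
    by_cases hle : rk S (σ.arr 6 1) ≤ rk S (σ.arr 5 1)
    · -- output
      obtain ⟨-, -, hload⟩ := hrV hle
      -- An output comes from a slot, so the credit of 100 is present; if this output closes the
      -- window, 50 of it remains for the reopening.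
      have hcnt : cnt ≠ 0 := by have := hload.1; omega
      have hstep : A * (S.length - t) = A * (S.length - (t + 1)) + A := by
        rw [show S.length - t = (S.length - (t + 1)) + 1 by omega, Nat.mul_succ]
      rw [credit, if_pos hw, if_neg hcnt] at hk
      refine ⟨A - 7, by omega, ?_⟩
      refine runs_branch_true fitw (by simpa only [Test.Holds, Expr.eval, v5] using hw)
        (by simp only [Test.cost, Expr.cost]; omega) ?_
      refine runs_branch_true fitl ((leTest_holds v0).2 hle)
        (by rw [hlc]; simp only [Test.cost, Expr.cost]; omega) ?_
      rw [hlc]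
      refine (runs_popStep (j := j) hz hL h htn hle (by omega) hj
        (by simp only [Test.cost, Expr.cost]; omega)).mono le_rfl ?_
      rintro τ ⟨h', e9, e10, e7, e8⟩
      refine ⟨t + 1, cnt, Ev, X, h', ?_, htn, by omega, ?_⟩
      · rw [e9, e10, e7, e8]; exact hg.pop hw
      · have : credit B (K * lg) cnt (τ.var 9) ≤ B * cnt + 100 := by
          unfold credit; split_ifs <;> omega
        rw [e10]
        omega
    · obtain ⟨hp, hrk, hload⟩ := hrU hle
      have hpos : posOf S t = σ.arr 5 1 := by rw [← hrk, posOf_rk hp]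
      have fitc : (Test.lt (.var 8) (.var 3)).Fits W S σ := by
        simp only [Test.Fits, Expr.Fits, v8, v3]; omega
      by_cases hcnt : cnt < K
      · -- load
        have hstep : (2 * B + 100) * (Tmax - σ.var 10) =
            (2 * B + 100) * (Tmax - (σ.var 10 + 1)) + (2 * B + 100) := by
          rw [show Tmax - σ.var 10 = (Tmax - (σ.var 10 + 1)) + 1 by omega, Nat.mul_succ]
        refine ⟨B - 7, by omega, ?_⟩
        refine runs_branch_true fitw (by simpa only [Test.Holds, Expr.eval, v5] using hw)
          (by simp only [Test.cost, Expr.cost]; omega) ?_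
        refine runs_branch_false fitl (fun hh => hle ((leTest_holds v0).1 hh))
          (by rw [hlc]; simp only [Test.cost, Expr.cost]; omega) ?_
        rw [hlc]
        refine runs_branch_true fitc (by simpa only [Test.Holds, Expr.eval, v8, v3] using hcnt)
          (by simp only [Test.cost, Expr.cost]; omega) ?_
        refine (runs_loadStep (j := j') hz hL h htn hle hcnt (by omega) hj' hG'
          (by simp only [Test.cost, Expr.cost]; omega)).mono le_rfl ?_
        rintro τ ⟨h', e9, e10, e7, e8⟩
        obtain ⟨Ev', X', hg'⟩ := hg.load (ld' := Loaded (τ.arr 7) (τ.arr 8) (cnt + 1)) hw htn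
          (by rw [hpos]; exact hload) (fun g => by rw [e7, e8]; exact loaded_update g)
        refine ⟨t, cnt + 1, Ev', X', h', ?_, ht, by omega, ?_⟩
        · rw [e9, e10]; exact hg'
        · have h1 : credit B (K * lg) (cnt + 1) (τ.var 9) = B * cnt + B + 100 := by
            rw [credit, e9, if_pos hw, if_neg (by omega), Nat.mul_succ]
          have h2 : B * cnt ≤ credit B (K * lg) cnt (σ.var 9) := Nat.le_add_right _ _
          rw [h1, e10]
          omega
      · -- the slots are full
        have hc0 : cnt ≠ 0 := by omega
        rw [credit, if_pos hw, if_neg hc0] at hk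
        -- Together with the guard this costs 50, the amount by which the credit drops when the
        -- window closes.
        refine ⟨43, by omega, ?_⟩
        refine runs_branch_true fitw (by simpa only [Test.Holds, Expr.eval, v5] using hw)
          (by simp only [Test.cost, Expr.cost]; omega) ?_
        refine runs_branch_false fitl (fun hh => hle ((leTest_holds v0).1 hh))
          (by rw [hlc]; simp only [Test.cost, Expr.cost]; omega) ?_
        rw [hlc]
        refine runs_branch_false fitc (by simpa only [Test.Holds, Expr.eval, v8, v3] using hcnt)
          (by simp only [Test.cost, Expr.cost]; omega) ?_
        refine runs_assign (by simp only [Expr.Fits, v5]; omega)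
          (by simp only [Test.cost, Expr.cost]; omega) ?_
        simp only [Expr.eval, v5]
        refine ⟨t, cnt, Ev, X, h.congr_var9 _, ?_, ht, by simpa using hLT, ?_⟩
        · have := hg.close hw (by omega) (by rw [hpos]; exact hload)
          simpa using this
        · simp only [Store.setVar_var, Nat.reduceEqDiff, if_true, if_false]
          rw [credit, if_neg (lt_irrefl _)]
          omega
  · have fitc : (Test.lt (.const 0) (.var 8)).Fits W S σ := by
      simp only [Test.Fits, Expr.Fits, v8]; omega
    by_cases hcnt : 0 < cnt
    · -- give up a slot
      obtain ⟨c, rfl⟩ : ∃ c, cnt = c + 1 := ⟨cnt - 1, by omega⟩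
      rw [credit, if_neg hw, Nat.mul_succ] at hk
      refine ⟨B - 7, by omega, ?_⟩
      refine runs_branch_false fitw (by simpa only [Test.Holds, Expr.eval, v5] using hw)
        (by simp only [Test.cost, Expr.cost]; omega) ?_
      refine runs_branch_true fitc (by simpa only [Test.Holds, Expr.eval, v8] using hcnt)
        (by simp only [Test.cost, Expr.cost]; omega) ?_
      refine (runs_unloadStep (j := j') hz h hj' hG'
        (by simp only [Test.cost, Expr.cost]; omega)).mono le_rfl ?_
      rintro τ ⟨h', e9, e10⟩
      refine ⟨t, c, Ev, X, h', ?_, ht, by omega, ?_⟩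
      · rw [e9, e10]; exact hg.unload hw c
      · rw [e9, e10, credit, if_neg hw]; omega
    · -- begin a new window
      obtain rfl : cnt = 0 := by omega
      rw [credit, if_neg hw] at hk
      refine ⟨10, by omega, ?_⟩
      refine runs_branch_false fitw (by simpa only [Test.Holds, Expr.eval, v5] using hw)
        (by simp only [Test.cost, Expr.cost]; omega) ?_
      refine runs_branch_false fitc (by simpa only [Test.Holds, Expr.eval, v8] using hcnt)
        (by simp only [Test.cost, Expr.cost]; omega) ?_
      refine runs_assign (by simp [Expr.Fits]) (by simp only [Test.cost, Expr.cost]; omega) ?_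
      simp only [Expr.eval]
      refine ⟨t, 0, Ev, X, h.congr_var9 _, ?_, ht, by simpa using hLT, ?_⟩
      · have := hg.reopen hw
        simpa using this
      · simp only [Store.setVar_var, Nat.reduceEqDiff, if_true, if_false]
        rw [credit, if_pos hwpos, if_pos rfl]
        omega

end Loop

/-! ### The beginning of a phase -/

/-- Fill the trees with the position after all others. -/
def clearTrees : Prog :=
  .loop (.lt (.var 13) (.mul (.mul (.const 2) (.var 3)) (.var 4)))
    (.seq (.put 4 (.var 13) (.var 0)) <|
     .seq (.put 5 (.var 13) (.var 0)) <|
     .seq (.put 6 (.var 13) (.var 0)) <|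
     .assign 13 (.add (.var 13) (.const 1)))

/-- Enter all heads into the forest. -/
def enterHeads : Prog :=
  .loop (.lt (.var 13) (.var 1))
    (.seq (.assign 16 (.get 2 (.var 13))) <|
     .seq putHead <|
     .assign 13 (.add (.var 13) (.const 1)))

/-- Enter the heads of all groups into the tree of the groups. -/
def enterGroups : Prog :=
  .loop (.lt (.var 14) (.var 4))
    (.seq (.assign 16 (.get 4 (.add (.mul (.mul (.const 2) (.var 3)) (.var 14)) (.const 1)))) <|
     .seq (.assign 15 (.const 0)) <|
     .seq (.assign 11 (.add (.var 4) (.var 14))) <|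
     .seq (setLeaf 5) <|
     .assign 14 (.add (.var 14) (.const 1)))

/-- Set up the data structure for the group size in variable 3. -/
def beginPhase : Prog :=
  .seq (.assign 4 (.div (.sub (.add (.var 1) (.var 3)) (.const 1)) (.var 3))) <|
  .seq (.assign 5 (.mul (.var 3) (.var 2))) <|
  .seq (.assign 8 (.const 0)) <|
  .seq (.assign 9 (.const 0)) <|
  .seq (.assign 10 (.const 0)) <|
  .seq (.assign 13 (.const 0)) <|
  .seq clearTrees <|
  .seq (.assign 13 (.const 0)) <|
  .seq enterHeads <|
  .seq (.assign 14 (.const 0)) <|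
  enterGroups

section Begin

variable {α : Type*} [LinearOrder α]

/-- The state of the memory between two phases. -/
structure BaseInv (S : List α) (m lg Tmax : ℕ) (st sq : ℕ → ℕ) (σ : Store α) (t : ℕ) : Prop where
  v0 : σ.var 0 = S.length
  v1 : σ.var 1 = m
  v2 : σ.var 2 = lg
  v6 : σ.var 6 = Tmax
  v7 : σ.var 7 = t
  a1 : ∀ p < S.length, σ.arr 1 p = sq p
  a3 : ∀ i < m, σ.arr 3 i = st (i + 1)
  out : σ.out = sortedPrefix S t
  head : ∀ i < m, IsHead S (fun p => sq p = i) t (σ.arr 2 i)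

/-- The state of the memory at the beginning of a phase. -/
structure Setup (S : List α) (m lg K G Tmax : ℕ) (st sq : ℕ → ℕ) (σ : Store α) (t : ℕ) : Prop
    extends BaseInv S m lg Tmax st sq σ t where
  v3 : σ.var 3 = K
  v4 : σ.var 4 = G
  v5 : σ.var 5 = K * lg
  v8 : σ.var 8 = 0
  v9 : σ.var 9 = 0
  v10 : σ.var 10 = 0

variable {W m lg K G Tmax t cnt : ℕ} {S : List α} {st sq : ℕ → ℕ} {σ τ : Store α}

theorem PhaseInv.toBaseInv (h : PhaseInv S m lg K G Tmax st sq σ t cnt) :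
    BaseInv S m lg Tmax st sq σ t :=
  ⟨h.v0, h.v1, h.v2, h.v6, h.v7, h.a1, h.a3, h.out, h.conf.head⟩

theorem Setup.congr (h : Setup S m lg K G Tmax st sq σ t) (hv : ∀ y < 11, τ.var y = σ.var y)
    (ho : τ.out = σ.out) (ha : ∀ b < 4, τ.arr b = σ.arr b) :
    Setup S m lg K G Tmax st sq τ t where
  v0 := by rw [hv 0 (by omega), h.v0]
  v1 := by rw [hv 1 (by omega), h.v1]
  v2 := by rw [hv 2 (by omega), h.v2]
  v3 := by rw [hv 3 (by omega), h.v3]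
  v4 := by rw [hv 4 (by omega), h.v4]
  v5 := by rw [hv 5 (by omega), h.v5]
  v6 := by rw [hv 6 (by omega), h.v6]
  v7 := by rw [hv 7 (by omega), h.v7]
  v8 := by rw [hv 8 (by omega), h.v8]
  v9 := by rw [hv 9 (by omega), h.v9]
  v10 := by rw [hv 10 (by omega), h.v10]
  a1 := by rw [ha 1 (by omega)]; exact h.a1
  a3 := by rw [ha 3 (by omega)]; exact h.a3
  out := by rw [ho, h.out]
  head := by rw [ha 2 (by omega)]; exact h.head

theorem isTree_const {A : ℕ → ℕ} {b N : ℕ} (h : ∀ v < 2 * N, A (b + v) = S.length) :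
    IsTree S A b N where
  le v _ h2 := (h v h2).le
  node v h1 h2 := by
    rw [h v (by omega), h (2 * v) (by omega), Nat.add_assoc b, h (2 * v + 1) (by omega), best]
    simp

theorem runs_clearTrees {T : ℕ} (hz : Sizes W S.length m lg K G)
    (h : Setup S m lg K G Tmax st sq σ t) (h13 : σ.var 13 = 0)
    (hT : 25 * (2 * K * G) + 7 ≤ T) :
    Runs W S clearTrees σ T fun τ => Setup S m lg K G Tmax st sq τ t ∧
      ∀ y < 2 * K * G, τ.arr 4 y = S.length ∧ τ.arr 5 y = S.length ∧ τ.arr 6 y = S.length := by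
  have hW := hz.hW
  have hn := hz.hn
  have hmn := hz.m_le
  have hKm := hz.hKm
  have hmul := hz.mul_le
  have hGm := hz.G_le
  have hKG : 2 * K * G = 2 * (K * G) := Nat.mul_assoc _ _ _
  refine runs_loop (fun k σ => Setup S m lg K G Tmax st sq σ t ∧ σ.var 13 ≤ 2 * K * G ∧
    (∀ y < σ.var 13, σ.arr 4 y = S.length ∧ σ.arr 5 y = S.length ∧ σ.arr 6 y = S.length) ∧
    25 * (2 * K * G - σ.var 13) + 7 ≤ k) ?_ ⟨h, by omega, by simp [h13], by omega⟩
  rintro k σ ⟨h, hi, hA, hk⟩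
  have v0 := h.v0
  have v3 := h.v3
  have v4 := h.v4
  refine ⟨?_, by simp only [Test.cost, Expr.cost]; omega, ?_, ?_⟩
  · simp only [Test.Fits, Expr.Fits, Expr.eval, v3, v4]; omega
  · intro hh
    simp only [Test.Holds, Expr.eval, v3, v4] at hh
    exact ⟨h, fun y hy => hA y (by omega)⟩
  · intro hh
    simp only [Test.Holds, Expr.eval, v3, v4] at hh
    refine ⟨18, by simp only [Test.cost, Expr.cost]; omega, ?_⟩
    refine runs_put_seq (by simp only [Expr.Fits]; omega) (by simp only [Expr.Fits]; omega)
      (by simp [Expr.cost]) ?_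
    refine runs_put_seq (by simp [Expr.Fits]; omega) (by simp [Expr.Fits]; omega)
      (by simp [Expr.cost]) ?_
    refine runs_put_seq (by simp [Expr.Fits]; omega) (by simp [Expr.Fits]; omega)
      (by simp [Expr.cost]) ?_
    refine runs_assign (by simp [Expr.Fits, Expr.eval]; omega) (by simp [Expr.cost]) ?_
    refine ⟨h.congr ?_ rfl ?_, ?_, ?_, ?_⟩
    · intro y hy
      have : y ≠ 13 := by omega
      simp [this]
    · intro b hb
      have h4 : b ≠ 4 := by omega
      have h5 : b ≠ 5 := by omega
      have h6 : b ≠ 6 := by omega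
      simp [h4, h5, h6]
    · simp [Expr.eval]; omega
    · intro y hy
      simp [Expr.eval] at hy
      by_cases hy' : y = σ.var 13
      · simp [Expr.eval, hy', v0]
      · have := hA y (by omega)
        simpa [Expr.eval, hy', Function.update_of_ne] using this
    · simp [Expr.eval, Test.cost, Expr.cost]; omega

theorem runs_enterHeads {j T : ℕ} (hz : Sizes W S.length m lg K G)
    (h : Setup S m lg K G Tmax st sq σ t) (h13 : σ.var 13 = 0)
    (hA : ∀ y < 2 * K * G, σ.arr 4 y = S.length ∧ σ.arr 5 y = S.length ∧ σ.arr 6 y = S.length)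
    (hj : K ≤ 2 ^ j) (hT : (100 * j + 70) * m + 3 ≤ T) :
    Runs W S enterHeads σ T fun τ => Setup S m lg K G Tmax st sq τ t ∧
      (∀ g < G, IsTree S (τ.arr 4) (2 * K * g) K) ∧
      (∀ g < G, ∀ i < K, τ.arr 4 (2 * K * g + (K + i)) =
        if K * g + i < m then τ.arr 2 (K * g + i) else S.length) ∧
      ∀ y < 2 * K * G, τ.arr 5 y = S.length ∧ τ.arr 6 y = S.length := by
  have hW := hz.hW
  have hn := hz.hn
  have hK := hz.hK
  have hmn := hz.m_le
  have haddr : ∀ g < G, ∀ v < 2 * K, 2 * K * g + v < 2 * K * G := fun g hg v hv => by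
    have h2 : 2 * K * (g + 1) ≤ 2 * K * G := Nat.mul_le_mul_left _ hg
    rw [Nat.mul_add] at h2
    omega
  -- The forest belongs to a fictitious array of heads in which the sequences not yet entered hold
  -- the sentinel n.
  refine runs_loop (fun k σ => Setup S m lg K G Tmax st sq σ t ∧ σ.var 13 ≤ m ∧
    (∀ g < G, IsTree S (σ.arr 4) (2 * K * g) K) ∧
    (∀ g < G, ∀ i < K, σ.arr 4 (2 * K * g + (K + i)) = if K * g + i < m then
      (fun l => if l < σ.var 13 then σ.arr 2 l else S.length) (K * g + i) else S.length) ∧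
    (∀ y < 2 * K * G, σ.arr 5 y = S.length ∧ σ.arr 6 y = S.length) ∧
    (100 * j + 70) * (m - σ.var 13) + 3 ≤ k) ?_ ⟨h, by omega, ?_, ?_, fun y hy => (hA y hy).2, ?_⟩
  · rintro k σ ⟨h, hi, ht, hl, hUV, hk⟩
    have v0 := h.v0
    have v1 := h.v1
    refine ⟨?_, by simp only [Test.cost, Expr.cost]; omega, ?_, ?_⟩
    · simp only [Test.Fits, Expr.Fits, v1]; omega
    · intro hh
      simp only [Test.Holds, Expr.eval, v1] at hh
      refine ⟨h, ht, fun g hg i hi => ?_, hUV⟩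
      rw [hl g hg i hi]
      split_ifs with h1
      · exact if_pos (by omega)
      · rfl
    · intro hh
      simp only [Test.Holds, Expr.eval, v1] at hh
      set i := σ.var 13 with hid
      have hx := (h.head i hh).le
      have hstep : (100 * j + 70) * (m - i) = (100 * j + 70) * (m - (i + 1)) + (100 * j + 70) := by
        rw [show m - i = (m - (i + 1)) + 1 by omega, Nat.mul_succ]
      refine ⟨100 * j + 60, by simp only [Test.cost, Expr.cost]; omega, ?_⟩
      refine runs_assign_seq (by simp only [Expr.Fits, Expr.eval, ← hid]; omega)
        (by simp only [Expr.cost]; omega) ?_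
      refine Runs.seq (T₁ := 100 * j + 50) (T₂ := 4) ?_ (by simp only [Expr.cost]; omega)
      simp only [Expr.eval, ← hid]
      refine runs_putHead (i := i) (x := σ.arr 2 i) (j := j) hz (by simpa using v0)
        (by simpa using h.v3) hh (by simp [hid]) (by simp) hx hj le_rfl
        (by simpa using ht _ (hz.div_lt hh)) ?_
      intro F' f1 f2 f3 f4
      obtain ⟨t1, t2, -⟩ := forest_update (G := G)
          (cur := fun l => if l < i then σ.arr 2 l else S.length)
          (cur' := fun l => if l < i + 1 then σ.arr 2 l else S.length) hK ht hl hh f1 f2 f3 f4 (by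
        funext l
        by_cases hli : l = i
        · subst hli; simp
        · rw [Function.update_of_ne hli]
          have : l < i + 1 ↔ l < i := by omega
          simp only [this])
      refine runs_assign (by simp [Expr.Fits, Expr.eval]; omega) (by simp [Expr.cost]) ?_
      refine ⟨h.congr ?_ rfl ?_, ?_, ?_, ?_, ?_, ?_⟩
      · intro y hy
        have h1 : y ≠ 11 := by omega
        have h2 : y ≠ 13 := by omega
        have h3 : y ≠ 14 := by omega
        have h4 : y ≠ 15 := by omega
        have h5 : y ≠ 16 := by omega
        simp [h1, h2, h3, h4, h5]
      · intro b hb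
        have h4 : b ≠ 4 := by omega
        simp [h4]
      · simp [Expr.eval]; omega
      · simpa using t1
      · simpa [Expr.eval, ← hid] using t2
      · simpa using hUV
      · simp [Expr.eval, Test.cost, Expr.cost, ← hid]; omega
  · exact fun g hg => isTree_const fun v hv => (hA _ (haddr g hg v hv)).1
  · intro g hg i hi
    rw [(hA _ (haddr g hg (K + i) (by omega))).1, h13]
    simp
  · rw [h13]; simpa using hT

theorem runs_enterGroups {j T : ℕ} (hz : Sizes W S.length m lg K G)
    (h : Setup S m lg K G Tmax st sq σ t) (h14 : σ.var 14 = 0)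
    (ht : ∀ g < G, IsTree S (σ.arr 4) (2 * K * g) K)
    (hl : ∀ g < G, ∀ i < K, σ.arr 4 (2 * K * g + (K + i)) =
        if K * g + i < m then σ.arr 2 (K * g + i) else S.length)
    (hUV : ∀ y < 2 * K * G, σ.arr 5 y = S.length ∧ σ.arr 6 y = S.length)
    (hj : G ≤ 2 ^ j) (hT : (100 * j + 70) * G + 3 ≤ T) :
    Runs W S enterGroups σ T fun τ => PhaseInv S m lg K G Tmax st sq τ t 0 ∧
      τ.var 9 = 0 ∧ τ.var 10 = 0 := by
  have hW := hz.hW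
  have hn := hz.hn
  have hK := hz.hK
  have hmn := hz.m_le
  have hKm := hz.hKm
  have hGm := hz.G_le
  have hGone := hz.one_le
  have hGK : 2 * G ≤ 2 * K * G := Nat.mul_le_mul_right _ (by omega)
  have hKG : 2 * K ≤ 2 * K * G := Nat.le_mul_of_pos_right _ hGone
  refine runs_loop (fun k σ => Setup S m lg K G Tmax st sq σ t ∧ σ.var 14 ≤ G ∧
    (∀ g < G, IsTree S (σ.arr 4) (2 * K * g) K) ∧
    (∀ g < G, ∀ i < K, σ.arr 4 (2 * K * g + (K + i)) =
        if K * g + i < m then σ.arr 2 (K * g + i) else S.length) ∧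
    IsTree S (σ.arr 5) 0 G ∧
    (∀ g < G, σ.arr 5 (0 + (G + g)) =
      if g < σ.var 14 then σ.arr 4 (2 * K * g + 1) else S.length) ∧
    (∀ y < 2 * K, σ.arr 6 y = S.length) ∧
    (100 * j + 70) * (G - σ.var 14) + 3 ≤ k) ?_ ⟨h, by omega, ht, hl,
      isTree_const fun v hv => (hUV _ (by omega)).1, fun g hg => ?_,
      fun y hy => (hUV y (by omega)).2, by rw [h14]; simpa using hT⟩
  · rintro k σ ⟨h, hi, ht, hl, hU, hUl, hV, hk⟩
    have v0 := h.v0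
    have v3 := h.v3
    have v4 := h.v4
    refine ⟨?_, by simp only [Test.cost, Expr.cost]; omega, ?_, ?_⟩
    · simp only [Test.Fits, Expr.Fits, v4]; omega
    · intro hh
      simp only [Test.Holds, Expr.eval, v4] at hh
      refine ⟨⟨v0, h.v1, h.v2, v3, v4, h.v5, h.v6, h.v7, h.v8, h.a1, h.a3, h.out,
        ⟨h.head, ht, hl, Nat.zero_le _, by simp, by simp, hU, ?_,
          isTree_const fun v hv => hV _ (by omega), ?_⟩⟩, h.v9, h.v10⟩
      · intro g hg
        rw [hUl g hg, if_pos (by omega), if_neg fun hl => absurd hl.1 (Nat.not_lt_zero _)]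
      · intro s hs
        rw [hV _ (by omega), if_neg (Nat.not_lt_zero _)]
    · intro hh
      simp only [Test.Holds, Expr.eval, v4] at hh
      set g := σ.var 14 with hgd
      have haddr := hz.addr_le hh
      have hroot := (ht g hh).le 1 le_rfl (by omega)
      have hstep : (100 * j + 70) * (G - g) = (100 * j + 70) * (G - (g + 1)) + (100 * j + 70) := by
        rw [show G - g = (G - (g + 1)) + 1 by omega, Nat.mul_succ]
      refine ⟨100 * j + 60, by simp only [Test.cost, Expr.cost]; omega, ?_⟩
      refine runs_assign_seq (by simp only [Expr.Fits, Expr.eval, v3, ← hgd]; omega)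
        (by simp only [Expr.cost]; omega) ?_
      refine runs_assign_seq (by simp [Expr.Fits]) (by simp only [Expr.cost]; omega) ?_
      refine runs_assign_seq (by simp [Expr.Fits, Expr.eval, v4, ← hgd]; omega)
        (by simp only [Expr.cost]; omega) ?_
      refine Runs.seq (T₁ := 100 * j + 20) (T₂ := 4) ?_ (by simp only [Expr.cost]; omega)
      refine runs_setLeaf (b := 0) (N := G) (c := g) (x := σ.arr 4 (2 * K * g + 1)) (j := j)
        (by omega) (by omega) ?_ ?_ ?_ hh ?_ hroot hj le_rfl ?_ ?_
      · simpa using v0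
      · simp [Expr.eval]
      · simp [Expr.eval, v4, hgd]
      · simp [Expr.eval, v3, hgd]
      · simpa using hU
      intro U' u1 u2 u3 _
      refine runs_assign (by simp [Expr.Fits, Expr.eval]; omega) (by simp [Expr.cost]) ?_
      refine ⟨h.congr ?_ rfl ?_, ?_, ?_, ?_, ?_, ?_, ?_, ?_⟩
      · intro y hy
        have h1 : y ≠ 11 := by omega
        have h3 : y ≠ 14 := by omega
        have h4 : y ≠ 15 := by omega
        have h5 : y ≠ 16 := by omega
        simp [h1, h3, h4, h5]
      · intro b hb
        have h4 : b ≠ 5 := by omega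
        simp [h4]
      · simp [Expr.eval]; omega
      · simpa using ht
      · simpa using hl
      · simpa using u1
      · intro d hd
        simp only [Store.setVar_arr, Store.setArr_arr, if_true] at u3 ⊢
        by_cases hdg : d = g
        · subst hdg
          rw [u2]
          simp [Expr.eval, ← hgd]
        · rw [u3 d hd hdg, hUl d hd]
          have : d < g + 1 ↔ d < g := by omega
          simp [Expr.eval, ← hgd, this]
      · simpa using hV
      · simp [Expr.eval, Test.cost, Expr.cost, ← hgd]; omega
  · rw [(hUV _ (by omega)).1, h14]; simp

/-- The rebuilding makes at most 2m leaf updates of O(log n) each, which is O(n) because m log n ≤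
n. This affords fresh trees in every phase. -/
theorem runs_beginPhase {j T : ℕ} (hz : Sizes W S.length m lg K G)
    (h : BaseInv S m lg Tmax st sq σ t) (v3 : σ.var 3 = K)
    (hj : K ≤ 2 ^ j) (hjG : G ≤ 2 ^ j) (hT : (200 * j + 240) * m + 1000 ≤ T) :
    Runs W S beginPhase σ T fun τ => PhaseInv S m lg K G Tmax st sq τ t 0 ∧
      τ.var 3 = K ∧ τ.var 9 = 0 ∧ τ.var 10 = 0 := by
  have hW := hz.hW
  have hn := hz.hn
  have hK := hz.hK
  have hm := hz.hm
  have hmn := hz.m_le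
  have hKm := hz.hKm
  have hGm := hz.G_le
  have hlgn := hz.hlgn
  have hwn := hz.w_le
  have hmul := hz.mul_le
  have hKG : 2 * K * G = 2 * (K * G) := Nat.mul_assoc _ _ _
  have v1 := h.v1
  have v2 := h.v2
  have hGm' : (100 * j + 70) * G ≤ (100 * j + 70) * m := Nat.mul_le_mul_left _ hGm
  have hsum : (200 * j + 240) * m = 2 * ((100 * j + 70) * m) + 100 * m := by ring
  refine runs_assign_seq (by simp only [Expr.Fits, Expr.eval, v1, v3]; omega)
    (by simp only [Expr.cost]; omega) ?_
  refine runs_assign_seq (by simp [Expr.Fits, Expr.eval, v2, v3]; omega)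
    (by simp only [Expr.cost]; omega) ?_
  refine runs_assign_seq (by simp [Expr.Fits]) (by simp only [Expr.cost]; omega) ?_
  refine runs_assign_seq (by simp [Expr.Fits]) (by simp only [Expr.cost]; omega) ?_
  refine runs_assign_seq (by simp [Expr.Fits]) (by simp only [Expr.cost]; omega) ?_
  refine runs_assign_seq (by simp [Expr.Fits]) (by simp only [Expr.cost]; omega) ?_
  simp only [Expr.cost]
  refine Runs.seq (T₁ := 100 * m + 700) (T₂ := 2 * ((100 * j + 70) * m) + 200) ?_ (by omega)
  refine (runs_clearTrees (m := m) (lg := lg) (K := K) (G := G) (Tmax := Tmax) (st := st) (sq := sq)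
    (t := t) hz ⟨⟨?_, ?_, ?_, ?_, ?_, ?_, ?_, ?_, ?_⟩, ?_, ?_, ?_, ?_, ?_, ?_⟩ ?_ (by omega)).mono
    le_rfl ?_
  · simpa using h.v0
  · simpa using h.v1
  · simpa using h.v2
  · simpa using h.v6
  · simpa using h.v7
  · simpa using h.a1
  · simpa using h.a3
  · simpa using h.out
  · simpa using h.head
  · simpa using v3
  · simp [Expr.eval, v1, v3, hz.hG]
  · simp [Expr.eval, v2, v3]
  · simp [Expr.eval]
  · simp [Expr.eval]
  · simp [Expr.eval]
  · simp [Expr.eval]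
  rintro τ ⟨hs, hA⟩
  have hset : ∀ (τ : Store α) y, 11 ≤ y → Setup S m lg K G Tmax st sq τ t →
      Setup S m lg K G Tmax st sq (τ.setVar y 0) t := fun τ y hy hs =>
    hs.congr (fun x hx => by have : x ≠ y := by omega
                             simp [this]) rfl fun _ _ => rfl
  refine runs_assign_seq (by simp [Expr.Fits]) (by simp only [Expr.cost]; omega) ?_
  simp only [Expr.eval, Expr.cost]
  refine Runs.seq (T₁ := (100 * j + 70) * m + 3) (T₂ := (100 * j + 70) * m + 100) ?_ (by omega)
  refine (runs_enterHeads hz (hset τ 13 (by omega) hs) (by simp) (by simpa using hA) hj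
    le_rfl).mono le_rfl ?_
  rintro τ ⟨hs, ht, hl, hUV⟩
  refine runs_assign_seq (by simp [Expr.Fits]) (by simp only [Expr.cost]; omega) ?_
  simp only [Expr.eval, Expr.cost]
  refine (runs_enterGroups hz (hset τ 14 (by omega) hs) (by simp) (by simpa using ht)
    (by simpa using hl) (by simpa using hUV) hjG (by omega)).mono le_rfl ?_
  rintro τ ⟨h1, h2, h3⟩
  exact ⟨h1, h1.v3, h2, h3⟩

end Begin

/-! ### The layout of the input -/

section Input

variable {α : Type*}

/-- The position of the first element of the `i`-th sequence. -/
def startOf (L : List (List α)) (i : ℕ) : ℕ := (L.take i).flatten.length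

/-- The sequence to which a position belongs. -/
def seqOf (L : List (List α)) (p : ℕ) : ℕ :=
  ((Finset.range L.length).filter fun i => startOf L (i + 1) ≤ p).card

theorem startOf_zero (L : List (List α)) : startOf L 0 = 0 := by simp [startOf]

theorem startOf_length (L : List (List α)) : startOf L L.length = L.flatten.length := by
  simp [startOf]

theorem startOf_succ (L : List (List α)) {i : ℕ} (hi : i < L.length) :
    startOf L (i + 1) = startOf L i + L[i].length := by
  rw [startOf, startOf, ← List.take_concat_get' L i hi, List.flatten_append, List.length_append]
  congr 1
  simp

theorem startOf_mono (L : List (List α)) : Monotone (startOf L) := by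
  refine monotone_nat_of_le_succ fun i => ?_
  rcases lt_or_ge i L.length with hi | hi
  · rw [startOf_succ L hi]; omega
  · simp [startOf, List.take_of_length_le hi, List.take_of_length_le (Nat.le_succ_of_le hi)]

theorem startOf_le (L : List (List α)) (i : ℕ) : startOf L i ≤ L.flatten.length := by
  rcases le_total i L.length with hi | hi
  · rw [← startOf_length]; exact startOf_mono L hi
  · simp [startOf, List.take_of_length_le hi]

theorem getElem?_flatten_startOf (L : List (List α)) {i j : ℕ} (hi : i < L.length)
    (hj : j < L[i].length) : L.flatten[startOf L i + j]? = some L[i][j] := by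
  have hsplit : L.flatten = (L.take i).flatten ++ (L[i] ++ (L.drop (i + 1)).flatten) := by
    conv_lhs => rw [← List.take_append_drop i L, List.flatten_append,
      List.drop_eq_getElem_cons hi, List.flatten_cons]
  rw [hsplit, startOf, List.getElem?_append_right (by omega), Nat.add_sub_cancel_left,
    List.getElem?_append_left hj, List.getElem?_eq_getElem hj]

/-- Counting the sequences that end at or before a position skips empty sequences correctly. -/
theorem seqOf_eq (L : List (List α)) {i p : ℕ} (hi : i < L.length) (h1 : startOf L i ≤ p)
    (h2 : p < startOf L (i + 1)) : seqOf L p = i := by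
  have : ((Finset.range L.length).filter fun i => startOf L (i + 1) ≤ p) = Finset.range i := by
    ext l
    simp only [Finset.mem_filter, Finset.mem_range]
    constructor
    · rintro ⟨-, h⟩
      by_contra hle
      have := startOf_mono L (by omega : i + 1 ≤ l + 1)
      omega
    · intro hl
      exact ⟨by omega, (startOf_mono L (by omega : l + 1 ≤ i)).trans h1⟩
  rw [seqOf, this, Finset.card_range]

theorem exists_seq (L : List (List α)) {p : ℕ} (hp : p < L.flatten.length) :
    ∃ i < L.length, startOf L i ≤ p ∧ p < startOf L (i + 1) := by
  have hex : ∃ i, p < startOf L i := ⟨L.length, by rwa [startOf_length]⟩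
  classical
  have h1 := Nat.find_spec hex
  set l := Nat.find hex with hl
  rcases Nat.eq_zero_or_pos l with h0 | h0
  · rw [h0, startOf_zero] at h1; omega
  obtain ⟨i, hi⟩ : ∃ i, l = i + 1 := ⟨l - 1, by omega⟩
  have h2 : ¬ p < startOf L i := Nat.find_min hex (by omega)
  rw [hi] at h1
  refine ⟨i, ?_, by omega, h1⟩
  by_contra hle
  apply h2
  have := startOf_mono L (not_lt.1 hle)
  rw [startOf_length] at this
  omega

theorem layout [LinearOrder α] (L : List (List α)) (hL : ∀ s ∈ L, s.Pairwise (· ≤ ·)) :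
    Layout L.flatten L.length (startOf L) (seqOf L) := by
  have key : ∀ p < L.flatten.length, seqOf L p < L.length ∧ startOf L (seqOf L p) ≤ p ∧
      p < startOf L (seqOf L p + 1) := by
    intro p hp
    obtain ⟨i, hi, h1, h2⟩ := exists_seq L hp
    rw [seqOf_eq L hi h1 h2]
    exact ⟨hi, h1, h2⟩
  refine ⟨fun p hp => (key p hp).1, fun p hp => (key p hp).2.2,
    fun i hi p h1 h2 => seqOf_eq L hi h1 h2, fun p hp => (key p hp).2.1,
    fun i _ => startOf_le L _, ?_, ?_⟩
  · intro p q hpq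
    refine Finset.card_le_card fun i hi => ?_
    rw [Finset.mem_filter] at hi ⊢
    exact ⟨hi.1, hi.2.trans hpq⟩
  · intro p q hpq hq hs
    have hp := hpq.trans hq
    obtain ⟨hi, p1, p2⟩ := key p hp
    obtain ⟨-, q1, q2⟩ := key q hq
    rw [← hs] at q1 q2
    generalize seqOf L p = i at *
    rw [startOf_succ L hi] at p2 q2
    refine rk_lt_rk hpq hq ?_
    obtain ⟨a, rfl⟩ := Nat.exists_eq_add_of_le p1
    obtain ⟨b, rfl⟩ := Nat.exists_eq_add_of_le q1
    have ha : a < L[i].length := by omega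
    have hb : b < L[i].length := by omega
    have e1 := getElem?_flatten_startOf L hi ha
    have e2 := getElem?_flatten_startOf L hi hb
    rw [List.getElem?_eq_getElem hp, Option.some_inj] at e1
    rw [List.getElem?_eq_getElem hq, Option.some_inj] at e2
    rw [e1, e2]
    exact List.pairwise_iff_getElem.1 (hL _ (List.getElem_mem hi)) a b ha hb (by omega)

/-- The first position of the `i`-th sequence. -/
def firstPos (L : List (List α)) (i : ℕ) : ℕ :=
  if startOf L i < startOf L (i + 1) then startOf L i else L.flatten.length

theorem isHead_firstPos [LinearOrder α] (L : List (List α)) (hL : ∀ s ∈ L, s.Pairwise (· ≤ ·))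
    {i : ℕ} (hi : i < L.length) :
    IsHead L.flatten (fun p => seqOf L p = i) 0 (firstPos L i) := by
  have hl := layout L hL
  unfold firstPos
  split_ifs with h
  · have hs := seqOf_eq L hi le_rfl h
    refine ⟨startOf_le L i, fun _ => ⟨hs, Nat.zero_le _⟩, fun q hq hqi _ => ?_⟩
    have h1 := hl.start_le q hq
    rw [hqi] at h1
    rcases h1.lt_or_eq with h1 | h1
    · exact (hl.sorted _ q h1 hq (hs.trans hqi.symm)).le
    · rw [h1]
  · refine ⟨le_rfl, fun h => absurd h (lt_irrefl _), fun q hq hqi _ => ?_⟩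
    have h1 := hl.start_le q hq
    have h2 := hl.lt_end q hq
    rw [hqi] at h1 h2
    omega

end Input

/-! ### The preparation -/

/-- Add the logarithm of variable 13 to variable 2. -/
def computeLog : Prog :=
  .loop (.lt (.const 1) (.var 13))
    (.seq (.assign 13 (.div (.var 13) (.const 2))) (.assign 2 (.add (.var 2) (.const 1))))

/-- Mark the positions from variable 12 to variable 17 as positions of the sequence in
variable 13. -/
def markSeq : Prog :=
  .loop (.lt (.var 12) (.var 17))
    (.seq (.put 1 (.var 12) (.var 13)) (.assign 12 (.add (.var 12) (.const 1))))

/-- Compute the sequences of all positions, and the first positions and the ends of all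
sequences. -/
def computeLayout : Prog :=
  .loop (.lt (.var 13) (.var 1))
    (.seq (.assign 17 (.add (.var 12) (.get 0 (.var 13)))) <|
     .seq (.branch (.lt (.var 12) (.var 17)) (.put 2 (.var 13) (.var 12))
       (.put 2 (.var 13) (.var 0))) <|
     .seq (.put 3 (.var 13) (.var 17)) <|
     .seq markSeq <|
     .assign 13 (.add (.var 13) (.const 1)))

/-- The computations before the first phase. -/
def prepare : Prog :=
  .seq (.assign 13 (.var 0)) <|
  .seq computeLog <|
  .seq (.assign 13 (.const 0)) <|
  .seq computeLayout <|
  .seq (.assign 3 (.const 8)) <|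
  .assign 6 (.mul (.const 40) (.div (.var 0) (.var 2)))

section Prepare

variable {α : Type*} [LinearOrder α] {W : ℕ} {S : List α} {σ : Store α}

theorem runs_computeLog {T n : ℕ} (hn : 1 ≤ n) (hW : 40 * n ≤ W) (h13 : σ.var 13 = n)
    (h2 : σ.var 2 = 0) (hT : 20 * n + 3 ≤ T) :
    Runs W S computeLog σ T fun τ => ∃ x, τ = (σ.setVar 13 x).setVar 2 (Nat.log 2 n) := by
  have hlog := Nat.log_le_self 2 n
  refine runs_loop (fun k τ => ∃ x l, τ = (σ.setVar 13 x).setVar 2 l ∧ 1 ≤ x ∧ x ≤ n ∧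
    l + Nat.log 2 x = Nat.log 2 n ∧ 20 * Nat.log 2 x + 3 ≤ k) ?_
    ⟨n, 0, ?_, hn, le_rfl, by omega, by omega⟩
  · rintro k _ ⟨x, l, rfl, hx, hxn, hl, hk⟩
    refine ⟨?_, by simp only [Test.cost, Expr.cost]; omega, ?_, ?_⟩
    · simp [Test.Fits, Expr.Fits]; omega
    · intro hh
      simp only [Test.Holds, Expr.eval, Store.setVar_var, Nat.reduceEqDiff, if_true,
        if_false] at hh
      obtain rfl : x = 1 := by omega
      rw [Nat.log_one_right] at hl
      exact ⟨1, by rw [← hl]; rfl⟩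
    · intro hh
      simp only [Test.Holds, Expr.eval, Store.setVar_var, Nat.reduceEqDiff, if_true,
        if_false] at hh
      have hlx : Nat.log 2 x = Nat.log 2 (x / 2) + 1 := Nat.log_of_one_lt_of_le (by omega) hh
      refine ⟨10, by simp only [Test.cost, Expr.cost]; omega, ?_⟩
      refine runs_assign_seq (by simp [Expr.Fits]; omega) (by simp [Expr.cost]) ?_
      refine runs_assign (by simp [Expr.Fits, Expr.eval]; omega) (by simp [Expr.cost]) ?_
      refine ⟨x / 2, l + 1, ?_, by omega, by omega, by omega, ?_⟩
      · simp only [Expr.eval, Store.setVar_var, Nat.reduceEqDiff, if_true, if_false]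
        simp only [Store.setVar]
        congr 1
        rw [Function.update_comm (by omega : (2 : ℕ) ≠ 13)]
        simp
      · simp only [Test.cost, Expr.cost]; omega
  · rcases σ with ⟨v, a, o⟩
    simp only at h13 h2
    simp [Store.setVar, ← h13, ← h2]

theorem runs_markSeq {T i e n : ℕ} (f : ℕ → ℕ) (hW : 40 * n ≤ W) (hn : 1 ≤ n)
    (h13 : σ.var 13 = i) (hi : i ≤ n) (h17 : σ.var 17 = e) (he : e ≤ n) (h12 : σ.var 12 ≤ e)
    (hf : ∀ p, σ.var 12 ≤ p → p < e → f p = i) (hA : ∀ p < σ.var 12, σ.arr 1 p = f p)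
    (hT : 20 * (e - σ.var 12) + 3 ≤ T) :
    Runs W S markSeq σ T fun τ => ∃ A, τ = (σ.setVar 12 e).setArr 1 A ∧ ∀ p < e, A p = f p := by
  refine runs_loop (fun k τ => ∃ q A, τ = (σ.setVar 12 q).setArr 1 A ∧ σ.var 12 ≤ q ∧ q ≤ e ∧
    (∀ p < q, A p = f p) ∧ 20 * (e - q) + 3 ≤ k) ?_
    ⟨σ.var 12, σ.arr 1, by simp [Store.setVar, Store.setArr], le_rfl, h12, hA, hT⟩
  rintro k _ ⟨q, A, rfl, hq1, hq2, hA, hk⟩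
  refine ⟨?_, by simp only [Test.cost, Expr.cost]; omega, ?_, ?_⟩
  · simp [Test.Fits, Expr.Fits, h17]; omega
  · intro hh
    simp [Test.Holds, Expr.eval, h17] at hh
    obtain rfl : q = e := by omega
    exact ⟨A, rfl, hA⟩
  · intro hh
    simp [Test.Holds, Expr.eval, h17] at hh
    refine ⟨10, by simp only [Test.cost, Expr.cost]; omega, ?_⟩
    refine runs_put_seq (by simp [Expr.Fits]; omega) (by simp [Expr.Fits, h13]; omega)
      (by simp [Expr.cost]) ?_
    refine runs_assign (by simp [Expr.Fits, Expr.eval]; omega) (by simp [Expr.cost]) ?_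
    refine ⟨q + 1, Function.update A q i, ?_, by omega, by omega, fun p hp => ?_, ?_⟩
    · simp [Expr.eval, h13, Store.setVar, Store.setArr]
    · by_cases hpq : p = q
      · rw [hpq, Function.update_self, hf q hq1 hh]
      · rw [Function.update_of_ne hpq]; exact hA p (by omega)
    · simp only [Test.cost, Expr.cost]; omega

/-- The part of the layout that concerns the first `i` sequences has been computed. -/
structure LayoutInv (L : List (List α)) (lg : ℕ) (σ : Store α) (i : ℕ) : Prop where
  v0 : σ.var 0 = L.flatten.length
  v1 : σ.var 1 = L.length
  v2 : σ.var 2 = lg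
  v7 : σ.var 7 = 0
  v12 : σ.var 12 = startOf L i
  v13 : σ.var 13 = i
  a0 : ∀ l (hl : l < L.length), σ.arr 0 l = L[l].length
  a1 : ∀ p < startOf L i, σ.arr 1 p = seqOf L p
  a2 : ∀ l < i, σ.arr 2 l = firstPos L l
  a3 : ∀ l < i, σ.arr 3 l = startOf L (l + 1)
  out : σ.out = []

/-- The budget is 20 steps per position and 50 per sequence, the latter because empty sequences also
cost time. -/
theorem runs_computeLayout {L : List (List α)} {lg T : ℕ} (hW : 40 * L.flatten.length ≤ W)
    (hn : 1 ≤ L.flatten.length) (hm : L.length ≤ L.flatten.length) (h : LayoutInv L lg σ 0)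
    (hT : 20 * L.flatten.length + 50 * L.length + 3 ≤ T) :
    Runs W S computeLayout σ T fun τ => LayoutInv L lg τ L.length := by
  set n := L.flatten.length with hnd
  set m := L.length with hmd
  refine runs_loop (fun k τ => ∃ i, LayoutInv L lg τ i ∧ i ≤ m ∧
    20 * (n - startOf L i) + 50 * (m - i) + 3 ≤ k) ?_ ⟨0, h, Nat.zero_le _, by
      rw [startOf_zero]; simpa using hT⟩
  rintro k σ ⟨i, h, him, hk⟩
  have v0 := h.v0
  have v1 := h.v1
  have v12 := h.v12
  have v13 := h.v13
  refine ⟨?_, by simp only [Test.cost, Expr.cost]; omega, ?_, ?_⟩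
  · simp only [Test.Fits, Expr.Fits, v1, v13]; omega
  · intro hh
    simp only [Test.Holds, Expr.eval, v1, v13] at hh
    obtain rfl : i = m := by omega
    exact h
  intro hh
  simp only [Test.Holds, Expr.eval, v1, v13] at hh
  have hsucc := startOf_succ L hh
  have hle := startOf_le L (i + 1)
  have a0 := h.a0 i hh
  set e := startOf L (i + 1) with he
  refine ⟨20 * (e - startOf L i) + 40, by simp only [Test.cost, Expr.cost]; omega, ?_⟩
  refine runs_assign_seq (by simp only [Expr.Fits, Expr.eval, v12, v13, a0]; omega)
    (by simp only [Expr.cost]; omega) ?_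
  simp only [Expr.eval, v12, v13, a0, ← hsucc, Expr.cost]
  refine Runs.seq (T₁ := 10) (T₂ := 20 * (e - startOf L i) + 20) ?_ (by omega)
  -- Both branches reach this store: an empty sequence receives the sentinel n as its head, in
  -- agreement with `firstPos`.
  have hcont : ∀ τ, τ = (σ.setVar 17 e).setArr 2 (Function.update (σ.arr 2) i (firstPos L i)) →
      Runs W S (.seq (.put 3 (.var 13) (.var 17)) <| .seq markSeq <|
        .assign 13 (.add (.var 13) (.const 1))) τ (20 * (e - startOf L i) + 20)
      fun τ => ∃ i, LayoutInv L lg τ i ∧ i ≤ m ∧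
        20 * (n - startOf L i) + 50 * (m - i) + 3 ≤
          k - ((Test.lt (.var 13) (.var 1)).cost + (20 * (e - startOf L (σ.var 13)) + 40)) := by
    rintro _ rfl
    refine runs_put_seq (by simp [Expr.Fits, v13]; omega) (by simp [Expr.Fits]; omega)
      (by simp only [Expr.cost]; omega) ?_
    refine Runs.seq (T₁ := 20 * (e - startOf L i) + 3) (T₂ := 8) ?_
      (by simp only [Expr.cost]; omega)
    refine (runs_markSeq (i := i) (e := e) (n := n) (seqOf L) hW hn (by simpa using v13) (by omega)
      (by simp) hle (by simp [v12]; omega) ?_ (by simpa [v12] using h.a1)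
      (by simp [v12])).mono le_rfl ?_
    · intro p h1 h2
      refine seqOf_eq L hh ?_ h2
      simpa [v12] using h1
    rintro _ ⟨A, rfl, hA⟩
    refine runs_assign (by simp [Expr.Fits, Expr.eval, v13]; omega) (by simp [Expr.cost]) ?_
    refine ⟨i + 1, ⟨?_, ?_, ?_, ?_, ?_, ?_, ?_, ?_, ?_, ?_, ?_⟩, hh, ?_⟩
    · simpa using v0
    · simpa using v1
    · simpa using h.v2
    · simpa using h.v7
    · simp [he]
    · simp [Expr.eval, v13]
    · simpa using h.a0
    · simpa using hA
    · intro l hl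
      by_cases hli : l = i
      · subst hli; simp
      · have := h.a2 l (by omega)
        simpa [Function.update_of_ne hli] using this
    · intro l hl
      by_cases hli : l = i
      · subst hli; simp [Expr.eval, v13, he]
      · have := h.a3 l (by omega)
        simpa [Expr.eval, v13, Function.update_of_ne hli] using this
    · simpa using h.out
    · rw [v13, ← he]
      simp only [Test.cost, Expr.cost]
      omega
  rw [← v13] at hcont ⊢
  refine runs_branch (by simp [Test.Fits, Expr.Fits, v12]; omega) (by simp [Test.cost, Expr.cost])
    ?_ ?_
  · intro hb
    simp [Test.Holds, Expr.eval, v12] at hb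
    refine runs_put (by simp [Expr.Fits, v13]; omega) (by simp [Expr.Fits, v12]; omega)
      (by simp [Test.cost, Expr.cost]) (hcont _ ?_)
    rw [firstPos, v13, if_pos hb]
    simp [Expr.eval, v12, v13]
  · intro hb
    simp [Test.Holds, Expr.eval, v12] at hb
    refine runs_put (by simp [Expr.Fits, v13]; omega) (by simp [Expr.Fits, v0, -List.length_flatten]; omega)
      (by simp [Test.cost, Expr.cost]) (hcont _ ?_)
    rw [firstPos, v13, if_neg (by omega)]
    simp [Expr.eval, v0, v13]

theorem runs_prepare {L : List (List α)} {T : ℕ} (hL : ∀ s ∈ L, s.Pairwise (· ≤ ·))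
    (hW : 40 * L.flatten.length ≤ W) (hn : 2 ≤ L.flatten.length)
    (hm : L.length ≤ L.flatten.length) (hT : 150 * L.flatten.length ≤ T) :
    Runs W L.flatten prepare (mergeInput L) T fun τ =>
      BaseInv L.flatten L.length (Nat.log 2 L.flatten.length)
        (40 * (L.flatten.length / Nat.log 2 L.flatten.length)) (startOf L) (seqOf L) τ 0 ∧
      τ.var 3 = 8 := by
  set n := L.flatten.length with hnd
  have hdiv := Nat.div_le_self n (Nat.log 2 n)
  have hlog := Nat.log_le_self 2 n
  refine runs_assign_seq (by simp only [Expr.Fits, mergeInput, if_true]; omega)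
    (by simp only [Expr.cost]; omega) ?_
  refine Runs.seq (T₁ := 20 * n + 3) (T₂ := 70 * n + 30) ?_ (by simp only [Expr.cost]; omega)
  refine (runs_computeLog (n := n) (by omega) hW (by simp [Expr.eval, mergeInput, hnd])
    (by simp [mergeInput]) le_rfl).mono le_rfl ?_
  rintro _ ⟨x, rfl⟩
  refine runs_assign_seq (by simp [Expr.Fits]) (by simp only [Expr.cost]; omega) ?_
  refine Runs.seq (T₁ := 70 * n + 3) (T₂ := 20) ?_ (by simp only [Expr.cost]; omega)
  refine (runs_computeLayout (L := L) (lg := Nat.log 2 n) hW (by omega) hm ?_ (by omega)).mono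
    le_rfl ?_
  · refine ⟨?_, ?_, ?_, ?_, ?_, ?_, ?_, ?_, ?_, ?_, ?_⟩
    · simp [mergeInput]
    · simp [mergeInput]
    · simp
    · simp [mergeInput]
    · simp [mergeInput, startOf_zero]
    · simp [Expr.eval]
    · intro l hl
      simp [mergeInput, hl]
    · simp [startOf_zero]
    · simp
    · simp
    · simp [mergeInput]
  intro τ h
  have v0 : τ.var 0 = n := h.v0
  have v2 := h.v2
  refine runs_assign_seq (by simp [Expr.Fits]; omega) (by simp [Expr.cost]) ?_
  refine runs_assign (by simp [Expr.Fits, Expr.eval, v0, v2, -List.length_flatten]; omega)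
    (by simp [Expr.cost]) ?_
  refine ⟨⟨?_, ?_, ?_, ?_, ?_, ?_, ?_, ?_, ?_⟩, ?_⟩
  · simpa using h.v0
  · simpa using h.v1
  · simpa using v2
  · simp [Expr.eval, v0, v2, hnd]
  · simpa using h.v7
  · have := h.a1
    rw [startOf_length] at this
    simpa using this
  · simpa using h.a3
  · simpa [sortedPrefix_zero] using h.out
  · intro i hi
    have := h.a2 i hi
    simp only [Store.setVar_arr, this]
    exact isHead_firstPos L hL hi
  · simp [Expr.eval]

end Prepare

/-! ### The merging algorithm -/

/-- Replace the group size by its square, or by a number that makes a single group. -/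
def enlargeGroups : Prog :=
  .branch (.lt (.div (.add (.var 1) (.const 6)) (.var 3)) (.var 3))
    (.assign 3 (.add (.var 1) (.const 6))) (.assign 3 (.mul (.var 3) (.var 3)))

/-- A phase, followed by the choice of the group size of the next one. -/
def phase : Prog := .seq beginPhase (.seq mergeLoop enlargeGroups)

/-- The merging algorithm. -/
def mergeProg : Prog := .seq prepare (.loop (.lt (.var 7) (.var 0)) phase)

/-- The group size after `K`. -/
def nextSize (m K : ℕ) : ℕ := if (m + 6) / K < K then m + 6 else K * K

/-! ### The cost of all phases -/

section Main

variable {α : Type*} [LinearOrder α]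
variable {W m lg K Tmax t : ℕ} {S : List α} {st sq : ℕ → ℕ} {σ : Store α}

/-- Since K ≤ 2^(3·2^i), the outputs cost O(n·2^i). Setting up the trees costs O(m log n) and the
loads cost O((n / log n)·log n), both O(n). -/
theorem runs_phase {i T : ℕ} (hz : Sizes W S.length m lg K ((m + K - 1) / K))
    (hL : Layout S m st sq) (hlog : lg = Nat.log 2 S.length)
    (hTmax : Tmax = 40 * (S.length / lg))
    (h : BaseInv S m lg Tmax st sq σ t) (v3 : σ.var 3 = K) (ht : t ≤ S.length)
    (hK : K ≤ 2 ^ (3 * 2 ^ i)) (hT : 103000 * S.length * 2 ^ i ≤ T) :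
    Runs W S phase σ T fun τ => ∃ t', BaseInv S m lg Tmax st sq τ t' ∧ t' ≤ S.length ∧
      τ.var 3 = nextSize m K ∧
      ∀ D, 1 ≤ D → 6 * D ≤ K → LoadBound S (fun p => sq p / K) ((m + K - 1) / K) D →
        t' = S.length := by
  have hW := hz.hW
  have hn := hz.hn
  have hKm := hz.hKm
  have hmn := hz.m_le
  have hGm := hz.G_le
  have hmlg := hz.hmlg
  have hpow : S.length < 2 ^ (lg + 1) := by
    rw [hlog]; exact Nat.lt_pow_succ_log_self (by omega) _
  have hpow' : 2 ^ (lg + 4) = 8 * 2 ^ (lg + 1) := by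
    rw [show lg + 4 = (lg + 1) + 3 by omega, pow_add]; ring
  -- K ≤ m + 7 ≤ n + 7 and n < 2^(lg + 1); the additional factor 8 absorbs the 7.
  have hKj : K ≤ 2 ^ (lg + 4) := by omega
  have hGj : (m + K - 1) / K ≤ 2 ^ (lg + 4) := by omega
  have hone : 1 ≤ 2 ^ i := Nat.one_le_two_pow
  have hbig : S.length ≤ S.length * 2 ^ i := Nat.le_mul_of_pos_right _ hone
  have hT' : 103000 * (S.length * 2 ^ i) ≤ T := by rw [← Nat.mul_assoc]; exact hT
  have hb : (200 * (lg + 4) + 240) * m = 200 * (m * lg) + 1040 * m := by ring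
  have hTlg : Tmax * lg ≤ 40 * S.length := by
    rw [hTmax, Nat.mul_assoc]; exact Nat.mul_le_mul_left _ (Nat.div_mul_le_self _ _)
  have hTle : Tmax ≤ 40 * S.length := by
    rw [hTmax]; exact Nat.mul_le_mul_left _ (Nat.div_le_self _ _)
  have hl1 : (200 * (3 * 2 ^ i) + 200) * S.length = 600 * (S.length * 2 ^ i) + 200 * S.length := by
    ring
  have hl2 : (2 * (200 * (lg + 4) + 200) + 100) * Tmax = 400 * (Tmax * lg) + 2100 * Tmax := by ring
  refine Runs.seq (T₁ := 1740 * S.length)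
    (T₂ := 600 * (S.length * 2 ^ i) + 100200 * S.length + 30) ?_ (by omega)
  refine (runs_beginPhase (j := lg + 4) hz h v3 hKj hGj (by omega)).mono le_rfl ?_
  rintro τ ⟨hτ, h3, h9, h10⟩
  refine Runs.seq (T₁ := 600 * (S.length * 2 ^ i) + 100200 * S.length + 7) (T₂ := 20) ?_ (by omega)
  refine (runs_mergeLoop (j := 3 * 2 ^ i) (j' := lg + 4) hz hL hτ h9 h10 ht hTmax hK hKj hGj rfl rfl
    (by omega)).mono le_rfl ?_
  rintro ρ ⟨t', cnt, hρ, ht', hgood⟩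
  have v1 := hρ.v1
  have v3 := hρ.v3
  have hbase : ∀ x, BaseInv S m lg Tmax st sq (ρ.setVar 3 x) t' := fun x => by
    have := hρ.toBaseInv
    refine ⟨?_, ?_, ?_, ?_, ?_, ?_, ?_, ?_, ?_⟩
    · simpa using this.v0
    · simpa using this.v1
    · simpa using this.v2
    · simpa using this.v6
    · simpa using this.v7
    · simpa using this.a1
    · simpa using this.a3
    · simpa using this.out
    · simpa using this.head
  refine runs_branch ?_ (by simp [Test.cost, Expr.cost]) ?_ ?_
  · simp only [Test.Fits, Expr.Fits, Expr.eval, v1, v3]; omega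
  · intro hh
    simp only [Test.Holds, Expr.eval, v1, v3] at hh
    refine runs_assign (by simp only [Expr.Fits, Expr.eval, v1]; omega)
      (by simp [Test.cost, Expr.cost]) ⟨t', hbase _, ht', ?_, hgood⟩
    simp [Expr.eval, v1, nextSize, hh]
  · intro hh
    simp only [Test.Holds, Expr.eval, v1, v3] at hh
    have hKK : K * K ≤ m + 6 := by
      have := Nat.div_mul_le_self (m + 6) K
      have := Nat.mul_le_mul_right K (not_lt.1 hh)
      omega
    refine runs_assign (by simp only [Expr.Fits, Expr.eval, v3]; omega)
      (by simp [Test.cost, Expr.cost]) ⟨t', hbase _, ht', ?_, hgood⟩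
    simp [Expr.eval, v3, nextSize, hh]

/-- The condition compares K² with m + 6 by a division, because the product K·K might exceed the
capacity of a word. The alternative m + 6 gives a single group and is at least 6, as the load count
with D = 1 requires. -/
theorem nextSize_le {m K : ℕ} (hK : 1 ≤ K) : nextSize m K ≤ m + 6 ∧ nextSize m K ≤ K * K ∧
    (nextSize m K = K * K ∨ m ≤ nextSize m K) := by
  unfold nextSize
  split_ifs with h
  · refine ⟨le_rfl, ?_, Or.inr (by omega)⟩
    rw [Nat.div_lt_iff_lt_mul hK] at h
    exact h.le
  · refine ⟨?_, le_rfl, Or.inl rfl⟩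
    have := Nat.div_mul_le_self (m + 6) K
    have := Nat.mul_le_mul_right K (not_lt.1 h)
    omega

theorem loadBound_single {m K : ℕ} (hL : Layout S m st sq) (hm : 1 ≤ m) (hK : m ≤ K) :
    LoadBound S (fun p => sq p / K) ((m + K - 1) / K) 1 := by
  have hG : (m + K - 1) / K = 1 := by
    rw [show m + K - 1 = (m - 1) + K by omega, Nat.add_div_right _ (by omega),
      Nat.div_eq_of_lt (by omega)]
  rw [hG]
  refine loadBound_one (fun p q hpq => Nat.div_le_div_right (hL.mono hpq)) fun p hp => ?_
  have := hL.lt p hp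
  show sq p / K < 1
  rw [Nat.div_eq_of_lt (by omega)]
  exact one_pos

/-- A failed phase shows that K < 6D and K < m, so K is still exactly 2^(3·2^i) with i < I, and the
next phase has index i + 1. The costs c·2^i sum to less than c·2^(I + 1). -/
theorem runs_phases {T I D : ℕ} (hn : 2 ≤ S.length) (hm : 1 ≤ m) (hmlg : m * lg ≤ S.length)
    (hW : 40 * S.length ≤ W)
    (hL : Layout S m st sq) (hlog : lg = Nat.log 2 S.length)
    (hTmax : Tmax = 40 * (S.length / lg))
    (h : BaseInv S m lg Tmax st sq σ 0) (v3 : σ.var 3 = 8)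
    (hD : 1 ≤ D) (hI : 6 * D ≤ 2 ^ (3 * 2 ^ I))
    (hLB : ∀ K G, 1 ≤ K → (∀ p < S.length, sq p / K < G) → LoadBound S (fun p => sq p / K) G D)
    (hT : 104000 * S.length * 2 ^ (I + 1) ≤ T) :
    Runs W S (.loop (.lt (.var 7) (.var 0)) phase) σ T fun τ =>
      τ.out = sortedPrefix S S.length := by
  have hlg : 1 ≤ lg := by
    rw [hlog]; exact Nat.log_pos (by omega) hn
  have hlgn : lg ≤ S.length := by rw [hlog]; exact Nat.log_le_self _ _
  set c := 104000 * S.length with hc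
  -- The steps left are at least c(2^(I + 1) - 2^i), the total cost of the phases i to I. The bound
  -- `6 ≤ K` serves the single group, and `3 ≤ k` pays for the last test.
  refine runs_loop (fun k σ => ∃ t K, BaseInv S m lg Tmax st sq σ t ∧ σ.var 3 = K ∧
    t ≤ S.length ∧ 6 ≤ K ∧ K ≤ m + 7 ∧ 3 ≤ k ∧ (t < S.length → ∃ i ≤ I, K ≤ 2 ^ (3 * 2 ^ i) ∧
      (K = 2 ^ (3 * 2 ^ i) ∨ m ≤ K) ∧ c * 2 ^ (I + 1) ≤ k + c * 2 ^ i)) ?_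
    ⟨0, 8, h, v3, Nat.zero_le _, by omega, by omega, ?_, fun _ => ⟨0, Nat.zero_le _, by norm_num,
      Or.inl (by norm_num), by omega⟩⟩
  · rintro k σ ⟨t, K, h, v3, ht, hK6, hKm, hk3, hk⟩
    have v0 := h.v0
    have v7 := h.v7
    refine ⟨?_, by simpa only [Test.cost, Expr.cost] using hk3, ?_, ?_⟩
    · simp only [Test.Fits, Expr.Fits, v0, v7]; omega
    · intro hh
      simp only [Test.Holds, Expr.eval, v0, v7] at hh
      obtain rfl : t = S.length := by omega
      exact h.out
    intro hh
    simp only [Test.Holds, Expr.eval, v0, v7] at hh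
    obtain ⟨i, hiI, hKi, hKc, hbud⟩ := hk hh
    have hpi : 1 ≤ 2 ^ i := Nat.one_le_two_pow
    have hlarge : 208000 ≤ c * 2 ^ i := by
      refine le_trans ?_ (Nat.le_mul_of_pos_right c hpi)
      omega
    have hmono : c * 2 ^ (i + 1) ≤ c * 2 ^ (I + 1) :=
      Nat.mul_le_mul_left _ (Nat.pow_le_pow_right (by omega) (by omega))
    have hdouble : c * 2 ^ (i + 1) = 2 * (c * 2 ^ i) := by rw [pow_succ]; ring
    have hz : Sizes W S.length m lg K ((m + K - 1) / K) :=
      ⟨hn, hm, hlg, by omega, hKm, hmlg, hlgn, rfl, hW⟩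
    have hcost : 103000 * S.length * 2 ^ i + 6 ≤ c * 2 ^ i := by
      have h1 : c * 2 ^ i = 103000 * S.length * 2 ^ i + 1000 * (S.length * 2 ^ i) := by
        rw [hc]; ring
      have h2 : S.length ≤ S.length * 2 ^ i := Nat.le_mul_of_pos_right _ hpi
      omega
    refine ⟨103000 * S.length * 2 ^ i, ?_, ?_⟩
    · simp only [Test.cost, Expr.cost]; omega
    refine (runs_phase hz hL hlog hTmax h v3 ht hKi le_rfl).mono le_rfl ?_
    rintro τ ⟨t', hτ, ht', h3, hgood⟩
    obtain ⟨n1, n2, n3⟩ := nextSize_le (m := m) (K := K) (by omega)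
    have hcost1 : (Test.lt (.var 7) (.var 0)).cost = 3 := rfl
    rw [hcost1]
    refine ⟨t', nextSize m K, hτ, h3, ht', ?_, by omega, by omega, fun hlt => ?_⟩
    · unfold nextSize
      split_ifs
      · omega
      · exact le_trans hK6 (Nat.le_mul_of_pos_right K (by omega))
    have hDK : ¬ 6 * D ≤ K := fun hDK => by
      have := hgood D hD hDK (hLB _ _ (by omega) fun p hp => hz.div_lt (hL.lt p hp))
      omega
    -- With a single group the phase would have finished, because the load count then holds with D =
    -- 1.
    have hmK : ¬ m ≤ K := fun hmK => by
      have := hgood 1 le_rfl (by omega) (loadBound_single hL hm hmK)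
      omega
    have hKeq := hKc.resolve_right hmK
    have hiI' : i < I := by
      by_contra hle
      obtain rfl : i = I := by omega
      omega
    have hsq : K * K = 2 ^ (3 * 2 ^ (i + 1)) := by
      rw [hKeq, ← pow_add, pow_succ]
      congr 1
      ring
    refine ⟨i + 1, hiI', hsq ▸ n2, ?_, ?_⟩
    · rcases n3 with n3 | n3
      · exact Or.inl (n3.trans hsq)
      · exact Or.inr n3
    · omega
  · have : 1 ≤ 2 ^ (I + 1) := Nat.one_le_two_pow
    have := Nat.le_mul_of_pos_right c this
    omega

/-- Patterns of length at most one occur in every nonempty sequence. -/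
theorem two_le_of_seqAvoids {k : ℕ} {π : Equiv.Perm (Fin k)} (hS : SeqAvoids S π)
    (hn : 1 ≤ S.length) : 2 ≤ k := by
  by_contra hk
  apply hS
  have : Subsingleton (Fin k) := Fin.subsingleton_iff_le_one.2 (by omega)
  refine ⟨OrderEmbedding.ofStrictMono (fun _ => ⟨0, hn⟩) (Subsingleton.strictMono _), ?_⟩
  intro a b
  rw [Subsingleton.elim a b]
  simp

/-- The number of phases is at most logarithmic in the logarithm of the Füredi–Hajnal limit. -/
theorem exists_phases {c : ℝ} (hc : 1 ≤ c) : ∃ I : ℕ, 6 * ⌈c⌉₊ ≤ 2 ^ (3 * 2 ^ I) ∧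
    (2 : ℝ) ^ I ≤ 3 * (Real.logb 2 c + 1) := by
  have hex : ∃ I : ℕ, 6 * ⌈c⌉₊ ≤ 2 ^ (3 * 2 ^ I) := by
    refine ⟨6 * ⌈c⌉₊, ?_⟩
    have h1 : 6 * ⌈c⌉₊ < 2 ^ (6 * ⌈c⌉₊) := Nat.lt_two_pow_self
    have h2 : 2 ^ (6 * ⌈c⌉₊) < 2 ^ (2 ^ (6 * ⌈c⌉₊)) := Nat.lt_two_pow_self
    refine (h1.trans h2).le.trans (Nat.pow_le_pow_right (by omega) ?_)
    omega
  classical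
  refine ⟨Nat.find hex, Nat.find_spec hex, ?_⟩
  have hlog : 0 ≤ Real.logb 2 c := Real.logb_nonneg (by norm_num) hc
  rcases hI : Nat.find hex with _ | i
  · norm_num
    linarith
  · have hmin : ¬ 6 * ⌈c⌉₊ ≤ 2 ^ (3 * 2 ^ i) := Nat.find_min hex (by omega)
    have h1 : (2 : ℝ) ^ (3 * 2 ^ i) < 6 * ⌈c⌉₊ := by exact_mod_cast not_le.1 hmin
    have h2 : (⌈c⌉₊ : ℝ) < c + 1 := Nat.ceil_lt_add_one (by linarith)
    -- 6⌈c⌉ < 6(c + 1) ≤ 12c ≤ 2⁴c. The logarithm gives 3·2^i ≤ log c + 4 for the predecessor i of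
    -- the least suitable index, and doubling stays below the claimed bound.
    have h3 : (2 : ℝ) ^ (3 * 2 ^ i) ≤ 2 ^ 4 * c := by linarith
    have h4 : Real.logb 2 ((2 : ℝ) ^ (3 * 2 ^ i)) ≤ Real.logb 2 (2 ^ 4 * c) :=
      Real.logb_le_logb_of_le (by norm_num) (by positivity) h3
    rw [Real.logb_mul (by norm_num) (by linarith), Real.logb_pow, Real.logb_pow,
      Real.logb_self_eq_one (by norm_num)] at h4
    push_cast at h4
    rw [pow_succ]
    linarith

end Main

end PatternMerge

theorem mainTheorem3 :
    -- the limits that define the numbers `c_π` exist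
    (∀ (k : ℕ) (π : Equiv.Perm (Fin k)),
      Filter.Tendsto (fun n : ℕ => (PatternMerge.ex π n : ℝ) / n) Filter.atTop
        (nhds (PatternMerge.furediHajnal π))) ∧
    -- one program and two absolute constants serve all patterns and all inputs
    ∃ (P : PatternMerge.Prog) (B C : ℕ),
      ∀ (α : Type*) [LinearOrder α] (L : List (List α)) (k : ℕ) (π : Equiv.Perm (Fin k)) (n m : ℕ),
        n = L.flatten.length → m = L.length → 2 ≤ n →
        (∀ S ∈ L, S.Pairwise (· ≤ ·)) →
        PatternMerge.SeqAvoids L.flatten π →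
        (m : ℝ) ≤ n / Real.logb 2 n →
        ∃ (t : ℕ) (out : List α),
          PatternMerge.MergesTo (B * n) P L t out ∧
          out.Perm L.flatten ∧ out.Pairwise (· ≤ ·) ∧
          (t : ℝ) ≤ C * (Real.logb 2 (PatternMerge.furediHajnal π) + 1) * n := by
  open PatternMerge in
  -- Words up to 40n suffice for all counters and addresses, the load limit 40⌊n/lg⌋ included. The
  -- time is at most 150n + 104000·2·2^I·n, and 2^I ≤ 3(log c + 1) makes the coefficient at most
  -- 624150.
  refine ⟨fun k π => (tendsto_ex_div π).1, mergeProg, 40, 625000, ?_⟩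
  intro α _ L k π n m hn hm hn2 hL hS hmn
  set c := furediHajnal π with hc
  have hk : 2 ≤ k := two_le_of_seqAvoids hS (by omega)
  have hc1 : 1 ≤ c := one_le_furediHajnal π hk
  obtain ⟨I, hI, hIlog⟩ := exists_phases hc1
  have hn1 : (1 : ℝ) < n := by exact_mod_cast hn2
  have hlogpos : 0 < Real.logb 2 n := Real.logb_pos (by norm_num) hn1
  have hmlg : m * Nat.log 2 n ≤ n := by
    have h1 : (Nat.log 2 n : ℝ) ≤ Real.logb 2 n := Real.natLog_le_logb _ _
    rw [le_div_iff₀ hlogpos] at hmn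
    have h2 : (m : ℝ) * Nat.log 2 n ≤ n :=
      (mul_le_mul_of_nonneg_left h1 (Nat.cast_nonneg _)).trans hmn
    exact_mod_cast h2
  have hlg : 1 ≤ Nat.log 2 n := Nat.log_pos (by omega) hn2
  have hmle : m ≤ n := (Nat.le_mul_of_pos_right m hlg).trans hmlg
  have hm1 : 1 ≤ m := by
    rw [hm]
    refine List.length_pos_iff.2 fun h => ?_
    rw [h] at hn
    simp at hn
    omega
  have hD : 1 ≤ ⌈c⌉₊ := Nat.one_le_ceil_iff.2 (by linarith)
  -- Only the integer ⌈c⌉ enters the load count; rounding up changes log c by a bounded amount.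
  have hex : ∀ N, ex π N ≤ ⌈c⌉₊ * N := fun N => by
    have h1 := (tendsto_ex_div π).2 N
    have h2 : c * N ≤ (⌈c⌉₊ : ℝ) * N :=
      mul_le_mul_of_nonneg_right (Nat.le_ceil c) (Nat.cast_nonneg _)
    exact_mod_cast h1.trans h2
  subst hn hm
  have hlay := layout L hL
  obtain ⟨t, τ, hexec, ht, hout⟩ : Runs (40 * L.flatten.length) L.flatten mergeProg (mergeInput L)
      (150 * L.flatten.length + 104000 * L.flatten.length * 2 ^ (I + 1))
      fun τ => τ.out = sortedPrefix L.flatten L.flatten.length := by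
    refine Runs.seq ((runs_prepare hL le_rfl hn2 hmle le_rfl).mono le_rfl ?_) le_rfl
    rintro τ ⟨hτ, h3⟩
    exact runs_phases hn2 hm1 hmlg le_rfl hlay rfl rfl hτ h3 hD hI
      (fun K G _ hG => loadBound_of_avoids
        (fun p q hpq => Nat.div_le_div_right (hlay.mono hpq)) hG hS hex) le_rfl
  refine ⟨t, τ.out, ⟨τ, hexec, rfl⟩, ?_, ?_, ?_⟩
  · rw [hout]; exact sortedPrefix_perm
  · rw [hout]; exact sortedPrefix_pairwise
  · have ht' : (t : ℝ) ≤ 150 * L.flatten.length + 104000 * L.flatten.length * 2 ^ (I + 1) := by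
      exact_mod_cast ht
    have hlog : 0 ≤ Real.logb 2 c := Real.logb_nonneg (by norm_num) hc1
    have hpos : (0 : ℝ) ≤ L.flatten.length := Nat.cast_nonneg _
    have h1 : (L.flatten.length : ℝ) * 2 ^ I ≤ L.flatten.length * (3 * (Real.logb 2 c + 1)) :=
      mul_le_mul_of_nonneg_left hIlog hpos
    have h2 : 0 ≤ (L.flatten.length : ℝ) * Real.logb 2 c := mul_nonneg hpos hlog
    rw [pow_succ] at ht'
    push_cast
    nlinarith
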